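/- Let $d\in\mathbb N$, $T>0$, $M\in\mathbb R$ and $\varepsilon\in(0,1]$. Let $V\in C^2(\mathbb R^d;\mathbb R)$ and let $q,p\in\mathbb R^d$, $\alpha=\alpha_R+i\alpha_I\in\mathbb C^{d\times d}$, $B\in\mathbb R^{d\times d}$ be functions of $t\in[0,T]$ that solve $$\dot q=p,\qquad \dot p=-\nabla V(q),\qquad \dot\alpha=-2\alpha\alpha-\tfrac12\nabla\nabla V(q),\qquad \dot B=-2B\alpha_R,$$ where $\alpha_I(0)$ is positive definite and $B(0)=\sqrt{\alpha_I(0)}$. Define the residual potential $$U(\eta;q)=\varepsilon^{-3/2}\Big[V(q+\sqrt\varepsilon B^{-1}\eta)-V(q)-\sqrt\varepsilon\,\nabla V(q)(B^{-1}\eta)-\tfrac{\varepsilon}{2}(B^{-1}\eta)^T\nabla\nabla V(q)\,B^{-1}\eta\Big].$$ Let $w\in C([0,T];L^2(\mathbb R^d))$ be the weak solution (tested with Schwartz functions) of $$i\partial_t w=-\tfrac12\operatorname{tr}(B^T\nabla_\eta\nabla_\eta w\,B)+2\eta^TBB^T\eta\,w+\sqrt\varepsilon\,U(\eta;q(t))\,w,\qquad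 w(\eta,0)=\frac{2^{d/4}}{(\pi\varepsilon)^{d/4}}e^{-\eta^T\eta}.$$ (i) There is a constant $C$ that depends only on $d,T,M$ such that, if $|U(\eta;q(t))|\le M$ for all $\eta\in\mathbb R^d$ and $t\in[0,T]$, then $\|w(\cdot,t)\|_{L^2}\le C\varepsilon^{-d/4}$ for all $t\in[0,T]$. (ii) There is a constant $C$ that depends only on $d,T,M$ such that, if $|U(\eta;q(t))|\le M$ and $|\nabla_\eta U(\eta;q(t))|\le M$ for all $\eta\in\mathbb R^d$ and $t\in[0,T]$, then for all $t\in[0,T]$ the weak gradient $\nabla_\eta w(\cdot,t)$ exists in $L^2$ and $$\|\nabla_\eta w(\cdot,t)\|_{L^2}+\|\eta\, w(\cdot,t)\|_{L^2}\le C\varepsilon^{-d/4}.$$ (iii) There is a constant $C$ that depends only on $d,T,M$ and on the functions $q,p,\alpha,B$ on $[0,T]$ (not on $\varepsilon$, and on $V$ only through these functions) such that, under the assumptions of (ii), for all $t\in[0,T]$, $$\|\eta\,\nabla_\eta w(\cdot,t)\|_{L^2}:=\Big(\int_{\mathbb R^d}|\eta|^2|\nabla_\eta w(\eta,t)|^2\,d\eta\Big)^{1/2}\le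 C\varepsilon^{-d/4}.$$ -/

import Mathlib

open MeasureTheory Set
open scoped SchwartzMap Matrix

noncomputable section

/-- The Euclidean space `ℝ^d`. -/
abbrev Space (d : ℕ) : Type := EuclideanSpace ℝ (Fin d)

/-- The Hessian matrix `(∂_i ∂_j f (x))_{ij}` of a real- or complex-valued function on `ℝ^d`. -/
def hessian {d : ℕ} {F : Type*} [NormedAddCommGroup F] [NormedSpace ℝ F]
    (f : Space d → F) (x : Space d) : Matrix (Fin d) (Fin d) F :=
  Matrix.of fun i j =>
    fderiv ℝ (fderiv ℝ f) x (EuclideanSpace.single i 1) (EuclideanSpace.single j 1)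

/-- `(q, p, α, B)` solve on `[0, T]` the ordinary differential equations
`q' = p`, `p' = -∇V(q)`, `α' = -2 α α - (1/2) ∇∇V(q)`, `B' = -2 B α_R`, where `α_R`, `α_I` are the
real and imaginary parts of the complex matrix `α`, the matrix `α_I(0)` is positive definite, and
`B(0)` is the positive semidefinite square root of `α_I(0)`. -/
structure IsGWPTFlow {d : ℕ} (V : Space d → ℝ) (T : ℝ) (q p : ℝ → Space d)
    (α : ℝ → Matrix (Fin d) (Fin d) ℂ) (B : ℝ → Matrix (Fin d) (Fin d) ℝ) : Prop where
  deriv_q : ∀ t ∈ Icc 0 T, HasDerivWithinAt q (p t) (Icc 0 T) t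
  deriv_p : ∀ t ∈ Icc 0 T, HasDerivWithinAt p (-gradient V (q t)) (Icc 0 T) t
  deriv_α : ∀ t ∈ Icc 0 T, ∀ i j, HasDerivWithinAt (fun s => α s i j)
    (-2 * (α t * α t) i j - (1 / 2) * ((hessian V (q t) i j : ℝ) : ℂ)) (Icc 0 T) t
  deriv_B : ∀ t ∈ Icc 0 T, ∀ i j, HasDerivWithinAt (fun s => B s i j)
    (-2 * (B t * (α t).map Complex.re) i j) (Icc 0 T) t
  posDef_α : ((α 0).map Complex.im).PosDef
  posSemidef_B : (B 0).PosSemidef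
  sq_B : B 0 * B 0 = (α 0).map Complex.im

/-- The residual potential
`U(η; q) = ε^{-3/2} [V(q + √ε y) - V(q) - √ε ∇V(q) y - (ε/2) yᵀ ∇∇V(q) y]`, `y = B⁻¹ η`. -/
def residualPotential {d : ℕ} (ε : ℝ) (V : Space d → ℝ) (q : Space d)
    (B : Matrix (Fin d) (Fin d) ℝ) (η : Space d) : ℝ :=
  let y : Space d := WithLp.toLp 2 (B⁻¹ *ᵥ η.ofLp)
  (1 / ε ^ (3 / 2 : ℝ)) *
    (V (q + √ε • y) - V q - √ε * fderiv ℝ V q y - ε / 2 * (y.ofLp ⬝ᵥ (hessian V q *ᵥ y.ofLp)))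

/-- The quadratic Hamiltonian
`Ĥ_q φ = -(1/2) tr (Bᵀ ∇∇φ B) + 2 (ηᵀ B Bᵀ η) φ`. -/
def quadraticHamiltonian {d : ℕ} (B : Matrix (Fin d) (Fin d) ℝ) (φ : Space d → ℂ)
    (η : Space d) : ℂ :=
  -(1 / 2) * ((B.map Complex.ofReal)ᵀ * hessian φ η * B.map Complex.ofReal).trace
    + ((2 * (η.ofLp ⬝ᵥ ((B * Bᵀ) *ᵥ η.ofLp)) : ℝ) : ℂ) * φ η

/-- The full Hamiltonian `Ĥ φ = Ĥ_q φ + √ε U φ`. -/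
def hamiltonian {d : ℕ} (ε : ℝ) (V : Space d → ℝ) (q : Space d)
    (B : Matrix (Fin d) (Fin d) ℝ) (φ : Space d → ℂ) (η : Space d) : ℂ :=
  quadraticHamiltonian B φ η + ((√ε * residualPotential ε V q B η : ℝ) : ℂ) * φ η

/-- The initial value `w₀(η) = 2^{d/4} (π ε)^{-d/4} exp(-ηᵀη)`. -/
def initialValue (d : ℕ) (ε : ℝ) (η : Space d) : ℂ :=
  (((2 : ℝ) ^ ((d : ℝ) / 4) / (Real.pi * ε) ^ ((d : ℝ) / 4) * Real.exp (-‖η‖ ^ 2) : ℝ) : ℂ)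

/-- `w ∈ C([0, T]; L²(ℝ^d))` is a weak solution of the Cauchy problem `i ∂_t w = Ĥ(t) w`,
`w(·, 0) = w₀`. The coefficients of `Ĥ(t)` are real and `Ĥ(t)` is symmetric, so that tested with a
Schwartz function `φ` the equation reads `(d/dt) ∫ φ w = -i ∫ (Ĥ(t) φ) w`. -/
structure IsWSolution {d : ℕ} (ε : ℝ) (V : Space d → ℝ) (T : ℝ) (q : ℝ → Space d)
    (B : ℝ → Matrix (Fin d) (Fin d) ℝ)
    (w : ℝ → Lp ℂ 2 (volume : Measure (Space d))) : Prop where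
  continuousOn : ContinuousOn w (Icc 0 T)
  initial : (w 0 : Space d → ℂ) =ᵐ[volume] initialValue d ε
  equation : ∀ φ : 𝓢(Space d, ℂ), ∀ t ∈ Icc 0 T,
    HasDerivWithinAt (fun s => ∫ η, φ η * w s η)
      (-Complex.I * ∫ η, hamiltonian ε V (q t) (B t) φ η * w t η) (Icc 0 T) t

/-- `g ∈ L²(ℝ^d; ℂ^d)` is the weak gradient of `f` (which is meant to be in `L²(ℝ^d)`):
`∫ (∂_j φ) f = - ∫ φ g_j` for all Schwartz functions `φ` and all `j`. -/
structure HasWeakGradient {d : ℕ} (f : Space d → ℂ) (g : Space d → EuclideanSpace ℂ (Fin d)) :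
    Prop where
  memLp : MemLp g 2 volume
  integral_eq : ∀ φ : 𝓢(Space d, ℂ), ∀ j : Fin d,
    ∫ η, fderiv ℝ φ η (EuclideanSpace.single j 1) * f η = -∫ η, φ η * g η j

end

/-!
The solution is approximated by Galerkin solutions in the spaces `hermiteL2 d n` spanned by the
Hermite functions of degree at most `n`, for which all computations are finite-dimensional and all
test functions are Schwartz. With the momenta `D_k = -i ∂_k` and the positions `Y_k = 2 η_k`
(`phaseOp`), quadratic Hamiltonians are operators `∑ G a b X_a X_b` (`quadOp`), and the oscillator
`∑ X_a²` preserves every Hermite space. Weakly convergent subsequences are not needed: a Galerkin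
solution paired with the weak solution has a derivative that is controlled by the Galerkin residual,
so that bounded residuals imply strong convergence (`IsWeakSolution.tendsto_galerkin`), and bounds for
operators applied to the approximations pass to the limit (`exists_weak_image`).

*The norm and the energy.* The symbol of `-(1/2) tr (Bᵀ ∇∇ B) + 2 ηᵀ B Bᵀ η` is
`(1/2) diag (B Bᵀ, B Bᵀ)`. It commutes with the oscillator and preserves the Hermite spaces, so that
the residual comes from the bounded potential only; this gives `‖w t‖ ≤ ‖w 0‖`
(`IsWSolution.norm_le`), with no dependence on the flow. The energy `∑ ‖X_a u‖²` changes only through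
the commutator with the potential, that is, through its gradient, and Grönwall's inequality bounds it
(`IsWSolution.exists_tendsto_energy`).

*The weighted gradient.* Commuting the square of the oscillator with the potential would cost second
derivatives of `U`, which need not be bounded. Instead, the time derivative of the solution is
estimated. Multiplication by a phase `exp (-i ηᵀ A η / 2)` (`IsWeakSolution.gauge`) adds the
multiplication operator `ηᵀ A' η / 2` to the Hamiltonian. The choice
`A' = μ + (B⁻¹)ᵀ ∇∇V(q) B⁻¹` has two effects.

* The Hessian in `A'` completes `√ε U` to the first order Taylor remainder
  `ε⁻¹ (V(q + √ε y) - V(q) - √ε ∇V(q) y)`, `y = B⁻¹ η`. Along the flow its time derivative is a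
  directional derivative of `U`, multiplied by a function of linear growth, plus a quadratic form in
  `η` with bounded coefficients (`IsGWPTFlow.abs_totalPotential_sub_le`), although the Hessian itself
  is only continuous in time.
* For large `μ` the full symbol is positive definite (`gaugeSymbol_add_pos`), so that Gårding's
  inequality (`IsCCR.garding`) bounds all products `X_a X_b u` by the graph norm of the Hamiltonian.
  As the oscillator preserves the Hermite spaces, this persists for the compressions
  (`norm₂_hermiteRep_le`).

Hence the Hamiltonian is Lipschitz in time relative to its own graph norm, the graph norm propagates
(`IsSchrodingerCurve.graphNorm_le`), and second order bounds for the solution follow. They are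
invariant under the gauge up to constants. The Hessian along the trajectory is determined by the
Riccati equation for `α` (`IsGWPTFlow.hessian_eq`), so that the constants depend on the potential only
through the flow.
-/


/-! ### Linear ordinary differential equations -/

section LinearODE

variable {E : Type*} [NormedAddCommGroup E] [NormedSpace ℝ E]

/-- The radial retraction onto the closed ball of radius `R`. -/
noncomputable def radialRetraction (R : ℝ) (x : E) : E := (R / max R ‖x‖) • x

lemma radialRetraction_of_norm_le {R : ℝ} (hR : 0 < R) {x : E} (hx : ‖x‖ ≤ R) :
    radialRetraction R x = x := by
  simp [radialRetraction, max_eq_left hx, div_self hR.ne']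

lemma norm_radialRetraction_le_norm {R : ℝ} (hR : 0 < R) (x : E) :
    ‖radialRetraction R x‖ ≤ ‖x‖ := by
  have hm : 0 < max R ‖x‖ := lt_max_of_lt_left hR
  rw [radialRetraction, norm_smul, Real.norm_of_nonneg (by positivity)]
  exact mul_le_of_le_one_left (norm_nonneg _) ((div_le_one hm).2 (le_max_left _ _))

lemma norm_radialRetraction_le {R : ℝ} (hR : 0 < R) (x : E) : ‖radialRetraction R x‖ ≤ R := by
  have hm : 0 < max R ‖x‖ := lt_max_of_lt_left hR
  rw [radialRetraction, norm_smul, Real.norm_of_nonneg (by positivity), div_mul_eq_mul_div,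
    div_le_iff₀ hm]
  gcongr
  exact le_max_right _ _

lemma lipschitzWith_radialRetraction {R : ℝ} (hR : 0 < R) :
    LipschitzWith 2 (radialRetraction R : E → E) := by
  refine LipschitzWith.of_dist_le_mul fun x y => ?_
  rw [dist_eq_norm, dist_eq_norm]
  have hx : 0 < max R ‖x‖ := lt_max_of_lt_left hR
  have hy : 0 < max R ‖y‖ := lt_max_of_lt_left hR
  have h : radialRetraction R x - radialRetraction R y
      = (R / max R ‖x‖) • (x - y) + (R / max R ‖x‖ - R / max R ‖y‖) • y := by
    simp only [radialRetraction, smul_sub, sub_smul]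
    abel
  have h1 : R / max R ‖x‖ ≤ 1 := (div_le_one hx).2 (le_max_left _ _)
  have h2 : |R / max R ‖x‖ - R / max R ‖y‖| * ‖y‖ ≤ ‖x - y‖ := by
    have h3 : R / max R ‖x‖ - R / max R ‖y‖
        = R / max R ‖x‖ * ((max R ‖y‖ - max R ‖x‖) / max R ‖y‖) := by
      field_simp
    have h4 : |max R ‖y‖ - max R ‖x‖| ≤ ‖x - y‖ := by
      refine (abs_max_sub_max_le_max R ‖y‖ R ‖x‖).trans ?_
      simp only [sub_self, abs_zero]
      rw [norm_sub_rev]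
      exact max_le (norm_nonneg _) (abs_norm_sub_norm_le _ _)
    rw [h3, abs_mul, abs_div (max R ‖y‖ - max R ‖x‖),
      abs_of_pos (by positivity : 0 < R / max R ‖x‖), abs_of_pos hy]
    calc R / max R ‖x‖ * (|max R ‖y‖ - max R ‖x‖| / max R ‖y‖) * ‖y‖
        ≤ 1 * (‖x - y‖ / max R ‖y‖) * max R ‖y‖ := by
          gcongr
          exact le_max_right _ _
      _ = ‖x - y‖ := by field_simp
  calc ‖radialRetraction R x - radialRetraction R y‖
      ≤ ‖(R / max R ‖x‖) • (x - y)‖ + ‖(R / max R ‖x‖ - R / max R ‖y‖) • y‖ := by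
        rw [h]; exact norm_add_le _ _
    _ = R / max R ‖x‖ * ‖x - y‖ + |R / max R ‖x‖ - R / max R ‖y‖| * ‖y‖ := by
        rw [norm_smul, norm_smul, Real.norm_of_nonneg (by positivity : 0 ≤ R / max R ‖x‖),
          Real.norm_eq_abs]
    _ ≤ 1 * ‖x - y‖ + ‖x - y‖ := by gcongr
    _ = ((2 : NNReal) : ℝ) * ‖x - y‖ := by push_cast; ring

/-- A linear differential equation with continuous coefficients has a solution on the whole
interval. The field is cut off by the radial retraction onto a ball, which makes it bounded, and
Grönwall's inequality shows that the solution stays in the ball. -/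
theorem exists_linearODE_solution [CompleteSpace E] {T : ℝ} (hT : 0 ≤ T) {A : ℝ → E →L[ℝ] E}
    (hA : ContinuousOn A (Icc 0 T)) (x₀ : E) :
    ∃ x : ℝ → E, x 0 = x₀ ∧ ∀ t ∈ Icc 0 T, HasDerivWithinAt x (A t (x t)) (Icc 0 T) t := by
  obtain ⟨K, hK⟩ := isCompact_Icc.exists_bound_of_continuousOn hA
  have hK0 : 0 ≤ K := (norm_nonneg _).trans (hK 0 ⟨le_rfl, hT⟩)
  set R : ℝ := ‖x₀‖ * Real.exp (K * T) + 1
  have hR : 0 < R := by positivity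
  set f : ℝ → E → E := fun t x => A t (radialRetraction R x)
  have hle : ∀ t ∈ Icc 0 T, ∀ x, ‖f t x‖ ≤ K * ‖radialRetraction R x‖ := fun t ht x =>
    ((A t).le_opNorm _).trans (by gcongr; exact hK t ht)
  have hpl : IsPicardLindelof f (tmin := 0) (tmax := T) ⟨0, le_rfl, hT⟩ x₀
      (Real.toNNReal (K * R * T)) 0 (Real.toNNReal (K * R)) (Real.toNNReal K * 2) := by
    refine ⟨fun t ht => LipschitzWith.lipschitzOnWith ?_, fun x _ => ?_, fun t ht x _ => ?_, ?_⟩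
    · refine LipschitzWith.comp ((A t).lipschitz.weaken ?_) (lipschitzWith_radialRetraction hR)
      exact NNReal.coe_le_coe.1 (by simpa [hK0] using hK t ht)
    · exact hA.clm_apply continuousOn_const
    · rw [Real.coe_toNNReal _ (by positivity)]
      exact (hle t ht x).trans (by gcongr; exact norm_radialRetraction_le hR x)
    · simp only [NNReal.coe_zero, sub_zero]
      rw [Real.coe_toNNReal _ (by positivity), Real.coe_toNNReal _ (by positivity)]
      simp [hT]
  obtain ⟨x, hx0, hx⟩ := hpl.exists_eq_forall_mem_Icc_hasDerivWithinAt₀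
  refine ⟨x, hx0, fun t ht => ?_⟩
  have hcont : ContinuousOn x (Icc 0 T) := fun s hs => (hx s hs).continuousWithinAt
  have hb : ∀ s ∈ Icc 0 T, ‖x s‖ ≤ gronwallBound ‖x₀‖ K 0 (s - 0) := by
    refine norm_le_gronwallBound_of_norm_deriv_right_le hcont
      (f' := fun s => f s (x s)) (fun s hs => ?_) (by rw [hx0]) (fun s hs => ?_)
    · exact (hx s (Ico_subset_Icc_self hs)).mono_of_mem_nhdsWithin (Icc_mem_nhdsGE_of_mem hs)
    · rw [add_zero]
      exact (hle s (Ico_subset_Icc_self hs) _).trans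
        (by gcongr; exact norm_radialRetraction_le_norm hR _)
  have ht' : ‖x t‖ ≤ R := by
    refine (hb t ht).trans ?_
    rw [gronwallBound_ε0, sub_zero]
    have : Real.exp (K * t) ≤ Real.exp (K * T) := by gcongr; exact ht.2
    have := mul_le_mul_of_nonneg_left this (norm_nonneg x₀)
    linarith
  have := hx t ht
  rwa [show f t (x t) = A t (x t) by
    simp only [f]; rw [radialRetraction_of_norm_le hR ht']] at this

end LinearODE


/-! ### Quadratic operators in a representation of the canonical commutation relations -/

section CCR

variable {H S A : Type*} [NormedAddCommGroup H] [InnerProductSpace ℂ H] [AddCommGroup S]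
  [Module ℂ S] [Fintype A]

/-- Operators `X a` on a space `S`, embedded by `ι` into a Hilbert space, that are symmetric and
satisfy the canonical commutation relations `[X a, X b] = i σ a b`. -/
structure IsCCR (ι : S →ₗ[ℂ] H) (X : A → S →ₗ[ℂ] S) (σ : A → A → ℝ) : Prop where
  symm : ∀ a f g, inner ℂ (ι (X a f)) (ι g) = inner ℂ (ι f) (ι (X a g))
  comm : ∀ a b f, X a (X b f) = X b (X a f) + (Complex.I * σ a b) • f

/-- The quadratic operator `∑ G a b X a X b`. -/
noncomputable def quadOp (X : A → S →ₗ[ℂ] S) (G : Matrix A A ℝ) : S →ₗ[ℂ] S :=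
  ∑ a, ∑ b, ((G a b : ℝ) : ℂ) • (X a ∘ₗ X b)

lemma quadOp_apply (X : A → S →ₗ[ℂ] S) (G : Matrix A A ℝ) (u : S) :
    quadOp X G u = ∑ a, ∑ b, ((G a b : ℝ) : ℂ) • X a (X b u) := by
  simp [quadOp]

/-- The oscillator `∑ X a X a`. -/
noncomputable def oscillator (X : A → S →ₗ[ℂ] S) : S →ₗ[ℂ] S := ∑ a, X a ∘ₗ X a

lemma oscillator_apply (X : A → S →ₗ[ℂ] S) (u : S) : oscillator X u = ∑ a, X a (X a u) := by
  simp [oscillator]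

/-- The second order Sobolev-type norm `(∑ ‖X a X c u‖²)^{1/2}`. -/
noncomputable def norm₂ (ι : S →ₗ[ℂ] H) (X : A → S →ₗ[ℂ] S) (u : S) : ℝ :=
  √(∑ c, ∑ a, ‖ι (X a (X c u))‖ ^ 2)

variable {ι : S →ₗ[ℂ] H} {X : A → S →ₗ[ℂ] S} {σ : A → A → ℝ}

lemma norm₂_nonneg (u : S) : 0 ≤ norm₂ ι X u := Real.sqrt_nonneg _

lemma norm₂_sq (u : S) : norm₂ ι X u ^ 2 = ∑ c, ∑ a, ‖ι (X a (X c u))‖ ^ 2 :=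
  Real.sq_sqrt (by positivity)

lemma norm_le_norm₂ (a c : A) (u : S) : ‖ι (X a (X c u))‖ ≤ norm₂ ι X u := by
  refine Real.le_sqrt_of_sq_le ?_
  refine le_trans ?_ (Finset.single_le_sum (f := fun c => ∑ a, ‖ι (X a (X c u))‖ ^ 2)
    (fun _ _ => by positivity) (Finset.mem_univ c))
  exact Finset.single_le_sum (f := fun a => ‖ι (X a (X c u))‖ ^ 2)
    (fun _ _ => by positivity) (Finset.mem_univ a)

lemma norm_quadOp_le (G : Matrix A A ℝ) (u : S) :
    ‖ι (quadOp X G u)‖ ≤ (∑ a, ∑ b, |G a b|) * norm₂ ι X u := by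
  rw [quadOp_apply]
  simp only [map_sum, map_smul, Finset.sum_mul]
  refine (norm_sum_le _ _).trans (Finset.sum_le_sum fun a _ => ?_)
  refine (norm_sum_le _ _).trans (Finset.sum_le_sum fun b _ => ?_)
  rw [norm_smul, Complex.norm_real, Real.norm_eq_abs]
  gcongr
  exact norm_le_norm₂ a b u

namespace IsCCR

lemma inner_oscillator_self (h : IsCCR ι X σ) (u : S) :
    inner ℂ (ι u) (ι (oscillator X u)) = ((∑ a, ‖ι (X a u)‖ ^ 2 : ℝ) : ℂ) := by
  rw [oscillator_apply]
  simp only [map_sum, inner_sum]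
  push_cast
  refine Finset.sum_congr rfl fun a _ => ?_
  rw [← h.symm, inner_self_eq_norm_sq_to_K]
  simp

lemma sum_norm_sq_le (h : IsCCR ι X σ) (u : S) :
    ∑ a, ‖ι (X a u)‖ ^ 2 ≤ ‖ι u‖ * ‖ι (oscillator X u)‖ := by
  have := norm_inner_le_norm (𝕜 := ℂ) (ι u) (ι (oscillator X u))
  rw [h.inner_oscillator_self, Complex.norm_real, Real.norm_of_nonneg (by positivity)] at this
  exact this

lemma symm_quadOp (h : IsCCR ι X σ) {G : Matrix A A ℝ} (hG : G.IsSymm) (u v : S) :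
    inner ℂ (ι (quadOp X G u)) (ι v) = inner ℂ (ι u) (ι (quadOp X G v)) := by
  simp only [quadOp_apply, map_sum, map_smul, inner_sum, sum_inner, inner_smul_left,
    inner_smul_right, h.symm, Complex.conj_ofReal]
  rw [Finset.sum_comm]
  refine Finset.sum_congr rfl fun a _ => Finset.sum_congr rfl fun b _ => ?_
  rw [hG.apply]

/-- Commuting one factor `X c` of `X c X c` through a quadratic operator leaves a sum of squares
and terms of lower order. -/
lemma inner_sq_quadOp (h : IsCCR ι X σ) (G : Matrix A A ℝ) (c : A) (u : S) :
    inner ℂ (ι (X c (X c u))) (ι (quadOp X G u))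
      = (∑ a, ∑ b, (G a b : ℂ) * inner ℂ (ι (X a (X c u))) (ι (X b (X c u))))
        + Complex.I * ∑ a, ∑ b, (G a b : ℂ) * (σ c a * inner ℂ (ι (X c u)) (ι (X b u))
          + σ c b * inner ℂ (ι (X c u)) (ι (X a u))) := by
  rw [quadOp_apply]
  simp only [map_sum, map_smul, inner_sum, inner_smul_right, Finset.mul_sum,
    ← Finset.sum_add_distrib]
  refine Finset.sum_congr rfl fun a _ => Finset.sum_congr rfl fun b _ => ?_
  rw [h.symm c (X c u), h.comm c a, h.comm c b, map_add, map_add, map_add, h.symm a (X c u)]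
  simp only [map_smul, inner_add_right, inner_smul_right]
  ring

/-- The lower order terms in the commutation of the oscillator with a quadratic operator. -/
lemma norm_lower_order_le {s Γ : ℝ} (hs : ∀ a b, |σ a b| ≤ s) {G : Matrix A A ℝ}
    (hΓ : ∀ a b, |G a b| ≤ Γ) (u : S) :
    ‖∑ c, ∑ a, ∑ b, (G a b : ℂ) * (σ c a * inner ℂ (ι (X c u)) (ι (X b u))
          + σ c b * inner ℂ (ι (X c u)) (ι (X a u)))‖
      ≤ 2 * Γ * s * (Fintype.card A) ^ 2 * ∑ c, ‖ι (X c u)‖ ^ 2 := by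
  have h1 : ∀ c b, ‖inner ℂ (ι (X c u)) (ι (X b u))‖
      ≤ (‖ι (X c u)‖ ^ 2 + ‖ι (X b u)‖ ^ 2) / 2 := fun c b => by
    refine (norm_inner_le_norm _ _).trans ?_
    nlinarith [sq_nonneg (‖ι (X c u)‖ - ‖ι (X b u)‖)]
  calc _ ≤ ∑ c, ∑ a, ∑ b, Γ * (s * ((‖ι (X c u)‖ ^ 2 + ‖ι (X b u)‖ ^ 2) / 2)
            + s * ((‖ι (X c u)‖ ^ 2 + ‖ι (X a u)‖ ^ 2) / 2)) := by
        refine (norm_sum_le _ _).trans (Finset.sum_le_sum fun c _ => ?_)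
        refine (norm_sum_le _ _).trans (Finset.sum_le_sum fun a _ => ?_)
        refine (norm_sum_le _ _).trans (Finset.sum_le_sum fun b _ => ?_)
        have hs0 : 0 ≤ s := (abs_nonneg _).trans (hs c a)
        have hΓ0 : 0 ≤ Γ := (abs_nonneg _).trans (hΓ c a)
        rw [norm_mul, Complex.norm_real, Real.norm_eq_abs]
        refine mul_le_mul (hΓ a b) ((norm_add_le _ _).trans ?_) (norm_nonneg _) hΓ0
        rw [norm_mul, norm_mul, Complex.norm_real, Complex.norm_real, Real.norm_eq_abs,
          Real.norm_eq_abs]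
        exact add_le_add (mul_le_mul (hs c a) (h1 c b) (norm_nonneg _) hs0)
          (mul_le_mul (hs c b) (h1 c a) (norm_nonneg _) hs0)
    _ = _ := by
        simp only [← Finset.mul_sum, Finset.sum_add_distrib, ← Finset.sum_div, Finset.sum_const,
          Finset.card_univ, nsmul_eq_mul]
        ring

lemma inner_oscillator_quadOp (h : IsCCR ι X σ) (G : Matrix A A ℝ) (u : S) :
    inner ℂ (ι (oscillator X u)) (ι (quadOp X G u))
      = (∑ c, ∑ a, ∑ b, (G a b : ℂ) * inner ℂ (ι (X a (X c u))) (ι (X b (X c u))))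
        + Complex.I * ∑ c, ∑ a, ∑ b, (G a b : ℂ) * (σ c a * inner ℂ (ι (X c u)) (ι (X b u))
          + σ c b * inner ℂ (ι (X c u)) (ι (X a u))) := by
  rw [oscillator_apply, map_sum, sum_inner, Finset.mul_sum, ← Finset.sum_add_distrib]
  exact Finset.sum_congr rfl fun c _ => h.inner_sq_quadOp G c u

lemma norm_oscillator_le (u : S) :
    ‖ι (oscillator X u)‖ ≤ √(Fintype.card A) * norm₂ ι X u := by
  rw [norm₂, ← Real.sqrt_mul (by positivity)]
  refine Real.le_sqrt_of_sq_le ?_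
  rw [oscillator_apply, map_sum]
  calc ‖∑ a, ι (X a (X a u))‖ ^ 2 ≤ (∑ a, ‖ι (X a (X a u))‖) ^ 2 := by
        gcongr; exact norm_sum_le _ _
    _ ≤ Fintype.card A * ∑ a, ‖ι (X a (X a u))‖ ^ 2 := by
        simpa using sq_sum_le_card_mul_sum_sq (s := Finset.univ) (f := fun a => ‖ι (X a (X a u))‖)
    _ ≤ _ := by
        gcongr with a
        exact Finset.single_le_sum (f := fun c => ‖ι (X c (X a u))‖ ^ 2)
          (fun _ _ => by positivity) (Finset.mem_univ a)

/-- Gårding's inequality: a positive definite quadratic operator, paired with the oscillator,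
controls all products of two of the `X a`. -/
lemma garding (h : IsCCR ι X σ) {s Γ g : ℝ} (hs : ∀ a b, |σ a b| ≤ s) {G : Matrix A A ℝ}
    (hΓ : ∀ a b, |G a b| ≤ Γ)
    (hpos : ∀ v : A → H, g * ∑ a, ‖v a‖ ^ 2 ≤ (∑ a, ∑ b, (G a b : ℂ) * inner ℂ (v a) (v b)).re)
    (u : S) :
    g * norm₂ ι X u ^ 2 ≤ (inner ℂ (ι (oscillator X u)) (ι (quadOp X G u))).re
      + 2 * Γ * s * (Fintype.card A) ^ 2 * ∑ c, ‖ι (X c u)‖ ^ 2 := by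
  have h1 := norm_lower_order_le (ι := ι) (X := X) hs hΓ u
  rw [h.inner_oscillator_quadOp, Complex.add_re, Complex.re_sum, norm₂_sq, Finset.mul_sum]
  have h2 := Finset.sum_le_sum fun c (_ : c ∈ Finset.univ) => hpos fun a => ι (X a (X c u))
  have h3 := (Complex.abs_re_le_norm (Complex.I * ∑ c, ∑ a, ∑ b, (G a b : ℂ) *
    (σ c a * inner ℂ (ι (X c u)) (ι (X b u)) + σ c b * inner ℂ (ι (X c u)) (ι (X a u)))))
  rw [norm_mul, Complex.norm_I, one_mul] at h3
  have h4 := (abs_le.1 (h3.trans h1)).1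
  linarith

/-- A quadratic operator whose symbol Poisson commutes with the oscillator commutes with it; the
condition is that `σ G` is antisymmetric. -/
lemma im_inner_oscillator_quadOp_eq_zero (h : IsCCR ι X σ) {G : Matrix A A ℝ} (hG : G.IsSymm)
    (hσ : ∀ b c, ∑ a, σ c a * G a b + ∑ a, σ b a * G a c = 0) (u : S) :
    (inner ℂ (ι (oscillator X u)) (ι (quadOp X G u))).im = 0 := by
  have key : ∀ z : A → A → ℂ, (∀ a b, (starRingEnd ℂ) (z a b) = z b a) →
      (∑ a, ∑ b, (G a b : ℂ) * z a b).im = 0 := fun z hz => by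
    refine Complex.conj_eq_iff_im.1 ?_
    simp only [map_sum, map_mul, Complex.conj_ofReal, hz]
    rw [Finset.sum_comm]
    simp only [hG.apply]
  rw [h.inner_oscillator_quadOp, Complex.add_im, Complex.im_sum]
  rw [Finset.sum_eq_zero fun c _ => key _ fun a b => by simp, zero_add, Complex.mul_im]
  simp only [Complex.I_re, Complex.I_im, zero_mul, one_mul, zero_add]
  set z : A → A → ℂ := fun c b => inner ℂ (ι (X c u)) (ι (X b u))
  have hz : ∀ c b, (z b c).re = (z c b).re := fun c b => by
    have : (starRingEnd ℂ) (z b c) = z c b := by simp [z]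
    rw [← this, Complex.conj_re]
  have e : (∑ c, ∑ a, ∑ b, (G a b : ℂ) * (σ c a * z c b + σ c b * z c a)).re
      = 2 * ∑ c, ∑ b, (∑ a, σ c a * G a b) * (z c b).re := by
    have e1 : ∀ c, (∑ a, ∑ b, (G a b : ℂ) * (σ c a * z c b + σ c b * z c a)).re
        = ∑ b, (∑ a, σ c a * G a b) * (z c b).re + ∑ b, (∑ a, σ c a * G a b) * (z c b).re := by
      intro c
      simp only [Complex.re_sum, mul_add, Complex.add_re, Finset.sum_add_distrib,
        Finset.sum_mul]
      congr 1
      · rw [Finset.sum_comm]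
        refine Finset.sum_congr rfl fun b _ => Finset.sum_congr rfl fun a _ => ?_
        rw [← mul_assoc, ← Complex.ofReal_mul, Complex.re_ofReal_mul]; ring
      · refine Finset.sum_congr rfl fun b _ => Finset.sum_congr rfl fun a _ => ?_
        rw [← mul_assoc, ← Complex.ofReal_mul, Complex.re_ofReal_mul, hG.apply]; ring
    rw [Complex.re_sum, Finset.sum_congr rfl fun c _ => e1 c, Finset.sum_add_distrib]
    ring
  have e2 : ∑ c, ∑ b, (∑ a, σ c a * G a b) * (z c b).re
      = - ∑ c, ∑ b, (∑ a, σ c a * G a b) * (z c b).re := by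
    conv_lhs => rw [Finset.sum_comm]
    rw [← Finset.sum_neg_distrib]
    refine Finset.sum_congr rfl fun b _ => ?_
    rw [← Finset.sum_neg_distrib]
    refine Finset.sum_congr rfl fun c _ => ?_
    rw [← hz b c]
    linear_combination (z c b).re * hσ b c
  rw [e]
  linarith

end IsCCR

end CCR


/-! ### The Schrödinger equation in a finite-dimensional space -/

section FiniteDimensional

open Filter Topology

variable {F : Type*} [NormedAddCommGroup F] [InnerProductSpace ℂ F]

/-- `u` solves `i u' = L(t) u` on `[0, T]`. -/
def IsSchrodingerCurve (T : ℝ) (L : ℝ → F →L[ℂ] F) (u : ℝ → F) : Prop :=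
  ∀ t ∈ Icc 0 T, HasDerivWithinAt u (-Complex.I • L t (u t)) (Icc 0 T) t

lemma exists_schrodingerCurve [CompleteSpace F] {T : ℝ} (hT : 0 ≤ T) {L : ℝ → F →L[ℂ] F}
    (hL : ContinuousOn L (Icc 0 T)) (x₀ : F) :
    ∃ u, u 0 = x₀ ∧ IsSchrodingerCurve T L u := by
  have hA : ContinuousOn (fun t => (-Complex.I • L t).restrictScalars ℝ) (Icc 0 T) :=
    (ContinuousLinearMap.restrictScalarsL ℂ F F ℝ ℝ).continuous.comp_continuousOn
      (hL.const_smul (-Complex.I))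
  obtain ⟨u, h0, hu⟩ := exists_linearODE_solution hT hA x₀
  exact ⟨u, h0, fun t ht => by simpa using hu t ht⟩

/-- The Schrödinger equation can also be solved backwards in time. -/
lemma exists_schrodingerCurve_terminal [CompleteSpace F] {T : ℝ} (hT : 0 ≤ T) {L : ℝ → F →L[ℂ] F}
    (hL : ContinuousOn L (Icc 0 T)) (x₀ : F) :
    ∃ u, u T = x₀ ∧ IsSchrodingerCurve T L u := by
  have hmaps : MapsTo (fun t => T - t) (Icc 0 T) (Icc 0 T) := fun t ht =>
    ⟨by linarith [ht.2], by linarith [ht.1]⟩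
  have hA : ContinuousOn (fun t => -L (T - t)) (Icc 0 T) :=
    (hL.comp (by fun_prop) hmaps).neg
  obtain ⟨u, h0, hu⟩ := exists_schrodingerCurve hT hA x₀
  refine ⟨fun t => u (T - t), by simpa using h0, fun t ht => ?_⟩
  have h1 := HasDerivWithinAt.scomp (g₁ := u) t (hu (T - t) (hmaps ht))
    ((hasDerivWithinAt_id t (Icc 0 T)).const_sub T) hmaps
  simpa [Function.comp_def] using h1

namespace IsSchrodingerCurve

variable {T : ℝ} {L : ℝ → F →L[ℂ] F} {u : ℝ → F}

protected lemma continuousOn (h : IsSchrodingerCurve T L u) : ContinuousOn u (Icc 0 T) :=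
  fun t ht => (h t ht).continuousWithinAt

/-- The derivative of the expectation of a symmetric operator. -/
lemma hasDerivWithinAt_expectation (h : IsSchrodingerCurve T L u) (E : F →L[ℂ] F)
    (hE : ∀ x y, inner ℂ (E x) y = inner ℂ x (E y)) {t : ℝ} (ht : t ∈ Icc 0 T) :
    HasDerivWithinAt (fun s => (inner ℂ (E (u s)) (u s)).re)
      (2 * (inner ℂ (E (u t)) (L t (u t))).im) (Icc 0 T) t := by
  have h1 : HasDerivWithinAt (fun s => E (u s)) (E (-Complex.I • L t (u t))) (Icc 0 T) t :=
    ((E.restrictScalars ℝ).hasFDerivAt.comp_hasDerivWithinAt t (h t ht))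
  have h2 := HasDerivWithinAt.inner ℂ h1 (h t ht)
  have h3 := (Complex.reCLM.hasFDerivAt.comp_hasDerivWithinAt t h2)
  refine (h3.congr_deriv ?_)
  have h4 : inner ℂ (E (-Complex.I • L t (u t))) (u t)
      = (starRingEnd ℂ) (inner ℂ (E (u t)) (-Complex.I • L t (u t))) := by
    rw [inner_conj_symm, hE]
  rw [h4]
  simp only [Complex.reCLM_apply, Complex.add_re, Complex.conj_re, inner_smul_right,
    Complex.mul_re, Complex.neg_re, Complex.neg_im, Complex.I_re, Complex.I_im]
  ring

lemma norm_eq (h : IsSchrodingerCurve T L u)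
    (hL : ∀ t ∈ Icc 0 T, ∀ x y, inner ℂ (L t x) y = inner ℂ x (L t y))
    {s t : ℝ} (hs : s ∈ Icc 0 T) (ht : t ∈ Icc 0 T) : ‖u s‖ = ‖u t‖ := by
  have h0 : ∀ r ∈ Icc 0 T, HasDerivWithinAt (fun r => (inner ℂ (u r) (u r)).re) 0 (Icc 0 T) r := by
    intro r hr
    have := h.hasDerivWithinAt_expectation (ContinuousLinearMap.id ℂ F) (fun _ _ => rfl) hr
    refine this.congr_deriv ?_
    have h5 : (starRingEnd ℂ) (inner ℂ (u r) (L r (u r))) = inner ℂ (u r) (L r (u r)) := by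
      rw [inner_conj_symm, hL r hr]
    simp [Complex.conj_eq_iff_im.1 h5]
  have h1 := (convex_Icc 0 T).norm_image_sub_le_of_norm_hasDerivWithin_le (C := 0) h0
    (by simp) hs ht
  have h2 : (inner ℂ (u t) (u t)).re = (inner ℂ (u s) (u s)).re := by
    rw [zero_mul] at h1
    exact sub_eq_zero.1 (norm_le_zero_iff.1 h1)
  have h3 : ∀ x : F, (inner ℂ x x).re = ‖x‖ ^ 2 := fun x => by
    rw [inner_self_eq_norm_sq_to_K]; norm_cast
  rw [h3, h3] at h2
  exact ((sq_eq_sq₀ (norm_nonneg _) (norm_nonneg _)).1 h2).symm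

/-- Grönwall's inequality for the expectation of a symmetric operator. -/
lemma expectation_le (h : IsSchrodingerCurve T L u) (hT : 0 ≤ T)
    (hL : ∀ t ∈ Icc 0 T, ∀ x y, inner ℂ (L t x) y = inner ℂ x (L t y)) (E : F →L[ℂ] F)
    (hE : ∀ x y, inner ℂ (E x) y = inner ℂ x (E y)) {c : ℝ}
    (hb : ∀ t ∈ Icc 0 T, ∀ x, 2 * (inner ℂ (E x) (L t x)).im
      ≤ (inner ℂ (E x) x).re + c * ‖x‖ ^ 2) {t : ℝ} (ht : t ∈ Icc 0 T) :
    (inner ℂ (E (u t)) (u t)).re + c * ‖u 0‖ ^ 2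
      ≤ ((inner ℂ (E (u 0)) (u 0)).re + c * ‖u 0‖ ^ 2) * Real.exp t := by
  have hd : ∀ s ∈ Icc 0 T, HasDerivWithinAt
      (fun s => (inner ℂ (E (u s)) (u s)).re + c * ‖u 0‖ ^ 2)
      (2 * (inner ℂ (E (u s)) (L s (u s))).im) (Icc 0 T) s := fun s hs =>
    (h.hasDerivWithinAt_expectation E hE hs).add_const _
  have := le_gronwallBound_of_liminf_deriv_right_le (K := 1) (ε := 0)
    (fun s hs => (hd s hs).continuousWithinAt)
    (fun s hs r hr => ((hd s (Ico_subset_Icc_self hs)).mono_of_mem_nhdsWithin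
      (Icc_mem_nhdsGE_of_mem hs)).liminf_right_slope_le hr) le_rfl (fun s hs => by
        have h1 := hb s (Ico_subset_Icc_self hs) (u s)
        rw [h.norm_eq hL (Ico_subset_Icc_self hs) ⟨le_rfl, hT⟩] at h1
        linarith) t ht
  simpa [gronwallBound_ε0] using this

/-- Propagation of the graph norm: if the generator is Lipschitz in time relative to its own graph
norm, then `‖L(t) u(t)‖` grows at most exponentially. Since `L(t) u(t) = i u'(t)`, this is the
estimate for the time derivative of the solution; a derivative of `L` in time is not needed. -/
lemma graphNorm_le (h : IsSchrodingerCurve T L u) (hT : 0 ≤ T) (hLc : ContinuousOn L (Icc 0 T))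
    (hL : ∀ t ∈ Icc 0 T, ∀ x y, inner ℂ (L t x) y = inner ℂ x (L t y)) {C : ℝ}
    (hC : 0 ≤ C)
    (hlip : ∀ s ∈ Icc 0 T, ∀ t ∈ Icc 0 T, ∀ x,
      ‖L s x - L t x‖ ≤ C * |s - t| * (‖L s x‖ + ‖x‖)) {t : ℝ} (ht : t ∈ Icc 0 T) :
    ‖L t (u t)‖ ^ 2 + ‖u 0‖ ^ 2 ≤ (‖L 0 (u 0)‖ ^ 2 + ‖u 0‖ ^ 2) * Real.exp (3 * C * t) := by
  set v : ℝ → F := fun s => L s (u s)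
  have hv : ContinuousOn v (Icc 0 T) := hLc.clm_apply h.continuousOn
  have hf : ContinuousOn (fun s => ‖v s‖ ^ 2 + ‖u 0‖ ^ 2) (Icc 0 T) :=
    (hv.norm.pow 2).add continuousOn_const
  have hslope : ∀ x ∈ Ico 0 T, ∀ r, 2 * (‖v x‖ * (C * (‖v x‖ + ‖u 0‖))) < r →
      ∃ᶠ z in 𝓝[>] x, (z - x)⁻¹ * ((‖v z‖ ^ 2 + ‖u 0‖ ^ 2) - (‖v x‖ ^ 2 + ‖u 0‖ ^ 2)) < r := by
    intro x hx r hr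
    have hxT := Ico_subset_Icc_self hx
    have hle : 𝓝[>] x ≤ 𝓝[Icc 0 T] x := by
      rw [nhdsWithin_le_iff]
      exact mem_of_superset (Icc_mem_nhdsGT_of_mem hx) subset_rfl
    have hvx : Tendsto v (𝓝[>] x) (𝓝 (v x)) := (hv x hxT).mono_left hle
    set D : ℝ → F := fun z => (z - x)⁻¹ • (u z - u x)
    have hD : Tendsto D (𝓝[>] x) (𝓝 (-Complex.I • v x)) := by
      have h1 := ((h x hxT).mono_of_mem_nhdsWithin (Icc_mem_nhdsGE_of_mem hx))
      have h2 := hasDerivWithinAt_iff_tendsto_slope.1 h1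
      rw [Ici_sdiff_left] at h2
      exact h2
    set g : ℝ → ℝ := fun z => 2 * (‖v x‖ * (C * (‖v z‖ + ‖u 0‖)))
      + 2 * (inner ℂ (v x) (L x (D z))).re
      + (C * (‖v z‖ + ‖u 0‖) + ‖L x (D z)‖) * ‖v z - v x‖
    have hre : (inner ℂ (v x) (L x (-Complex.I • v x))).re = 0 := by
      have h5 : (starRingEnd ℂ) (inner ℂ (v x) (L x (v x))) = inner ℂ (v x) (L x (v x)) := by
        rw [inner_conj_symm, hL x hxT]
      have h6 := Complex.conj_eq_iff_im.1 h5
      simp [inner_smul_right, Complex.mul_re, h6]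
    have hg : Tendsto g (𝓝[>] x) (𝓝 (2 * (‖v x‖ * (C * (‖v x‖ + ‖u 0‖))))) := by
      have hLD : Tendsto (fun z => L x (D z)) (𝓝[>] x) (𝓝 (L x (-Complex.I • v x))) :=
        ((L x).continuous.tendsto _).comp hD
      have h1 : Tendsto (fun z => C * (‖v z‖ + ‖u 0‖)) (𝓝[>] x) (𝓝 (C * (‖v x‖ + ‖u 0‖))) :=
        (hvx.norm.add_const _).const_mul _
      have h2 : Tendsto (fun z => (inner ℂ (v x) (L x (D z))).re) (𝓝[>] x) (𝓝 0) := by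
        rw [← hre]
        exact (Complex.continuous_re.tendsto _).comp (tendsto_const_nhds.inner hLD)
      have h3 : Tendsto (fun z => ‖v z - v x‖) (𝓝[>] x) (𝓝 0) :=
        (tendsto_iff_norm_sub_tendsto_zero.1 hvx)
      have := (((h1.const_mul ‖v x‖).const_mul 2).add (h2.const_mul 2)).add
        ((h1.add hLD.norm).mul h3)
      simpa using this
    have hev : ∀ᶠ z in 𝓝[>] x, (z - x)⁻¹ * ((‖v z‖ ^ 2 + ‖u 0‖ ^ 2) - (‖v x‖ ^ 2 + ‖u 0‖ ^ 2))
        ≤ g z := by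
      filter_upwards [Ioo_mem_nhdsGT hx.2] with z hz
      have hzT : z ∈ Icc 0 T := ⟨hx.1.trans hz.1.le, hz.2.le⟩
      have hzx : 0 < z - x := sub_pos.2 hz.1
      -- the difference of `v` splits into the increments of the generator and of the solution
      have hdec : v z - v x = (L z (u z) - L x (u z)) + (z - x) • L x (D z) := by
        have h7 : (z - x) • L x (D z) = L x (u z) - L x (u x) := by
          simp only [D, ContinuousLinearMap.map_smul_of_tower, map_sub]
          rw [smul_smul, mul_inv_cancel₀ hzx.ne', one_smul]
        rw [h7]; simp only [v]; abel
      have h1 : ‖L z (u z) - L x (u z)‖ ≤ (z - x) * (C * (‖v z‖ + ‖u 0‖)) := by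
        have := hlip z hzT x hxT (u z)
        rw [abs_of_pos hzx, h.norm_eq hL hzT ⟨le_rfl, hT⟩] at this
        linarith
      have h2 : ‖v z - v x‖ ≤ (z - x) * (C * (‖v z‖ + ‖u 0‖) + ‖L x (D z)‖) := by
        rw [hdec]
        refine (norm_add_le _ _).trans ?_
        rw [norm_smul, Real.norm_of_nonneg hzx.le]
        linarith
      have h3 : ‖v z‖ ^ 2 = ‖v x‖ ^ 2 + 2 * (inner ℂ (v x) (v z - v x)).re
          + ‖v z - v x‖ ^ 2 := by
        have := norm_add_sq (𝕜 := ℂ) (v x) (v z - v x)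
        rwa [add_sub_cancel] at this
      have h4 : (inner ℂ (v x) (v z - v x)).re
          ≤ (z - x) * (‖v x‖ * (C * (‖v z‖ + ‖u 0‖)))
            + (z - x) * (inner ℂ (v x) (L x (D z))).re := by
        conv_lhs => rw [hdec]
        rw [inner_add_right, Complex.add_re, inner_smul_right_eq_smul, Complex.smul_re,
          smul_eq_mul]
        gcongr
        calc _ ≤ ‖v x‖ * ‖L z (u z) - L x (u z)‖ :=
              (Complex.re_le_norm _).trans (norm_inner_le_norm _ _)
          _ ≤ ‖v x‖ * ((z - x) * (C * (‖v z‖ + ‖u 0‖))) := by gcongr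
          _ = _ := by ring
      have h5 : ‖v z - v x‖ ^ 2
          ≤ (z - x) * ((C * (‖v z‖ + ‖u 0‖) + ‖L x (D z)‖) * ‖v z - v x‖) := by
        rw [sq, ← mul_assoc]
        gcongr
      rw [inv_mul_le_iff₀ hzx]
      simp only [g]
      rw [h3]
      linarith
    exact (hev.and (hg.eventually_lt_const hr)).frequently.mono fun z hz => hz.1.trans_lt hz.2
  have := le_gronwallBound_of_liminf_deriv_right_le (K := 3 * C) (ε := 0) hf hslope le_rfl
    (fun s _ => by
      generalize ‖v s‖ = a
      generalize ‖u 0‖ = b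
      nlinarith [mul_nonneg hC (sq_nonneg b), mul_nonneg hC (sq_nonneg (a - b))]) t ht
  simpa [gronwallBound_ε0] using this

end IsSchrodingerCurve

end FiniteDimensional


/-! ### Position and momentum on Schwartz functions -/

section Schwartz

open LineDeriv

variable {d : ℕ}

/-- The inclusion of the Schwartz functions into `L²`. -/
noncomputable def toL2 (d : ℕ) : 𝓢(Space d, ℂ) →ₗ[ℂ] Lp ℂ 2 (volume : Measure (Space d)) :=
  (SchwartzMap.toLpCLM ℂ ℂ 2 volume).toLinearMap

lemma coeFn_toL2 (f : 𝓢(Space d, ℂ)) : (toL2 d f : Space d → ℂ) =ᵐ[volume] f :=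
  f.coeFn_toLp 2 volume

lemma toL2_injective : Function.Injective (toL2 d) :=
  SchwartzMap.injective_toLp 2 volume

lemma denseRange_toL2 : DenseRange (toL2 d) :=
  SchwartzMap.denseRange_toLpCLM (F := ℂ) (E := Space d) (p := 2) (μ := volume) (by simp)

lemma inner_toL2_left (f : 𝓢(Space d, ℂ)) (w : Lp ℂ 2 (volume : Measure (Space d))) :
    inner ℂ (toL2 d f) w = ∫ η, (starRingEnd ℂ) (f η) * w η := by
  rw [L2.inner_def]
  refine integral_congr_ae ?_
  filter_upwards [coeFn_toL2 f] with η h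
  rw [h, RCLike.inner_apply, mul_comm]

lemma inner_toL2 (f g : 𝓢(Space d, ℂ)) :
    inner ℂ (toL2 d f) (toL2 d g) = ∫ η, (starRingEnd ℂ) (f η) * g η := by
  rw [inner_toL2_left]
  refine integral_congr_ae ?_
  filter_upwards [coeFn_toL2 g] with η h
  rw [h]

/-- The momentum operators `D_k = -i ∂_k` and the doubled position operators `Y_k = 2 η_k`; with
this scaling `∑ X_a²` is the oscillator `-Δ + 4 |η|²`, whose ground state is `exp (-|η|²)`. -/
noncomputable def phaseOp (d : ℕ) : Fin d ⊕ Fin d → 𝓢(Space d, ℂ) →ₗ[ℂ] 𝓢(Space d, ℂ)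
  | Sum.inl k => (-Complex.I) •
      (lineDerivOpCLM ℂ 𝓢(Space d, ℂ) (EuclideanSpace.single k (1 : ℝ))).toLinearMap
  | Sum.inr k => (SchwartzMap.smulLeftCLM ℂ fun η : Space d => (2 * η k : ℂ)).toLinearMap

/-- The matrix of the canonical commutation relations of `phaseOp`. -/
def phaseComm (d : ℕ) : Fin d ⊕ Fin d → Fin d ⊕ Fin d → ℝ
  | Sum.inl k, Sum.inr l => if k = l then -2 else 0
  | Sum.inr k, Sum.inl l => if k = l then 2 else 0
  | _, _ => 0

lemma hasTemperateGrowth_coord (k : Fin d) :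
    Function.HasTemperateGrowth fun η : Space d => ((η k : ℝ) : ℂ) :=
  (Complex.ofRealCLM.comp (EuclideanSpace.proj (𝕜 := ℝ) k)).hasTemperateGrowth

lemma hasTemperateGrowth_two_coord (k : Fin d) :
    Function.HasTemperateGrowth fun η : Space d => (2 * η k : ℂ) :=
  (Function.HasTemperateGrowth.const 2).mul (hasTemperateGrowth_coord k)

lemma phaseOp_inl_apply (k : Fin d) (f : 𝓢(Space d, ℂ)) (η : Space d) :
    phaseOp d (Sum.inl k) f η = -Complex.I * fderiv ℝ f η (EuclideanSpace.single k 1) := by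
  simp [phaseOp, SchwartzMap.lineDerivOp_apply_eq_fderiv]

lemma phaseOp_inr_apply (k : Fin d) (f : 𝓢(Space d, ℂ)) (η : Space d) :
    phaseOp d (Sum.inr k) f η = 2 * η k * f η := by
  simp [phaseOp, SchwartzMap.smulLeftCLM_apply_apply (hasTemperateGrowth_two_coord k)]

lemma SchwartzMap.fderiv_smulLeftCLM_apply {g : Space d → ℂ} (hg : g.HasTemperateGrowth)
    (f : 𝓢(Space d, ℂ)) (η v : Space d) :
    fderiv ℝ (SchwartzMap.smulLeftCLM ℂ g f) η v = g η * fderiv ℝ f η v + fderiv ℝ g η v * f η := by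
  have h1 : (SchwartzMap.smulLeftCLM ℂ g f : Space d → ℂ) = fun x => g x * f x := by
    ext x; simp [SchwartzMap.smulLeftCLM_apply_apply hg]
  rw [h1, fderiv_fun_mul (hg.1.differentiable (by simp)).differentiableAt
    (f.differentiableAt)]
  simp [mul_comm]

lemma SchwartzMap.fderiv_fderiv_apply (f : 𝓢(Space d, ℂ)) (η u v : Space d) :
    fderiv ℝ (fun x => fderiv ℝ f x v) η u = fderiv ℝ (fderiv ℝ f) η u v := by
  have h : DifferentiableAt ℝ (fderiv ℝ f) η :=
    ((f.smooth ⊤).fderiv_right (m := 1) (by norm_cast)).differentiable (by simp) η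
  rw [fderiv_clm_apply h (differentiableAt_const v)]
  simp

/-- Products of two momentum operators are second derivatives. -/
lemma phaseOp_inl_inl_apply (k l : Fin d) (f : 𝓢(Space d, ℂ)) (η : Space d) :
    phaseOp d (Sum.inl k) (phaseOp d (Sum.inl l) f) η
      = -fderiv ℝ (fderiv ℝ f) η (EuclideanSpace.single k 1) (EuclideanSpace.single l 1) := by
  have h : (phaseOp d (Sum.inl l) f : Space d → ℂ)
      = fun x => -Complex.I * fderiv ℝ f x (EuclideanSpace.single l 1) := by
    ext x; exact phaseOp_inl_apply l f x
  have h2 : DifferentiableAt ℝ (fun x => fderiv ℝ f x (EuclideanSpace.single l 1)) η :=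
    (((f.smooth ⊤).fderiv_right (m := 1) (by norm_cast)).differentiable (by simp) η).clm_apply
      (differentiableAt_const _)
  rw [phaseOp_inl_apply, h, fderiv_const_mul h2, smul_apply,
    SchwartzMap.fderiv_fderiv_apply, smul_eq_mul, ← mul_assoc]
  simp

lemma isCCR_phaseOp (d : ℕ) : IsCCR (toL2 d) (phaseOp d) (phaseComm d) where
  symm a f g := by
    rw [inner_toL2, inner_toL2]
    rcases a with k | k
    · have h := SchwartzMap.integral_bilinear_lineDerivOp_right_eq_neg_left (μ := volume) f g
        ((ContinuousLinearMap.mul ℝ ℂ).comp Complex.conjCLE.toContinuousLinearMap)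
        (EuclideanSpace.single k (1 : ℝ))
      simp only [phaseOp_inl_apply, map_mul, map_neg, Complex.conj_I, neg_neg]
      simp only [ContinuousLinearMap.coe_comp, Function.comp_apply,
        ContinuousLinearMap.mul_apply', SchwartzMap.lineDerivOp_apply_eq_fderiv] at h
      simp only [mul_assoc, integral_const_mul]
      have h' : ∀ x : Space d, (starRingEnd ℂ) (f x) * (-Complex.I *
          fderiv ℝ g x (EuclideanSpace.single k 1)) = -Complex.I * ((starRingEnd ℂ) (f x) *
          fderiv ℝ g x (EuclideanSpace.single k 1)) := fun x => by ring
      simp only [h', integral_const_mul]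
      simp only [ContinuousLinearEquiv.coe_coe, Complex.conjCLE_apply] at h
      rw [h]
      ring
    · simp only [phaseOp_inr_apply, map_mul, Complex.conj_ofReal]
      refine integral_congr_ae (.of_forall fun η => ?_)
      simp only [Complex.conj_ofNat]
      ring
  comm a b f := by
    have hYD : ∀ k l : Fin d, phaseOp d (Sum.inl k) (phaseOp d (Sum.inr l) f)
        = phaseOp d (Sum.inr l) (phaseOp d (Sum.inl k) f)
          + (Complex.I * phaseComm d (Sum.inl k) (Sum.inr l)) • f := fun k l => by
      ext η
      have h1 : fderiv ℝ (fun η : Space d => (2 * η l : ℂ)) η (EuclideanSpace.single k 1)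
          = if k = l then 2 else 0 := by
        have h2 : HasFDerivAt (fun η : Space d => (2 * η l : ℂ))
            ((2 : ℂ) • (Complex.ofRealCLM.comp (EuclideanSpace.proj (𝕜 := ℝ) l))) η :=
          ((Complex.ofRealCLM.comp (EuclideanSpace.proj (𝕜 := ℝ) l)).hasFDerivAt.const_mul 2)
        rw [h2.fderiv]
        simp only [smul_apply, ContinuousLinearMap.comp_apply]
        by_cases h : k = l
        · simp [h]
        · simp [h, Ne.symm h]
      rw [phaseOp_inl_apply, add_apply, phaseOp_inr_apply, smul_apply,
        phaseOp_inl_apply]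
      change -Complex.I * fderiv ℝ (SchwartzMap.smulLeftCLM ℂ _ f) η _ = _
      rw [SchwartzMap.fderiv_smulLeftCLM_apply (hasTemperateGrowth_two_coord l), h1]
      simp only [phaseComm]
      split_ifs <;> simp <;> ring
    rcases a with k | k <;> rcases b with l | l
    · ext η
      have hsymm : IsSymmSndFDerivAt ℝ f η :=
        (f.smooth 2).contDiffAt.isSymmSndFDerivAt (by simp)
      rw [add_apply, phaseOp_inl_inl_apply, phaseOp_inl_inl_apply, hsymm.eq]
      simp [phaseComm]
    · exact hYD k l
    · rw [hYD l k]
      simp only [phaseComm, add_assoc, ← add_smul]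
      by_cases h : k = l
      · simp [h]
      · simp [h, Ne.symm h]
    · ext η
      simp only [add_apply, phaseOp_inr_apply, phaseComm, smul_apply]
      simp
      ring

lemma abs_phaseComm_le (a b : Fin d ⊕ Fin d) : |phaseComm d a b| ≤ 2 := by
  rcases a with k | k <;> rcases b with l | l <;> simp only [phaseComm] <;>
    (try split_ifs) <;> simp

end Schwartz


/-! ### Quadratic phases -/

section Gauge

variable {d : ℕ}

/-- The quadratic form `ηᵀ A η`. -/
def quadForm (A : Matrix (Fin d) (Fin d) ℝ) (η : Space d) : ℝ := η.ofLp ⬝ᵥ (A *ᵥ η.ofLp)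

lemma quadForm_eq_sum (A : Matrix (Fin d) (Fin d) ℝ) (η : Space d) :
    quadForm A η = ∑ i, ∑ j, A i j * (η i * η j) := by
  simp only [quadForm, dotProduct, Matrix.mulVec, Finset.mul_sum]
  refine Finset.sum_congr rfl fun i _ => Finset.sum_congr rfl fun j _ => ?_
  ring

/-- The quadratic phase `exp (i ηᵀ A η / 2)`. -/
noncomputable def phase (A : Matrix (Fin d) (Fin d) ℝ) (η : Space d) : ℂ :=
  Complex.exp (Complex.I * ((quadForm A η / 2 : ℝ) : ℂ))

lemma norm_phase (A : Matrix (Fin d) (Fin d) ℝ) (η : Space d) : ‖phase A η‖ = 1 := by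
  rw [phase, mul_comm, Complex.norm_exp_ofReal_mul_I]

lemma phase_zero : phase (0 : Matrix (Fin d) (Fin d) ℝ) = 1 := by
  ext η; simp [phase, quadForm]

lemma conj_phase_mul_phase (A : Matrix (Fin d) (Fin d) ℝ) (η : Space d) :
    (starRingEnd ℂ) (phase A η) * phase A η = 1 := by
  rw [mul_comm, Complex.mul_conj, Complex.normSq_eq_norm_sq, norm_phase]; simp

lemma hasTemperateGrowth_quadForm (A : Matrix (Fin d) (Fin d) ℝ) :
    (quadForm A).HasTemperateGrowth := by
  have h : quadForm A = fun η => ∑ i, ∑ j, A i j * (η i * η j) :=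
    funext fun η => quadForm_eq_sum A η
  rw [h]
  have hc : ∀ i : Fin d, Function.HasTemperateGrowth fun η : Space d => η i := fun i =>
    (EuclideanSpace.proj i : Space d →L[ℝ] ℝ).hasTemperateGrowth
  exact .sum fun i _ => .sum fun j _ => (Function.HasTemperateGrowth.const _).mul
    ((hc i).mul (hc j))

lemma hasTemperateGrowth_exp_I_mul :
    Function.HasTemperateGrowth fun x : ℝ => Complex.exp (Complex.I * x) := by
  have hd : ∀ n : ℕ, iteratedDeriv n (fun x : ℝ => Complex.exp (Complex.I * x))
      = fun x : ℝ => Complex.I ^ n * Complex.exp (Complex.I * x) := by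
    intro n
    induction n with
    | zero => simp
    | succ n ih =>
      rw [iteratedDeriv_succ, ih]
      ext x
      have h1 : HasDerivAt (fun x : ℝ => Complex.exp (Complex.I * x))
          (Complex.exp (Complex.I * x) * (Complex.I * 1)) x :=
        ((Complex.ofRealCLM.hasDerivAt (x := x)).const_mul Complex.I).cexp
      rw [(h1.const_mul _).deriv]
      ring
  refine ⟨(contDiff_const.mul Complex.ofRealCLM.contDiff).cexp, fun n => ⟨0, 1, fun x => ?_⟩⟩
  rw [norm_iteratedFDeriv_eq_norm_iteratedDeriv, hd, norm_mul, norm_pow, Complex.norm_I,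
    mul_comm Complex.I, Complex.norm_exp_ofReal_mul_I]
  simp

lemma hasTemperateGrowth_phase (A : Matrix (Fin d) (Fin d) ℝ) :
    (phase A).HasTemperateGrowth := by
  have h : Function.HasTemperateGrowth fun η : Space d => quadForm A η / 2 := by
    simp only [div_eq_mul_inv]
    exact (hasTemperateGrowth_quadForm A).mul (.const _)
  exact hasTemperateGrowth_exp_I_mul.comp h

lemma hasFDerivAt_quadForm {A : Matrix (Fin d) (Fin d) ℝ} (hA : A.IsSymm) (η : Space d) :
    HasFDerivAt (quadForm A)
      (∑ i, (2 * ∑ j, A i j * η j) • (EuclideanSpace.proj i : Space d →L[ℝ] ℝ)) η := by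
  have h : quadForm A = fun η => ∑ i, ∑ j, A i j * (η i * η j) :=
    funext fun η => quadForm_eq_sum A η
  have hc : ∀ i : Fin d, HasFDerivAt (fun η : Space d => η i)
      (EuclideanSpace.proj i : Space d →L[ℝ] ℝ) η := fun i =>
    (EuclideanSpace.proj i : Space d →L[ℝ] ℝ).hasFDerivAt
  rw [h]
  refine (HasFDerivAt.fun_sum fun i _ => HasFDerivAt.fun_sum fun j _ =>
    ((hc i).mul (hc j)).const_mul (A i j)).congr_fderiv ?_
  ext v
  simp only [sum_apply, smul_apply, add_apply, PiLp.proj_apply, smul_eq_mul, mul_add,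
    Finset.sum_add_distrib, Finset.mul_sum, Finset.sum_mul]
  rw [Finset.sum_comm, ← Finset.sum_add_distrib]
  refine Finset.sum_congr rfl fun i _ => ?_
  rw [← Finset.sum_add_distrib]
  refine Finset.sum_congr rfl fun j _ => ?_
  rw [hA.apply]
  ring

/-- Multiplication of Schwartz functions by a quadratic phase. -/
noncomputable def phaseMul (A : Matrix (Fin d) (Fin d) ℝ) : 𝓢(Space d, ℂ) →ₗ[ℂ] 𝓢(Space d, ℂ) :=
  (SchwartzMap.smulLeftCLM ℂ (phase A)).toLinearMap

lemma phaseMul_apply (A : Matrix (Fin d) (Fin d) ℝ) (f : 𝓢(Space d, ℂ)) (η : Space d) :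
    phaseMul A f η = phase A η * f η := by
  simp [phaseMul, SchwartzMap.smulLeftCLM_apply_apply (hasTemperateGrowth_phase A)]

/-- Conjugation by a quadratic phase shifts the momentum by the gradient of the phase. -/
lemma phaseOp_inl_phaseMul {A : Matrix (Fin d) (Fin d) ℝ} (hA : A.IsSymm) (k : Fin d)
    (f : 𝓢(Space d, ℂ)) :
    phaseOp d (Sum.inl k) (phaseMul A f) = phaseMul A (phaseOp d (Sum.inl k) f
      + ∑ j, ((A k j / 2 : ℝ) : ℂ) • phaseOp d (Sum.inr j) f) := by
  ext η
  have h1 : HasFDerivAt (phase A) (phase A η • (Complex.I •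
      (Complex.ofRealCLM.comp ((2 : ℝ)⁻¹ • ∑ i, (2 * ∑ j, A i j * η j) •
        (EuclideanSpace.proj i : Space d →L[ℝ] ℝ))))) η := by
    have := (Complex.ofRealCLM.hasFDerivAt.comp η
      ((hasFDerivAt_quadForm hA η).const_mul (2 : ℝ)⁻¹)).const_mul Complex.I
    refine HasFDerivAt.congr_of_eventuallyEq (this.cexp.congr_fderiv ?_) (.of_forall fun x => ?_)
    · simp [phase, div_eq_inv_mul]
    · simp [phase, div_eq_inv_mul]
  rw [phaseOp_inl_apply]
  change -Complex.I * fderiv ℝ (SchwartzMap.smulLeftCLM ℂ _ f) η _ = _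
  rw [SchwartzMap.fderiv_smulLeftCLM_apply (hasTemperateGrowth_phase A), h1.fderiv, phaseMul_apply,
    add_apply, phaseOp_inl_apply, sum_apply]
  simp only [smul_apply, phaseOp_inr_apply, ContinuousLinearMap.comp_apply, sum_apply,
    PiLp.proj_apply, PiLp.single_apply, smul_eq_mul]
  simp only [mul_ite, mul_one, mul_zero, Finset.sum_ite_eq', Finset.mem_univ, if_true]
  have h2 : ∑ x, ((A k x / 2 : ℝ) : ℂ) * (2 * (η x : ℂ) * f η)
      = ((∑ j, A k j * η j : ℝ) : ℂ) * f η := by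
    push_cast
    rw [Finset.sum_mul]
    refine Finset.sum_congr rfl fun j _ => ?_
    ring
  rw [h2]
  simp only [Complex.ofRealCLM_apply]
  push_cast
  linear_combination (-phase A η * (∑ j, (A k j : ℂ) * η j) * f η) * Complex.I_mul_I

lemma phaseOp_inr_phaseMul (A : Matrix (Fin d) (Fin d) ℝ) (k : Fin d) (f : 𝓢(Space d, ℂ)) :
    phaseOp d (Sum.inr k) (phaseMul A f) = phaseMul A (phaseOp d (Sum.inr k) f) := by
  ext η
  simp only [phaseOp_inr_apply, phaseMul_apply]
  ring

lemma norm_toL2_phaseMul (A : Matrix (Fin d) (Fin d) ℝ) (f : 𝓢(Space d, ℂ)) :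
    ‖toL2 d (phaseMul A f)‖ = ‖toL2 d f‖ := by
  have h : inner ℂ (toL2 d (phaseMul A f)) (toL2 d (phaseMul A f))
      = inner ℂ (toL2 d f) (toL2 d f) := by
    rw [inner_toL2, inner_toL2]
    congr 1
    ext η
    rw [phaseMul_apply, map_mul]
    linear_combination ((starRingEnd ℂ) (f η) * f η) * conj_phase_mul_phase A η
  rw [inner_self_eq_norm_sq_to_K, inner_self_eq_norm_sq_to_K] at h
  have h' : ‖toL2 d (phaseMul A f)‖ ^ 2 = ‖toL2 d f‖ ^ 2 := by exact_mod_cast h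
  exact (sq_eq_sq₀ (norm_nonneg _) (norm_nonneg _)).1 h'

/-- The coefficients of `D_i + (A η)_i = D_i + (A Y)_i / 2` in terms of the operators `phaseOp`. -/
noncomputable def shiftMatrix (A : Matrix (Fin d) (Fin d) ℝ) : Matrix (Fin d) (Fin d ⊕ Fin d) ℝ :=
  Matrix.fromCols 1 ((2 : ℝ)⁻¹ • A)

/-- The symbol of the quadratic Hamiltonian conjugated by the phase `exp (i ηᵀ A η / 2)`. -/
noncomputable def gaugeSymbol (B A : Matrix (Fin d) (Fin d) ℝ) :
    Matrix (Fin d ⊕ Fin d) (Fin d ⊕ Fin d) ℝ :=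
  (2 : ℝ)⁻¹ • ((shiftMatrix A)ᵀ * (B * Bᵀ) * shiftMatrix A)
    + Matrix.fromBlocks 0 0 0 ((2 : ℝ)⁻¹ • (B * Bᵀ))

lemma isSymm_mul_transpose (B : Matrix (Fin d) (Fin d) ℝ) : (B * Bᵀ).IsSymm := by
  rw [Matrix.IsSymm, Matrix.transpose_mul, Matrix.transpose_transpose]

lemma isSymm_gaugeSymbol (B A : Matrix (Fin d) (Fin d) ℝ) : (gaugeSymbol B A).IsSymm := by
  rw [Matrix.IsSymm, gaugeSymbol, Matrix.transpose_add, Matrix.transpose_smul,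
    Matrix.transpose_mul, Matrix.transpose_mul, Matrix.transpose_transpose,
    (isSymm_mul_transpose B).eq, Matrix.fromBlocks_transpose, Matrix.transpose_smul,
    (isSymm_mul_transpose B).eq, Matrix.transpose_zero, ← Matrix.mul_assoc]

lemma sum_smul_phaseOp_shiftMatrix (A : Matrix (Fin d) (Fin d) ℝ) (i : Fin d) (f : 𝓢(Space d, ℂ)) :
    ∑ a, ((shiftMatrix A i a : ℝ) : ℂ) • phaseOp d a f
      = phaseOp d (Sum.inl i) f + ∑ j, ((A i j / 2 : ℝ) : ℂ) • phaseOp d (Sum.inr j) f := by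
  rw [Fintype.sum_sum_type]
  congr 1
  · simp [shiftMatrix, Matrix.one_apply]
  · refine Finset.sum_congr rfl fun j _ => ?_
    simp [shiftMatrix, div_eq_inv_mul]

lemma quadOp_gaugeSymbol (B A : Matrix (Fin d) (Fin d) ℝ) (f : 𝓢(Space d, ℂ)) :
    quadOp (phaseOp d) (gaugeSymbol B A) f
      = ∑ i, ∑ j, (((B * Bᵀ) i j / 2 : ℝ) : ℂ) •
        ((∑ a, ((shiftMatrix A i a : ℝ) : ℂ) • phaseOp d a
            (∑ b, ((shiftMatrix A j b : ℝ) : ℂ) • phaseOp d b f))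
          + phaseOp d (Sum.inr i) (phaseOp d (Sum.inr j) f)) := by
  simp only [smul_add, Finset.sum_add_distrib]
  rw [quadOp_apply, gaugeSymbol]
  simp only [Matrix.add_apply, Complex.ofReal_add, add_smul, Finset.sum_add_distrib]
  congr 1
  · simp only [map_sum, map_smul, Finset.smul_sum, smul_smul]
    have h : ∀ a b, (((2 : ℝ)⁻¹ • ((shiftMatrix A)ᵀ * (B * Bᵀ) * shiftMatrix A)) a b : ℝ)
        = ∑ i, ∑ j, (B * Bᵀ) i j / 2 * (shiftMatrix A i a * shiftMatrix A j b) := by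
      intro a b
      rw [Matrix.smul_apply, Matrix.mul_apply, smul_eq_mul, Finset.mul_sum, Finset.sum_comm]
      refine Finset.sum_congr rfl fun j _ => ?_
      rw [Matrix.mul_apply, Finset.sum_mul, Finset.mul_sum]
      refine Finset.sum_congr rfl fun i _ => ?_
      rw [Matrix.transpose_apply]
      ring
    simp only [h]
    push_cast
    simp only [Finset.sum_smul]
    calc _ = ∑ a, ∑ i, ∑ b, ∑ j, _ := Finset.sum_congr rfl fun a _ => Finset.sum_comm
      _ = ∑ i, ∑ a, ∑ b, ∑ j, _ := Finset.sum_comm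
      _ = ∑ i, ∑ a, ∑ j, ∑ b, _ := Finset.sum_congr rfl fun i _ => Finset.sum_congr rfl
          fun a _ => Finset.sum_comm
      _ = ∑ i, ∑ j, ∑ a, ∑ b, _ := Finset.sum_congr rfl fun i _ => Finset.sum_comm
      _ = _ := by
        refine Finset.sum_congr rfl fun i _ => Finset.sum_congr rfl fun j _ =>
          Finset.sum_congr rfl fun a _ => Finset.sum_congr rfl fun b _ => ?_
        congr 1
  · simp only [Fintype.sum_sum_type, Matrix.fromBlocks_apply₁₁, Matrix.fromBlocks_apply₁₂,
      Matrix.fromBlocks_apply₂₁, Matrix.fromBlocks_apply₂₂, Matrix.zero_apply, Complex.ofReal_zero,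
      zero_smul, Finset.sum_const_zero, zero_add, Matrix.smul_apply, smul_eq_mul, div_eq_inv_mul]

lemma gaugeSymbol_zero (B : Matrix (Fin d) (Fin d) ℝ) : gaugeSymbol B 0
    = Matrix.fromBlocks ((2 : ℝ)⁻¹ • (B * Bᵀ)) 0 0 ((2 : ℝ)⁻¹ • (B * Bᵀ)) := by
  ext a b
  rcases a with i | i <;> rcases b with j | j <;>
    simp [gaugeSymbol, shiftMatrix, Matrix.mul_apply, Matrix.one_apply, Matrix.transpose_apply]

/-- Conjugation of the quadratic Hamiltonian by a quadratic phase. -/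
lemma quadOp_phaseMul (B : Matrix (Fin d) (Fin d) ℝ) {A : Matrix (Fin d) (Fin d) ℝ} (hA : A.IsSymm)
    (f : 𝓢(Space d, ℂ)) :
    quadOp (phaseOp d) (gaugeSymbol B 0) (phaseMul A f)
      = phaseMul A (quadOp (phaseOp d) (gaugeSymbol B A) f) := by
  have key : ∀ i g, ∑ a, ((shiftMatrix 0 i a : ℝ) : ℂ) • phaseOp d a (phaseMul A g)
      = phaseMul A (∑ a, ((shiftMatrix A i a : ℝ) : ℂ) • phaseOp d a g) := fun i g => by
    rw [sum_smul_phaseOp_shiftMatrix, sum_smul_phaseOp_shiftMatrix, phaseOp_inl_phaseMul hA]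
    simp
  rw [quadOp_gaugeSymbol, quadOp_gaugeSymbol]
  rw [map_sum]
  refine Finset.sum_congr rfl fun i _ => ?_
  rw [map_sum]
  refine Finset.sum_congr rfl fun j _ => ?_
  rw [map_smul, map_add, key, key, phaseOp_inr_phaseMul, phaseOp_inr_phaseMul]

end Gauge


/-! ### Hermite functions -/

section Hermite

variable {d : ℕ}

lemma one_add_pow_mul_exp_neg_sq_le (N : ℕ) {r : ℝ} (hr : 0 ≤ r) :
    (1 + r) ^ N * Real.exp (-r ^ 2) ≤ 2 ^ N * N.factorial * Real.exp 1 := by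
  have h1 : (1 + r) ^ N ≤ 2 ^ N * (1 + r ^ 2) ^ N := by
    rw [← mul_pow]
    gcongr
    nlinarith [sq_nonneg (r - 1)]
  have h2 := Real.pow_div_factorial_le_exp (1 + r ^ 2) (by positivity) N
  rw [div_le_iff₀ (by positivity), Real.exp_add] at h2
  calc (1 + r) ^ N * Real.exp (-r ^ 2)
      ≤ 2 ^ N * (Real.exp 1 * Real.exp (r ^ 2) * N.factorial) * Real.exp (-r ^ 2) := by
        gcongr
        exact h1.trans (by gcongr)
    _ = 2 ^ N * N.factorial * Real.exp 1 * (Real.exp (r ^ 2) * Real.exp (-r ^ 2)) := by ring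
    _ = _ := by rw [← Real.exp_add]; simp

/-- The ground state `exp (-|η|²)` of the oscillator. -/
noncomputable def groundState (d : ℕ) : 𝓢(Space d, ℂ) where
  toFun η := ((Real.exp (-‖η‖ ^ 2) : ℝ) : ℂ)
  smooth' := Complex.ofRealCLM.contDiff.comp
    (Real.contDiff_exp.comp ((contDiff_norm_sq ℝ).neg))
  decay' k n := by
    have ht : Function.HasTemperateGrowth fun η : Space d => -‖η‖ ^ 2 :=
      Function.HasTemperateGrowth.neg (f := fun η : Space d => ‖η‖ ^ 2)
        (by fun_prop)
    obtain ⟨m, C, hC0, hC⟩ := ht.norm_iteratedFDeriv_le_uniform n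
    refine ⟨n.factorial * (1 + C) ^ n *
      (2 ^ (k + m * n) * (k + m * n).factorial * Real.exp 1), fun x => ?_⟩
    have h1 : ‖iteratedFDeriv ℝ n (Real.exp ∘ fun η : Space d => -‖η‖ ^ 2) x‖
        ≤ n.factorial * Real.exp (-‖x‖ ^ 2) * ((1 + C) * (1 + ‖x‖) ^ m) ^ n := by
      refine norm_iteratedFDeriv_comp_le (N := n) Real.contDiff_exp ((contDiff_norm_sq ℝ).neg)
        le_rfl x (fun i _ => ?_) (fun i hi hin => ?_)
      · rw [norm_iteratedFDeriv_eq_norm_iteratedDeriv, iteratedDeriv_eq_iterate,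
          Real.iter_deriv_exp, Real.norm_of_nonneg (Real.exp_pos _).le]
      · have h3 : 1 ≤ (1 + ‖x‖) ^ m := one_le_pow₀ (by linarith [norm_nonneg x])
        refine (hC i hin x).trans (le_trans ?_ (le_self_pow₀ (one_le_mul_of_one_le_of_one_le
          (by linarith) h3) (by omega)))
        gcongr
        linarith
    have h2 : ‖iteratedFDeriv ℝ n (fun η : Space d => ((Real.exp (-‖η‖ ^ 2) : ℝ) : ℂ)) x‖
        = ‖iteratedFDeriv ℝ n (Real.exp ∘ fun η : Space d => -‖η‖ ^ 2) x‖ :=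
      Complex.ofRealLI.norm_iteratedFDeriv_comp_left (n := n)
        (Real.contDiff_exp.comp ((contDiff_norm_sq ℝ).neg)).contDiffAt (by exact_mod_cast le_rfl)
    rw [h2]
    calc _ ≤ (1 + ‖x‖) ^ k * (n.factorial * Real.exp (-‖x‖ ^ 2) *
          ((1 + C) * (1 + ‖x‖) ^ m) ^ n) := by gcongr; linarith
      _ = n.factorial * (1 + C) ^ n * ((1 + ‖x‖) ^ (k + m * n) * Real.exp (-‖x‖ ^ 2)) := by
        rw [mul_pow, ← pow_mul, pow_add]; ring
      _ ≤ _ := mul_le_mul_of_nonneg_left (one_add_pow_mul_exp_neg_sq_le _ (norm_nonneg x))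
        (by positivity)

lemma groundState_apply (η : Space d) :
    groundState d η = ((Real.exp (-‖η‖ ^ 2) : ℝ) : ℂ) := rfl

/-- The annihilation operators `∂_k + 2 η_k`. -/
noncomputable def lowerOp (k : Fin d) : 𝓢(Space d, ℂ) →ₗ[ℂ] 𝓢(Space d, ℂ) :=
  Complex.I • phaseOp d (Sum.inl k) + phaseOp d (Sum.inr k)

lemma lowerOp_groundState (k : Fin d) : lowerOp k (groundState d) = 0 := by
  ext η
  have h1 : HasFDerivAt (groundState d)
      (Complex.ofRealCLM.comp (Real.exp (-‖η‖ ^ 2) • -(2 • innerSL ℝ η))) η :=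
    Complex.ofRealCLM.hasFDerivAt.comp η ((hasStrictFDerivAt_norm_sq η).hasFDerivAt.neg.exp)
  simp only [lowerOp, LinearMap.add_apply, LinearMap.smul_apply, add_apply, smul_apply,
    phaseOp_inl_apply, phaseOp_inr_apply, h1.fderiv, groundState_apply]
  simp only [ContinuousLinearMap.comp_apply, smul_apply, neg_apply, innerSL_apply_apply,
    Complex.ofRealCLM_apply, EuclideanSpace.inner_single_right, smul_eq_mul, zero_apply]
  simp
  linear_combination (2 * η k * Complex.exp (-(‖η‖ : ℂ) ^ 2)) * Complex.I_mul_I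

lemma lowerOp_phaseOp_inr (k j : Fin d) (f : 𝓢(Space d, ℂ)) :
    lowerOp k (phaseOp d (Sum.inr j) f)
      = phaseOp d (Sum.inr j) (lowerOp k f) + (if k = j then 2 else 0 : ℂ) • f := by
  simp only [lowerOp, LinearMap.add_apply, LinearMap.smul_apply, map_add, map_smul]
  rw [(isCCR_phaseOp d).comm (Sum.inl k), (isCCR_phaseOp d).comm (Sum.inr k)]
  simp only [phaseComm]
  rw [smul_add, smul_smul]
  have : Complex.I * (Complex.I * ((if k = j then -2 else 0 : ℝ) : ℂ))
      = if k = j then 2 else 0 := by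
    rw [← mul_assoc, Complex.I_mul_I]; split_ifs <;> simp
  rw [this]
  simp only [Complex.ofReal_zero, mul_zero, zero_smul, add_zero]
  abel

/-- The products of the ground state with the polynomials of degree at most `n`. -/
noncomputable def hermiteSpace (d : ℕ) : ℕ → Submodule ℂ 𝓢(Space d, ℂ)
  | 0 => ℂ ∙ groundState d
  | n + 1 => hermiteSpace d n ⊔ ⨆ k : Fin d, (hermiteSpace d n).map (phaseOp d (Sum.inr k))

instance finiteDimensional_hermiteSpace (n : ℕ) : FiniteDimensional ℂ (hermiteSpace d n) := by
  induction n with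
  | zero => exact inferInstanceAs (FiniteDimensional ℂ ↥(ℂ ∙ groundState d))
  | succ n ih => exact inferInstanceAs (FiniteDimensional ℂ ↥(hermiteSpace d n ⊔
      ⨆ k : Fin d, (hermiteSpace d n).map (phaseOp d (Sum.inr k))))

lemma hermiteSpace_mono : Monotone (hermiteSpace d) :=
  monotone_nat_of_le_succ fun _ => le_sup_left

lemma groundState_mem (n : ℕ) : groundState d ∈ hermiteSpace d n :=
  hermiteSpace_mono (Nat.zero_le n) (Submodule.mem_span_singleton_self _)

lemma phaseOp_inr_mem {n : ℕ} {f : 𝓢(Space d, ℂ)} (hf : f ∈ hermiteSpace d n) (k : Fin d) :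
    phaseOp d (Sum.inr k) f ∈ hermiteSpace d (n + 1) :=
  (le_sup_right : _ ≤ hermiteSpace d n ⊔ _)
    (le_iSup (fun k : Fin d => (hermiteSpace d n).map (phaseOp d (Sum.inr k))) k
      (Submodule.mem_map_of_mem hf))

lemma hermiteSpace_succ_le {n : ℕ} {W : Submodule ℂ 𝓢(Space d, ℂ)}
    (h0 : hermiteSpace d n ≤ W)
    (h1 : ∀ k, ∀ f ∈ hermiteSpace d n, phaseOp d (Sum.inr k) f ∈ W) :
    hermiteSpace d (n + 1) ≤ W :=
  sup_le h0 (iSup_le fun k => Submodule.map_le_iff_le_comap.2 fun f hf => h1 k f hf)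

lemma lowerOp_eq_zero {f : 𝓢(Space d, ℂ)} (hf : f ∈ hermiteSpace d 0) (k : Fin d) :
    lowerOp k f = 0 := by
  obtain ⟨c, rfl⟩ := Submodule.mem_span_singleton.1 hf
  rw [map_smul, lowerOp_groundState, smul_zero]

lemma lowerOp_mem (n : ℕ) (k : Fin d) :
    ∀ f ∈ hermiteSpace d (n + 1), lowerOp k f ∈ hermiteSpace d n := by
  induction n with
  | zero =>
    refine hermiteSpace_succ_le (W := (hermiteSpace d 0).comap (lowerOp k))
      (fun f hf => ?_) (fun j f hf => ?_)
    · rw [Submodule.mem_comap, lowerOp_eq_zero hf]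
      exact zero_mem _
    · rw [Submodule.mem_comap, lowerOp_phaseOp_inr, lowerOp_eq_zero hf, map_zero, zero_add]
      exact Submodule.smul_mem _ _ hf
  | succ n ih =>
    refine hermiteSpace_succ_le (W := (hermiteSpace d (n + 1)).comap (lowerOp k))
      (fun f hf => ?_) (fun j f hf => ?_)
    · exact hermiteSpace_mono (Nat.le_succ n) (ih f hf)
    · rw [Submodule.mem_comap, lowerOp_phaseOp_inr]
      exact add_mem (phaseOp_inr_mem (ih f hf) j) (Submodule.smul_mem _ _ hf)

lemma lowerOp_mem_self {n : ℕ} {f : 𝓢(Space d, ℂ)} (hf : f ∈ hermiteSpace d n) (k : Fin d) :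
    lowerOp k f ∈ hermiteSpace d n := by
  rcases n with _ | n
  · rw [lowerOp_eq_zero hf]; exact zero_mem _
  · exact hermiteSpace_mono (Nat.le_succ n) (lowerOp_mem n k f hf)

lemma phaseOp_inr_lowerOp_mem {n : ℕ} {f : 𝓢(Space d, ℂ)} (hf : f ∈ hermiteSpace d n)
    (j k : Fin d) : phaseOp d (Sum.inr j) (lowerOp k f) ∈ hermiteSpace d n := by
  rcases n with _ | n
  · rw [lowerOp_eq_zero hf, map_zero]; exact zero_mem _
  · exact phaseOp_inr_mem (lowerOp_mem n k f hf) j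

/-- The operators `D_i D_j + Y_i Y_j` do not raise the degree: in terms of the annihilation
operators `a_k = i D_k + Y_k` they are `Y_i a_j + a_i Y_j - a_i a_j`. -/
lemma momentum_add_position_mem {n : ℕ} {f : 𝓢(Space d, ℂ)} (hf : f ∈ hermiteSpace d n)
    (i j : Fin d) :
    phaseOp d (Sum.inl i) (phaseOp d (Sum.inl j) f)
      + phaseOp d (Sum.inr i) (phaseOp d (Sum.inr j) f) ∈ hermiteSpace d n := by
  have h : phaseOp d (Sum.inl i) (phaseOp d (Sum.inl j) f)
      + phaseOp d (Sum.inr i) (phaseOp d (Sum.inr j) f)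
      = phaseOp d (Sum.inr i) (lowerOp j f) + lowerOp i (phaseOp d (Sum.inr j) f)
        - lowerOp i (lowerOp j f) := by
    simp only [lowerOp, LinearMap.add_apply, LinearMap.smul_apply, map_add, map_smul, smul_add,
      smul_smul, Complex.I_mul_I, neg_smul, one_smul]
    abel
  rw [h, lowerOp_phaseOp_inr]
  exact sub_mem (add_mem (phaseOp_inr_lowerOp_mem hf i j) (add_mem (phaseOp_inr_lowerOp_mem hf j i)
    (Submodule.smul_mem _ _ hf))) (lowerOp_mem_self (lowerOp_mem_self hf j) i)

lemma oscillator_mem {n : ℕ} {f : 𝓢(Space d, ℂ)} (hf : f ∈ hermiteSpace d n) :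
    oscillator (phaseOp d) f ∈ hermiteSpace d n := by
  rw [oscillator_apply, Fintype.sum_sum_type, ← Finset.sum_add_distrib]
  exact sum_mem fun k _ => momentum_add_position_mem hf k k

lemma quadOp_gaugeSymbol_zero_mem {n : ℕ} {f : 𝓢(Space d, ℂ)} (hf : f ∈ hermiteSpace d n)
    (B : Matrix (Fin d) (Fin d) ℝ) :
    quadOp (phaseOp d) (gaugeSymbol B 0) f ∈ hermiteSpace d n := by
  rw [quadOp_gaugeSymbol]
  refine sum_mem fun i _ => sum_mem fun j _ => Submodule.smul_mem _ _ ?_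
  simp only [sum_smul_phaseOp_shiftMatrix, Matrix.zero_apply, zero_div, Complex.ofReal_zero,
    zero_smul, Finset.sum_const_zero, add_zero]
  exact momentum_add_position_mem hf i j

end Hermite


/-! ### Completeness of the Hermite functions -/

section Density

open FourierTransform

variable {d : ℕ}

/-- The Hermite functions of degree at most `n` as a subspace of `L²`. -/
noncomputable def hermiteL2 (d n : ℕ) : Submodule ℂ (Lp ℂ 2 (volume : Measure (Space d))) :=
  (hermiteSpace d n).map (toL2 d)

instance finiteDimensional_hermiteL2 (n : ℕ) : FiniteDimensional ℂ (hermiteL2 d n) :=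
  inferInstanceAs (FiniteDimensional ℂ ((hermiteSpace d n).map (toL2 d)))

lemma hermiteL2_mono : Monotone (hermiteL2 d) := fun _ _ h =>
  Submodule.map_mono (hermiteSpace_mono h)

lemma exists_hermite_inner_pow (ξ : Space d) (m : ℕ) : ∃ f ∈ hermiteSpace d m, ∀ η : Space d,
    f η = ((2 * inner ℝ η ξ : ℝ) : ℂ) ^ m * ((Real.exp (-‖η‖ ^ 2) : ℝ) : ℂ) := by
  induction m with
  | zero => exact ⟨groundState d, groundState_mem 0, fun η => by simp [groundState_apply]⟩
  | succ m ih =>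
    obtain ⟨f, hf, h⟩ := ih
    refine ⟨∑ k, ((ξ k : ℝ) : ℂ) • phaseOp d (Sum.inr k) f,
      sum_mem fun k _ => Submodule.smul_mem _ _ (phaseOp_inr_mem hf k), fun η => ?_⟩
    simp only [sum_apply, smul_apply, phaseOp_inr_apply, h, smul_eq_mul, PiLp.inner_apply,
      RCLike.inner_apply, conj_trivial]
    generalize hx : ((2 * ∑ x, ξ x * η x : ℝ) : ℂ) = z
    rw [pow_succ' z, mul_assoc z]
    generalize z ^ m * ((Real.exp (-‖η‖ ^ 2) : ℝ) : ℂ) = y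
    rw [← hx, Complex.ofReal_mul, Complex.ofReal_sum, Finset.mul_sum, Finset.sum_mul]
    refine Finset.sum_congr rfl fun k _ => ?_
    push_cast
    ring

lemma integrable_exp_neg_sq : Integrable fun η : Space d => Real.exp (-‖η‖ ^ 2) := by
  have h := GaussianFourier.integrable_cexp_neg_mul_sq_norm_add (V := Space d) (b := 1)
    (by simp) 0 0
  refine h.norm.congr (.of_forall fun η => ?_)
  simp only [Complex.norm_exp]
  congr 1
  norm_cast
  simp

lemma integrable_exp_mul_gaussian (c : ℝ) (f : Lp ℂ 2 (volume : Measure (Space d))) :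
    Integrable fun η : Space d => Real.exp (c * ‖η‖) * (Real.exp (-‖η‖ ^ 2) * ‖f η‖) := by
  have hf : Integrable fun η => ‖f η‖ ^ 2 :=
    (memLp_two_iff_integrable_sq_norm (Lp.aestronglyMeasurable f)).1 (Lp.memLp f)
  refine Integrable.mono' ((integrable_exp_neg_sq.const_mul (Real.exp (c ^ 2))).add hf)
    ?_ (.of_forall fun η => ?_)
  · refine AEStronglyMeasurable.mul (Continuous.aestronglyMeasurable (by fun_prop))
      (AEStronglyMeasurable.mul (Continuous.aestronglyMeasurable (by fun_prop))
        (Lp.aestronglyMeasurable f).norm)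
  · rw [Real.norm_of_nonneg (by positivity), ← mul_assoc, ← Real.exp_add]
    have h1 : (Real.exp (c * ‖η‖ + -‖η‖ ^ 2)) ^ 2 ≤ Real.exp (c ^ 2) * Real.exp (-‖η‖ ^ 2) := by
      rw [← Real.exp_nat_mul, ← Real.exp_add]
      gcongr
      push_cast
      nlinarith [sq_nonneg (c - ‖η‖)]
    simp only [Pi.add_apply]
    nlinarith [sq_nonneg (Real.exp (c * ‖η‖ + -‖η‖ ^ 2) - ‖f η‖), sq_nonneg ‖f η‖,
      sq_nonneg (Real.exp (c * ‖η‖ + -‖η‖ ^ 2))]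

/-- A square integrable function orthogonal to all Hermite functions vanishes: the Fourier transform
of its product with the Gaussian is zero, by expanding the exponential in a power series. -/
lemma eq_zero_of_inner_hermite_eq_zero (f : Lp ℂ 2 (volume : Measure (Space d)))
    (hf : ∀ n, ∀ φ ∈ hermiteSpace d n, inner ℂ (toL2 d φ) f = 0) : f = 0 := by
  set h : Space d → ℂ := fun η => ((Real.exp (-‖η‖ ^ 2) : ℝ) : ℂ) * f η
  have hmeas : AEStronglyMeasurable h volume :=
    AEStronglyMeasurable.mul (Continuous.aestronglyMeasurable (by fun_prop))
      (Lp.aestronglyMeasurable f)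
  have hnorm : ∀ η, ‖h η‖ = Real.exp (-‖η‖ ^ 2) * ‖f η‖ := fun η => by
    simp only [h]
    rw [norm_mul, Complex.norm_real, Real.norm_of_nonneg (Real.exp_pos _).le]
  have hint : Integrable h := by
    refine (integrable_exp_mul_gaussian 0 f).mono' hmeas (.of_forall fun η => ?_)
    rw [hnorm]; simp
  have hmom : ∀ (ξ : Space d) (m : ℕ), ∫ η, ((2 * inner ℝ η ξ : ℝ) : ℂ) ^ m * h η = 0 := by
    intro ξ m
    obtain ⟨φ, hφ, hv⟩ := exists_hermite_inner_pow ξ m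
    rw [← hf m φ hφ, inner_toL2_left]
    refine integral_congr_ae (.of_forall fun η => ?_)
    simp only [hv, h, map_mul, map_pow, Complex.conj_ofReal]
    ring
  have hF : ∀ ξ, 𝓕 h ξ = 0 := by
    intro ξ
    rw [Real.fourier_eq']
    have hsum := MeasureTheory.hasSum_integral_of_dominated_convergence (μ := volume)
      (F := fun (m : ℕ) (η : Space d) => (-(Real.pi : ℂ) * Complex.I) ^ m / m.factorial *
        (((2 * inner ℝ η ξ : ℝ) : ℂ) ^ m * h η))
      (f := fun η => Complex.exp ((↑(-2 * Real.pi * inner ℝ η ξ) * Complex.I)) • h η)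
      (fun m η => (2 * Real.pi * ‖ξ‖ * ‖η‖) ^ m / m.factorial * ‖h η‖)
      (fun m => (((Continuous.aestronglyMeasurable (by fun_prop)).mul hmeas).const_mul _))
      (fun m => .of_forall fun η => ?_) (.of_forall fun η => ?_) ?_ (.of_forall fun η => ?_)
    · refine hsum.unique ?_
      simp only [integral_const_mul, hmom, mul_zero]
      exact hasSum_zero
    · rw [norm_mul, norm_mul, norm_div, norm_pow, norm_mul, norm_neg, Complex.norm_I,
        Complex.norm_real, Real.norm_of_nonneg Real.pi_pos.le, norm_pow, Complex.norm_real,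
        Complex.norm_natCast, Real.norm_eq_abs, abs_mul, abs_two, mul_one, ← mul_assoc,
        div_mul_eq_mul_div, ← mul_pow]
      have := abs_real_inner_le_norm η ξ
      refine mul_le_mul_of_nonneg_right (div_le_div_of_nonneg_right
        (pow_le_pow_left₀ (by positivity) ?_ m) (by positivity)) (norm_nonneg _)
      calc Real.pi * (2 * |inner ℝ η ξ|) ≤ Real.pi * (2 * (‖η‖ * ‖ξ‖)) := by gcongr
        _ = _ := by ring
    · exact (Real.summable_pow_div_factorial _).mul_right _
    · have hs : ∀ x : ℝ, ∑' m : ℕ, x ^ m / m.factorial = Real.exp x := fun x => by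
        rw [Real.exp_eq_exp_ℝ, NormedSpace.exp_eq_tsum_div]
      simp only [tsum_mul_right, hs, hnorm]
      exact integrable_exp_mul_gaussian _ f
    · have hs := NormedSpace.expSeries_div_hasSum_exp
        ((-2 * Real.pi * inner ℝ η ξ : ℝ) * Complex.I)
      rw [← Complex.exp_eq_exp_ℂ] at hs
      refine (congrArg (fun g => HasSum g _) (funext fun m => ?_)).mp (hs.mul_right (h η))
      symm
      rw [← mul_assoc, div_mul_eq_mul_div, ← mul_pow]
      congr 3
      push_cast
      ring
  have hz : ∀ᵐ η, h η = 0 := by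
    refine ae_eq_zero_of_integral_contDiff_smul_eq_zero hint.locallyIntegrable
      fun g hg hgc => ?_
    have hgc' : HasCompactSupport fun x => ((g x : ℝ) : ℂ) :=
      hgc.comp_left (g := fun x : ℝ => (x : ℂ)) Complex.ofReal_zero
    set ψ : 𝓢(Space d, ℂ) := hgc'.toSchwartzMap (Complex.ofRealCLM.contDiff.comp hg)
    have h1 := VectorFourier.integral_fourierIntegral_smul_eq_flip (L := innerₗ (Space d))
      (μ := volume) (ν := volume) (f := (𝓕⁻ ψ : 𝓢(Space d, ℂ))) (g := h)
      Real.continuous_fourierChar continuous_inner (SchwartzMap.integrable _) hint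
    have h2 : ∀ ξ, VectorFourier.fourierIntegral Real.fourierChar volume
        (innerₗ (Space d)) (𝓕⁻ ψ : 𝓢(Space d, ℂ)) ξ = ψ ξ := fun ξ => by
      have : 𝓕 (𝓕⁻ ψ : 𝓢(Space d, ℂ)) = ψ := fourier_fourierInv_eq ψ
      conv_rhs => rw [← this, SchwartzMap.fourier_coe]
      rfl
    have h3 : ∀ ξ, VectorFourier.fourierIntegral Real.fourierChar volume
        (innerₗ (Space d)).flip h ξ = 0 := fun ξ => by
      rw [flip_innerₗ]
      exact hF ξ
    simp only [h2, h3, smul_zero, integral_zero] at h1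
    rw [← h1]
    refine integral_congr_ae (.of_forall fun η => ?_)
    rfl
  rw [Lp.eq_zero_iff_ae_eq_zero]
  filter_upwards [hz] with η h0
  have : ((Real.exp (-‖η‖ ^ 2) : ℝ) : ℂ) ≠ 0 := by exact_mod_cast (Real.exp_pos _).ne'
  exact (mul_eq_zero.1 h0).resolve_left this

lemma topologicalClosure_iSup_hermiteL2 :
    (⨆ n, hermiteL2 d n).topologicalClosure = ⊤ := by
  rw [Submodule.topologicalClosure_eq_top_iff, Submodule.eq_bot_iff]
  refine fun f hf => eq_zero_of_inner_hermite_eq_zero f fun n φ hφ => ?_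
  exact (Submodule.mem_orthogonal _ _).1 hf _
    (Submodule.mem_iSup_of_mem n (Submodule.mem_map_of_mem hφ))

/-- The orthogonal projections onto the Hermite functions of degree at most `n` converge strongly
to the identity. -/
lemma tendsto_starProjection_hermiteL2 (f : Lp ℂ 2 (volume : Measure (Space d))) :
    Filter.Tendsto (fun n => (hermiteL2 d n).starProjection f) Filter.atTop (nhds f) :=
  Submodule.starProjection_tendsto_self _ hermiteL2_mono f topologicalClosure_iSup_hermiteL2.ge

end Density


/-! ### Bounded multiplication operators -/

section Multiplication

open Filter Topology

variable {d : ℕ}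

lemma L2_norm_sq_eq (x : Lp ℂ 2 (volume : Measure (Space d))) : ‖x‖ ^ 2 = ∫ η, ‖x η‖ ^ 2 := by
  have h : inner ℂ x x = ∫ η, ((‖x η‖ ^ 2 : ℝ) : ℂ) := by
    rw [L2.inner_def]
    congr 1
    ext η
    rw [inner_self_eq_norm_sq_to_K]
    norm_cast
  have h2 : ((‖x‖ ^ 2 : ℝ) : ℂ) = inner ℂ x x := by
    rw [inner_self_eq_norm_sq_to_K]
    norm_cast
  rw [h, integral_complex_ofReal] at h2
  exact Complex.ofReal_injective h2

lemma memLp_mul_of_bounded {f : Space d → ℂ} (hc : Continuous f) {M : ℝ} (hM : ∀ η, ‖f η‖ ≤ M)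
    (x : Lp ℂ 2 (volume : Measure (Space d))) : MemLp (fun η => f η * x η) 2 volume :=
  MemLp.of_le_mul (c := M) (Lp.memLp x)
    (hc.aestronglyMeasurable.mul (Lp.aestronglyMeasurable x)) (.of_forall fun η => by
      rw [norm_mul]; gcongr; exact hM η)

open Classical in
/-- The operator of multiplication by a bounded continuous function on `L²`; it is set to zero for
all other functions. -/
noncomputable def mulOp (f : Space d → ℂ) :
    Lp ℂ 2 (volume : Measure (Space d)) →L[ℂ] Lp ℂ 2 (volume : Measure (Space d)) :=
  if h : Continuous f ∧ ∃ M : ℝ, ∀ η, ‖f η‖ ≤ M then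
    LinearMap.mkContinuous
      { toFun := fun x => (memLp_mul_of_bounded h.1 h.2.choose_spec x).toLp _
        map_add' := fun x y => by
          rw [← MemLp.toLp_add, MemLp.toLp_eq_toLp_iff]
          filter_upwards [Lp.coeFn_add x y] with η hη
          rw [hη]; simp [mul_add]
        map_smul' := fun c x => by
          rw [RingHom.id_apply, ← MemLp.toLp_const_smul, MemLp.toLp_eq_toLp_iff]
          filter_upwards [Lp.coeFn_smul c x] with η hη
          rw [hη]; simp [mul_left_comm] }
      h.2.choose fun x => Lp.norm_le_mul_norm_of_ae_le_mul (by
        filter_upwards [MemLp.coeFn_toLp (memLp_mul_of_bounded h.1 h.2.choose_spec x)] with η hη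
        simp only [LinearMap.coe_mk, AddHom.coe_mk]
        rw [hη, norm_mul]; gcongr; exact h.2.choose_spec η)
  else 0

lemma coeFn_mulOp {f : Space d → ℂ} (hc : Continuous f) {M : ℝ} (hM : ∀ η, ‖f η‖ ≤ M)
    (x : Lp ℂ 2 (volume : Measure (Space d))) :
    (mulOp f x : Space d → ℂ) =ᵐ[volume] fun η => f η * x η := by
  have h : Continuous f ∧ ∃ M : ℝ, ∀ η, ‖f η‖ ≤ M := ⟨hc, M, hM⟩
  rw [mulOp, dif_pos h]
  exact MemLp.coeFn_toLp (memLp_mul_of_bounded h.1 h.2.choose_spec x)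

lemma norm_mulOp_le {f : Space d → ℂ} (hc : Continuous f) {M : ℝ} (hM : ∀ η, ‖f η‖ ≤ M)
    (x : Lp ℂ 2 (volume : Measure (Space d))) : ‖mulOp f x‖ ≤ M * ‖x‖ :=
  Lp.norm_le_mul_norm_of_ae_le_mul (by
    filter_upwards [coeFn_mulOp hc hM x] with η hη
    rw [hη, norm_mul]; gcongr; exact hM η)

lemma mulOp_mulOp {f g : Space d → ℂ} (hf : Continuous f) {M : ℝ} (hM : ∀ η, ‖f η‖ ≤ M)
    (hg : Continuous g) {N : ℝ} (hN : ∀ η, ‖g η‖ ≤ N)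
    (x : Lp ℂ 2 (volume : Measure (Space d))) :
    mulOp f (mulOp g x) = mulOp (fun η => f η * g η) x := by
  have hfg : ∀ η, ‖f η * g η‖ ≤ M * N := fun η => by
    rw [norm_mul]
    exact mul_le_mul (hM η) (hN η) (norm_nonneg _) ((norm_nonneg _).trans (hM η))
  ext1
  filter_upwards [coeFn_mulOp hf hM (mulOp g x), coeFn_mulOp hg hN x,
    coeFn_mulOp (f := fun η => f η * g η) (hf.mul hg) hfg x] with η h1 h2 h3
  rw [h1, h2, h3, mul_assoc]

lemma mulOp_one (x : Lp ℂ 2 (volume : Measure (Space d))) : mulOp 1 x = x := by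
  ext1
  filter_upwards [coeFn_mulOp (f := (1 : Space d → ℂ)) continuous_one (M := 1) (by simp) x]
    with η h1
  rw [h1]; simp

lemma inner_mulOp {f : Space d → ℂ} (hc : Continuous f) {M : ℝ} (hM : ∀ η, ‖f η‖ ≤ M)
    (x y : Lp ℂ 2 (volume : Measure (Space d))) :
    inner ℂ (mulOp f x) y = inner ℂ x (mulOp (fun η => (starRingEnd ℂ) (f η)) y) := by
  rw [L2.inner_def, L2.inner_def]
  refine integral_congr_ae ?_
  filter_upwards [coeFn_mulOp hc hM x, coeFn_mulOp (Complex.continuous_conj.comp hc) (M := M)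
    (fun η => by simpa using hM η) y] with η h1 h2
  rw [h1]
  erw [h2]
  simp only [RCLike.inner_apply, map_mul, Function.comp_apply]
  ring

/-- Multiplication operators converge strongly if the multipliers are uniformly bounded and converge
pointwise. -/
lemma tendsto_mulOp {ι : Type*} {l : Filter ι} [l.IsCountablyGenerated] {F : ι → Space d → ℂ}
    {f : Space d → ℂ} {M : ℝ} (hF : ∀ᶠ n in l, Continuous (F n))
    (hM : ∀ᶠ n in l, ∀ η, ‖F n η‖ ≤ M) (hf : Continuous f) (hfM : ∀ η, ‖f η‖ ≤ M)
    (hlim : ∀ η, Tendsto (fun n => F n η) l (𝓝 (f η)))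
    (x : Lp ℂ 2 (volume : Measure (Space d))) :
    Tendsto (fun n => mulOp (F n) x) l (𝓝 (mulOp f x)) := by
  have hx : Integrable fun η => ‖x η‖ ^ 2 :=
    (memLp_two_iff_integrable_sq_norm (Lp.aestronglyMeasurable x)).1 (Lp.memLp x)
  have h1 : Tendsto (fun n => ∫ η, ‖F n η - f η‖ ^ 2 * ‖x η‖ ^ 2) l (𝓝 (∫ _η : Space d, 0)) := by
    refine tendsto_integral_filter_of_dominated_convergence
      (fun η => (2 * M) ^ 2 * ‖x η‖ ^ 2) ?_ ?_ (hx.const_mul _) (.of_forall fun η => ?_)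
    · filter_upwards [hF] with n hn
      exact ((hn.sub hf).norm.pow 2).aestronglyMeasurable.mul
        ((Lp.aestronglyMeasurable x).norm.pow 2)
    · filter_upwards [hM] with n hn
      refine .of_forall fun η => ?_
      rw [Real.norm_of_nonneg (by positivity)]
      gcongr
      calc ‖F n η - f η‖ ≤ ‖F n η‖ + ‖f η‖ := norm_sub_le _ _
        _ ≤ 2 * M := by linarith [hn η, hfM η]
    · have := ((((hlim η).sub_const (f η)).norm).pow 2).mul_const (‖x η‖ ^ 2)
      simpa using this
  rw [integral_zero] at h1
  rw [tendsto_iff_norm_sub_tendsto_zero]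
  have h2 : ∀ᶠ n in l, √(∫ η, ‖F n η - f η‖ ^ 2 * ‖x η‖ ^ 2) = ‖mulOp (F n) x - mulOp f x‖ := by
    filter_upwards [hF, hM] with n hn hnM
    rw [← Real.sqrt_sq (norm_nonneg (mulOp (F n) x - mulOp f x)), L2_norm_sq_eq]
    congr 1
    refine integral_congr_ae ?_
    filter_upwards [coeFn_mulOp hn hnM x, coeFn_mulOp hf hfM x,
      Lp.coeFn_sub (mulOp (F n) x) (mulOp f x)] with η h1 h2 h3
    rw [h3, Pi.sub_apply, h1, h2, ← sub_mul, norm_mul, mul_pow]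
  refine Tendsto.congr' h2 ?_
  simpa using h1.sqrt

lemma mulOp_toL2 {g : Space d → ℂ} (hc : Continuous g) {M : ℝ} (hM : ∀ η, ‖g η‖ ≤ M)
    {φ ψ : 𝓢(Space d, ℂ)} (h : ∀ η, ψ η = g η * φ η) : mulOp g (toL2 d φ) = toL2 d ψ := by
  ext1
  filter_upwards [coeFn_mulOp hc hM (toL2 d φ), coeFn_toL2 φ, coeFn_toL2 ψ] with η h1 h2 h3
  rw [h1, h2, h3, h]

lemma continuous_phase (A : Matrix (Fin d) (Fin d) ℝ) : Continuous (phase A) :=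
  (hasTemperateGrowth_phase A).1.continuous

lemma mulOp_phase_toL2 (A : Matrix (Fin d) (Fin d) ℝ) (φ : 𝓢(Space d, ℂ)) :
    mulOp (phase A) (toL2 d φ) = toL2 d (phaseMul A φ) :=
  mulOp_toL2 (continuous_phase A) (fun η => (norm_phase A η).le) fun η => phaseMul_apply A φ η

end Multiplication


/-! ### Weak solutions and the gauge transformation -/

section Gauge

open Filter Topology

variable {d : ℕ}

/-- The operator `φ ↦ ∑ G a b X a X b φ + W φ` from the Schwartz functions to `L²`. -/
noncomputable def fullOp (G : Matrix (Fin d ⊕ Fin d) (Fin d ⊕ Fin d) ℝ) (W : Space d → ℝ) :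
    𝓢(Space d, ℂ) →ₗ[ℂ] Lp ℂ 2 (volume : Measure (Space d)) :=
  toL2 d ∘ₗ quadOp (phaseOp d) G + (mulOp fun η => ((W η : ℝ) : ℂ)).toLinearMap ∘ₗ toL2 d

lemma fullOp_apply (G : Matrix (Fin d ⊕ Fin d) (Fin d ⊕ Fin d) ℝ) (W : Space d → ℝ)
    (φ : 𝓢(Space d, ℂ)) : fullOp G W φ
      = toL2 d (quadOp (phaseOp d) G φ) + mulOp (fun η => ((W η : ℝ) : ℂ)) (toL2 d φ) := rfl

/-- `w ∈ C([0, T]; L²)` solves `i w' = (∑ G a b X a X b + W) w` weakly, tested with Schwartz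
functions in the sesquilinear pairing. -/
structure IsWeakSolution (T : ℝ) (G : ℝ → Matrix (Fin d ⊕ Fin d) (Fin d ⊕ Fin d) ℝ)
    (W : ℝ → Space d → ℝ) (w : ℝ → Lp ℂ 2 (volume : Measure (Space d))) : Prop where
  continuousOn : ContinuousOn w (Icc 0 T)
  equation : ∀ φ : 𝓢(Space d, ℂ), ∀ t ∈ Icc 0 T,
    HasDerivWithinAt (fun s => inner ℂ (toL2 d φ) (w s))
      (-Complex.I * inner ℂ (fullOp (G t) (W t) φ) (w t)) (Icc 0 T) t

lemma abs_quadForm_le {A : Matrix (Fin d) (Fin d) ℝ} {C : ℝ} (hC : 0 ≤ C) (hA : ∀ i j, |A i j| ≤ C)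
    (η : Space d) : |quadForm A η| ≤ d ^ 2 * C * ‖η‖ ^ 2 := by
  rw [quadForm_eq_sum]
  calc |∑ i, ∑ j, A i j * (η i * η j)| ≤ ∑ _i : Fin d, ∑ _j : Fin d, C * ‖η‖ ^ 2 := by
        refine (Finset.abs_sum_le_sum_abs _ _).trans (Finset.sum_le_sum fun i _ => ?_)
        refine (Finset.abs_sum_le_sum_abs _ _).trans (Finset.sum_le_sum fun j _ => ?_)
        rw [abs_mul, abs_mul, sq]
        exact mul_le_mul (hA i j) (mul_le_mul (PiLp.norm_apply_le η i) (PiLp.norm_apply_le η j)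
          (abs_nonneg _) (norm_nonneg _)) (by positivity) hC
    _ = _ := by simp; ring

lemma quadForm_sub (A A' : Matrix (Fin d) (Fin d) ℝ) (η : Space d) :
    quadForm (A - A') η = quadForm A η - quadForm A' η := by
  simp [quadForm, Matrix.sub_mulVec]

lemma quadForm_smul (c : ℝ) (A : Matrix (Fin d) (Fin d) ℝ) (η : Space d) :
    quadForm (c • A) η = c * quadForm A η := by
  simp [quadForm, Matrix.smul_mulVec]

lemma norm_phase_sub_le (A A' : Matrix (Fin d) (Fin d) ℝ) (η : Space d) :
    ‖phase A η - phase A' η‖ ≤ |quadForm (A - A') η| / 2 := by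
  have h : phase A η - phase A' η = phase A' η *
      (Complex.exp (Complex.I * ((quadForm (A - A') η / 2 : ℝ) : ℂ)) - 1) := by
    rw [mul_sub, mul_one, phase, phase, ← Complex.exp_add, quadForm_sub]
    congr 2
    push_cast; ring
  rw [h, norm_mul, norm_phase, one_mul]
  refine (Real.norm_exp_I_mul_ofReal_sub_one_le (x := quadForm (A - A') η / 2)).trans ?_
  rw [Real.norm_eq_abs, abs_div, abs_two]

lemma quadOp_fromBlocks_apply (R : Matrix (Fin d) (Fin d) ℝ) (φ : 𝓢(Space d, ℂ)) (η : Space d) :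
    quadOp (phaseOp d) (Matrix.fromBlocks 0 0 0 R) φ η = ((4 * quadForm R η : ℝ) : ℂ) * φ η := by
  rw [quadOp_apply]
  simp only [Fintype.sum_sum_type, Matrix.fromBlocks_apply₁₁, Matrix.fromBlocks_apply₁₂,
    Matrix.fromBlocks_apply₂₁, Matrix.fromBlocks_apply₂₂, Matrix.zero_apply, Complex.ofReal_zero,
    zero_smul, Finset.sum_const_zero, zero_add, sum_apply, smul_apply, phaseOp_inr_apply]
  rw [quadForm_eq_sum]
  push_cast
  simp only [Finset.mul_sum, Finset.sum_mul, smul_eq_mul]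
  refine Finset.sum_congr rfl fun i _ => Finset.sum_congr rfl fun j _ => ?_
  ring

lemma hasDerivWithinAt_quadForm {s : Set ℝ} {A : ℝ → Matrix (Fin d) (Fin d) ℝ}
    {A' : Matrix (Fin d) (Fin d) ℝ} {t : ℝ}
    (hA : ∀ i j, HasDerivWithinAt (fun r => A r i j) (A' i j) s t) (η : Space d) :
    HasDerivWithinAt (fun r => quadForm (A r) η) (quadForm A' η) s t := by
  simp only [quadForm_eq_sum]
  exact HasDerivWithinAt.fun_sum fun i _ => HasDerivWithinAt.fun_sum fun j _ =>
    (hA i j).mul_const _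

/-- A time dependent quadratic phase is strongly differentiable on Schwartz functions. -/
lemma hasDerivWithinAt_phaseMul {s : Set ℝ} {A : ℝ → Matrix (Fin d) (Fin d) ℝ}
    {A' : Matrix (Fin d) (Fin d) ℝ} {t : ℝ}
    (hA : ∀ i j, HasDerivWithinAt (fun r => A r i j) (A' i j) s t) (φ : 𝓢(Space d, ℂ)) :
    HasDerivWithinAt (fun r => toL2 d (phaseMul (A r) φ))
      (Complex.I • toL2 d (phaseMul (A t)
        (quadOp (phaseOp d) (Matrix.fromBlocks 0 0 0 ((8 : ℝ)⁻¹ • A')) φ))) s t := by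
  -- the difference quotients are bounded multipliers applied to `(1 + |η|²) φ`
  have hg : Function.HasTemperateGrowth fun η : Space d => ((1 + ‖η‖ ^ 2 : ℝ) : ℂ) := by
    have h1 : Function.HasTemperateGrowth fun η : Space d => 1 + ‖η‖ ^ 2 := by fun_prop
    exact Complex.ofRealCLM.hasTemperateGrowth.comp h1
  set ψ : 𝓢(Space d, ℂ) := SchwartzMap.smulLeftCLM ℂ (fun η : Space d => ((1 + ‖η‖ ^ 2 : ℝ) : ℂ)) φ
  have hψ : ∀ η, ψ η = ((1 + ‖η‖ ^ 2 : ℝ) : ℂ) * φ η := fun η => by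
    simp only [ψ]
    rw [SchwartzMap.smulLeftCLM_apply_apply hg, smul_eq_mul]
  have hpos : ∀ η : Space d, (1 + ‖η‖ ^ 2 : ℝ) ≠ 0 := fun η => by positivity
  set F : ℝ → Space d → ℂ := fun r η =>
    (((r - t)⁻¹ * (1 + ‖η‖ ^ 2)⁻¹ : ℝ) : ℂ) * (phase (A r) η - phase (A t) η)
  set f : Space d → ℂ := fun η =>
    (((1 + ‖η‖ ^ 2)⁻¹ : ℝ) : ℂ) * (Complex.I * ((quadForm A' η / 2 : ℝ) : ℂ) * phase (A t) η)
  obtain ⟨C, hC0, hC⟩ : ∃ C : ℝ, 0 ≤ C ∧ ∀ i j, |A' i j| + 1 ≤ C := by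
    refine ⟨∑ i, ∑ j, (|A' i j| + 1), by positivity, fun i j => ?_⟩
    exact (Finset.single_le_sum (f := fun j => |A' i j| + 1) (fun _ _ => by positivity)
      (Finset.mem_univ j)).trans (Finset.single_le_sum (f := fun i => ∑ j, (|A' i j| + 1))
        (fun _ _ => by positivity) (Finset.mem_univ i))
  have hcF : ∀ r, Continuous (F r) := fun r => by
    have h1 : Continuous fun η : Space d => (r - t)⁻¹ * (1 + ‖η‖ ^ 2)⁻¹ :=
      continuous_const.mul (Continuous.inv₀ (by fun_prop) hpos)
    exact (Complex.continuous_ofReal.comp h1).mul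
      ((continuous_phase (A r)).sub (continuous_phase (A t)))
  have hcf : Continuous f := by
    have h1 : Continuous fun η : Space d => (1 + ‖η‖ ^ 2)⁻¹ :=
      Continuous.inv₀ (by fun_prop) hpos
    have h2 : Continuous (quadForm A') := (hasTemperateGrowth_quadForm A').1.continuous
    exact (Complex.continuous_ofReal.comp h1).mul ((continuous_const.mul
      (Complex.continuous_ofReal.comp (h2.div_const 2))).mul (continuous_phase (A t)))
  have hlim : ∀ η, Tendsto (fun r => F r η) (𝓝[s \ {t}] t) (𝓝 (f η)) := fun η => by
    have h1 : HasDerivWithinAt (fun r => phase (A r) η)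
        (Complex.I * ((quadForm A' η / 2 : ℝ) : ℂ) * phase (A t) η) s t := by
      have h2 := (((hasDerivWithinAt_quadForm hA η).div_const 2).ofReal_comp.const_mul
        Complex.I).cexp
      exact h2.congr_deriv (mul_comm _ _)
    have h3 := (hasDerivWithinAt_iff_tendsto_slope.1 h1).const_mul (((1 + ‖η‖ ^ 2)⁻¹ : ℝ) : ℂ)
    refine h3.congr fun r => ?_
    simp only [F, slope_def_module, Complex.real_smul]
    push_cast; ring
  have hbF : ∀ᶠ r in 𝓝[s \ {t}] t, ∀ η, ‖F r η‖ ≤ d ^ 2 * C := by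
    have h1 : ∀ᶠ r in 𝓝[s \ {t}] t, ∀ i j, |(r - t)⁻¹ * (A r i j - A t i j)| ≤ C := by
      refine eventually_all.2 fun i => eventually_all.2 fun j => ?_
      have h2 := (hasDerivWithinAt_iff_tendsto_slope.1 (hA i j)).abs.eventually_lt_const
        (lt_add_one |A' i j|)
      filter_upwards [h2] with r hr
      rw [slope_def_module, smul_eq_mul] at hr
      exact hr.le.trans (hC i j)
    filter_upwards [h1] with r hr η
    have h3 := abs_quadForm_le hC0 (A := (r - t)⁻¹ • (A r - A t)) hr η
    rw [quadForm_smul, abs_mul] at h3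
    simp only [F]
    rw [norm_mul, Complex.norm_real, Real.norm_eq_abs, abs_mul, abs_of_nonneg
      (show (0 : ℝ) ≤ (1 + ‖η‖ ^ 2)⁻¹ by positivity)]
    calc |(r - t)⁻¹| * (1 + ‖η‖ ^ 2)⁻¹ * ‖phase (A r) η - phase (A t) η‖
        ≤ |(r - t)⁻¹| * (1 + ‖η‖ ^ 2)⁻¹ * (|quadForm (A r - A t) η| / 2) := by
          gcongr; exact norm_phase_sub_le _ _ _
      _ = (|(r - t)⁻¹| * |quadForm (A r - A t) η|) * (1 + ‖η‖ ^ 2)⁻¹ / 2 := by ring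
      _ ≤ (d ^ 2 * C * ‖η‖ ^ 2) * (1 + ‖η‖ ^ 2)⁻¹ / 2 := by gcongr
      _ = (d ^ 2 * C) * (‖η‖ ^ 2 / (1 + ‖η‖ ^ 2)) / 2 := by ring
      _ ≤ (d ^ 2 * C) * 1 / 1 := by
          gcongr
          · rw [div_le_one (by positivity)]; linarith
          · norm_num
      _ = _ := by ring
  have hbf : ∀ η, ‖f η‖ ≤ d ^ 2 * C := fun η => by
    have h3 := abs_quadForm_le hC0 (A := A') (fun i j => by linarith [hC i j]) η
    simp only [f]
    rw [norm_mul, norm_mul, norm_mul, norm_phase, Complex.norm_I, Complex.norm_real,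
      Complex.norm_real, Real.norm_eq_abs, Real.norm_eq_abs, abs_of_nonneg
      (show (0 : ℝ) ≤ (1 + ‖η‖ ^ 2)⁻¹ by positivity), abs_div, abs_two, one_mul, mul_one]
    calc (1 + ‖η‖ ^ 2)⁻¹ * (|quadForm A' η| / 2)
        ≤ (1 + ‖η‖ ^ 2)⁻¹ * ((d ^ 2 * C * ‖η‖ ^ 2) / 2) := by gcongr
      _ = (d ^ 2 * C) * (‖η‖ ^ 2 / (1 + ‖η‖ ^ 2)) / 2 := by ring
      _ ≤ (d ^ 2 * C) * 1 / 1 := by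
          gcongr
          · rw [div_le_one (by positivity)]; linarith
          · norm_num
      _ = _ := by ring
  have hmain := tendsto_mulOp (l := 𝓝[s \ {t}] t) (.of_forall hcF) hbF hcf hbf hlim (toL2 d ψ)
  rw [hasDerivWithinAt_iff_tendsto_slope]
  have e1 : mulOp f (toL2 d ψ) = Complex.I • toL2 d (phaseMul (A t)
        (quadOp (phaseOp d) (Matrix.fromBlocks 0 0 0 ((8 : ℝ)⁻¹ • A')) φ)) := by
    rw [← map_smul]
    refine mulOp_toL2 hcf hbf fun η => ?_
    have h0 : (1 + (‖η‖ : ℂ) ^ 2) ≠ 0 := by exact_mod_cast hpos η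
    rw [smul_apply, phaseMul_apply, quadOp_fromBlocks_apply, hψ, quadForm_smul]
    simp only [f, smul_eq_mul]
    push_cast
    field_simp
    ring
  rw [e1] at hmain
  refine hmain.congr' ?_
  filter_upwards [hbF] with r hr
  rw [slope_def_module, ← map_sub, RCLike.real_smul_eq_coe_smul (K := ℂ), ← map_smul]
  refine mulOp_toL2 (hcF r) hr fun η => ?_
  have h0 : (1 + (‖η‖ : ℂ) ^ 2) ≠ 0 := by exact_mod_cast hpos η
  rw [smul_apply, sub_apply, phaseMul_apply, phaseMul_apply, hψ]
  simp only [F, smul_eq_mul]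
  push_cast
  field_simp
  rfl

/-- The product rule for `⟪x, w⟫` if `x` is differentiable and `w` is weakly differentiable. -/
lemma hasDerivWithinAt_inner_of_weak {H : Type*} [NormedAddCommGroup H] [InnerProductSpace ℂ H]
    {s : Set ℝ} {x w : ℝ → H} {x' : H} {c : ℂ} {t : ℝ} (hx : HasDerivWithinAt x x' s t)
    (hw : ContinuousWithinAt w s t)
    (h : HasDerivWithinAt (fun r => inner ℂ (x t) (w r)) c s t) :
    HasDerivWithinAt (fun r => inner ℂ (x r) (w r)) (inner ℂ x' (w t) + c) s t := by
  rw [hasDerivWithinAt_iff_tendsto_slope] at hx h ⊢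
  have hw' : Tendsto w (𝓝[s \ {t}] t) (𝓝 (w t)) := hw.mono sdiff_subset
  refine ((hx.inner hw').add h).congr fun r => ?_
  simp only [slope_def_module, ← Complex.coe_smul, inner_smul_left, inner_sub_left,
    Complex.conj_ofReal, smul_eq_mul]
  ring

variable {T : ℝ} {w : ℝ → Lp ℂ 2 (volume : Measure (Space d))} {W : ℝ → Space d → ℝ}

lemma conj_phase (A : Matrix (Fin d) (Fin d) ℝ) (η : Space d) :
    (starRingEnd ℂ) (phase A η) = phase (-A) η := by
  have h : quadForm (-A) η = -quadForm A η := by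
    simpa using quadForm_smul (-1) A η
  rw [phase, phase, ← Complex.exp_conj, h]
  congr 1
  simp only [map_mul, Complex.conj_I, Complex.conj_ofReal]
  push_cast
  ring

lemma inner_mulOp_phase (A : Matrix (Fin d) (Fin d) ℝ)
    (x y : Lp ℂ 2 (volume : Measure (Space d))) :
    inner ℂ (mulOp (phase A) x) y = inner ℂ x (mulOp (phase (-A)) y) := by
  rw [inner_mulOp (continuous_phase A) (fun η => (norm_phase A η).le)]
  simp only [conj_phase]

lemma mulOp_phase_neg (A : Matrix (Fin d) (Fin d) ℝ) (x : Lp ℂ 2 (volume : Measure (Space d))) :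
    mulOp (phase A) (mulOp (phase (-A)) x) = x := by
  rw [mulOp_mulOp (continuous_phase A) (fun η => (norm_phase A η).le) (continuous_phase (-A))
    (fun η => (norm_phase (-A) η).le)]
  have : (fun η => phase A η * phase (-A) η) = 1 := by
    ext η; rw [← conj_phase, mul_comm, conj_phase_mul_phase]; rfl
  rw [this, mulOp_one]

lemma norm_mulOp_phase (A : Matrix (Fin d) (Fin d) ℝ) (x : Lp ℂ 2 (volume : Measure (Space d))) :
    ‖mulOp (phase A) x‖ = ‖x‖ := by
  have h : ∀ (A : Matrix (Fin d) (Fin d) ℝ) x, ‖mulOp (phase A) x‖ ≤ ‖x‖ := fun A x => by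
    simpa using norm_mulOp_le (continuous_phase A) (fun η => (norm_phase A η).le) x
  refine le_antisymm (h A x) ?_
  have h2 := h (-A) (mulOp (phase A) x)
  have h3 := mulOp_phase_neg (-A) x
  rw [neg_neg] at h3
  rwa [h3] at h2

/-- Multiplication of a weak solution by a quadratic phase changes the symbol to `gaugeSymbol B A`
and adds the time derivative of the phase `ηᵀ A η / 2` to the Hamiltonian. -/
lemma IsWeakSolution.gauge {B A A' : ℝ → Matrix (Fin d) (Fin d) ℝ}
    (h : IsWeakSolution T (fun t => gaugeSymbol (B t) 0) W w)
    {M : ℝ} (hWc : ∀ t ∈ Icc 0 T, Continuous (W t)) (hWM : ∀ t ∈ Icc 0 T, ∀ η, |W t η| ≤ M)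
    (hs : ∀ t ∈ Icc 0 T, (A t).IsSymm)
    (hA : ∀ t ∈ Icc 0 T, ∀ i j, HasDerivWithinAt (fun r => A r i j) (A' t i j) (Icc 0 T) t) :
    IsWeakSolution T
      (fun t => gaugeSymbol (B t) (A t) + Matrix.fromBlocks 0 0 0 ((8 : ℝ)⁻¹ • A' t)) W
      (fun t => mulOp (phase (-A t)) (w t)) where
  continuousOn := fun t ht => by
    have h1 : Tendsto (fun s => mulOp (phase (-A s)) (w t)) (𝓝[Icc 0 T] t)
        (𝓝 (mulOp (phase (-A t)) (w t))) := by
      refine tendsto_mulOp (M := 1) (.of_forall fun s => continuous_phase _)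
        (.of_forall fun s η => (norm_phase _ η).le) (continuous_phase _)
        (fun η => (norm_phase _ η).le) (fun η => ?_) _
      have h2 : ContinuousWithinAt (fun s => phase (-A s) η) (Icc 0 T) t := by
        have h3 := (hasDerivWithinAt_quadForm (A := fun s => -A s) (A' := -A' t)
          (fun i j => (hA t ht i j).neg) η).continuousWithinAt
        unfold phase
        exact (Complex.continuous_exp.tendsto _).comp (((Complex.continuous_ofReal.tendsto _).comp
          (h3.div_const 2)).const_mul Complex.I)
      exact h2
    have h4 : Tendsto (fun s => mulOp (phase (-A s)) (w s - w t)) (𝓝[Icc 0 T] t) (𝓝 0) := by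
      rw [tendsto_zero_iff_norm_tendsto_zero]
      simp only [norm_mulOp_phase]
      exact tendsto_iff_norm_sub_tendsto_zero.1 (h.continuousOn t ht)
    have := h4.add h1
    rw [zero_add] at this
    exact this.congr fun s => by rw [map_sub, sub_add_cancel]
  equation := fun φ t ht => by
    have hWb : ∀ η, ‖((W t η : ℝ) : ℂ)‖ ≤ M := fun η => by
      rw [Complex.norm_real]; exact hWM t ht η
    have hWc' : Continuous fun η => ((W t η : ℝ) : ℂ) := Complex.continuous_ofReal.comp (hWc t ht)
    have h1 := hasDerivWithinAt_inner_of_weak (hasDerivWithinAt_phaseMul (hA t ht) φ)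
      (h.continuousOn t ht) (h.equation (phaseMul (A t) φ) t ht)
    have h2 : ∀ s (f : 𝓢(Space d, ℂ)), inner ℂ (toL2 d (phaseMul (A s) f)) (w s)
        = inner ℂ (toL2 d f) (mulOp (phase (-A s)) (w s)) := fun s f => by
      rw [← mulOp_phase_toL2, inner_mulOp_phase]
    simp only [h2] at h1
    refine h1.congr_deriv ?_
    have h5 : mulOp (fun η => ((W t η : ℝ) : ℂ)) (toL2 d (phaseMul (A t) φ))
        = mulOp (phase (A t)) (mulOp (fun η => ((W t η : ℝ) : ℂ)) (toL2 d φ)) := by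
      rw [← mulOp_phase_toL2, mulOp_mulOp hWc' hWb (continuous_phase _)
        (fun η => (norm_phase _ η).le), mulOp_mulOp (continuous_phase _)
        (fun η => (norm_phase _ η).le) hWc' hWb]
      congr 2
      ext η; ring
    have h6 : ∀ G G' : Matrix (Fin d ⊕ Fin d) (Fin d ⊕ Fin d) ℝ,
        quadOp (phaseOp d) (G + G') φ = quadOp (phaseOp d) G φ + quadOp (phaseOp d) G' φ :=
      fun G G' => by
        simp only [quadOp_apply, Matrix.add_apply, Complex.ofReal_add, add_smul,
          Finset.sum_add_distrib]
    simp only [fullOp_apply, quadOp_phaseMul (B t) (hs t ht), h5, h6, map_add, inner_add_left,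
      inner_smul_left, h2, inner_mulOp_phase, Complex.conj_I]
    ring

end Gauge


/-! ### Galerkin approximation in the Hermite spaces -/

section Galerkin

open Filter Topology

variable {d : ℕ}

/-- The Schwartz function that represents an element of `hermiteL2 d n`. -/
noncomputable def hermiteRep (d n : ℕ) : hermiteL2 d n →ₗ[ℂ] 𝓢(Space d, ℂ) :=
  (hermiteSpace d n).subtype ∘ₗ
    (Submodule.equivMapOfInjective (toL2 d) toL2_injective (hermiteSpace d n)).symm.toLinearMap

lemma hermiteRep_mem {n : ℕ} (x : hermiteL2 d n) : hermiteRep d n x ∈ hermiteSpace d n :=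
  ((Submodule.equivMapOfInjective (toL2 d) toL2_injective (hermiteSpace d n)).symm x).2

lemma toL2_hermiteRep {n : ℕ} (x : hermiteL2 d n) : toL2 d (hermiteRep d n x) = x := by
  have := Submodule.coe_equivMapOfInjective_apply (toL2 d) toL2_injective (hermiteSpace d n)
    ((Submodule.equivMapOfInjective (toL2 d) toL2_injective (hermiteSpace d n)).symm x)
  exact this.symm.trans (congrArg Subtype.val (LinearEquiv.apply_symm_apply _ x))

lemma norm_toL2_hermiteRep {n : ℕ} (x : hermiteL2 d n) : ‖toL2 d (hermiteRep d n x)‖ = ‖x‖ :=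
  congrArg norm (toL2_hermiteRep x)

/-- The compression of `fullOp G W` to `hermiteL2 d n`. -/
noncomputable def galerkinOp (n : ℕ) (G : Matrix (Fin d ⊕ Fin d) (Fin d ⊕ Fin d) ℝ)
    (W : Space d → ℝ) : hermiteL2 d n →L[ℂ] hermiteL2 d n :=
  LinearMap.toContinuousLinearMap
    ((hermiteL2 d n).orthogonalProjectionOnto.toLinearMap ∘ₗ fullOp G W ∘ₗ hermiteRep d n)

lemma galerkinOp_apply (n : ℕ) (G : Matrix (Fin d ⊕ Fin d) (Fin d ⊕ Fin d) ℝ)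
    (W : Space d → ℝ) (x : hermiteL2 d n) : galerkinOp n G W x
      = (hermiteL2 d n).orthogonalProjectionOnto (fullOp G W (hermiteRep d n x)) := rfl

/-- The coefficients of a time dependent Hamiltonian on `[0, T]`: a symmetric symbol and a bounded
potential, continuous in time. -/
structure IsRegularHamiltonian (T M : ℝ) (G : ℝ → Matrix (Fin d ⊕ Fin d) (Fin d ⊕ Fin d) ℝ)
    (W : ℝ → Space d → ℝ) : Prop where
  symm : ∀ t ∈ Icc 0 T, (G t).IsSymm
  continuousOn_symbol : ∀ a b, ContinuousOn (fun t => G t a b) (Icc 0 T)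
  continuous_potential : ∀ t ∈ Icc 0 T, Continuous (W t)
  bound : ∀ t ∈ Icc 0 T, ∀ η, |W t η| ≤ M
  continuousOn_potential : ∀ η, ContinuousOn (fun t => W t η) (Icc 0 T)

variable {T M : ℝ} {G : ℝ → Matrix (Fin d ⊕ Fin d) (Fin d ⊕ Fin d) ℝ} {W : ℝ → Space d → ℝ}

lemma IsRegularHamiltonian.mono (h : IsRegularHamiltonian T M G W) {τ : ℝ} (hτ : τ ≤ T) :
    IsRegularHamiltonian τ M G W where
  symm t ht := h.symm t (Icc_subset_Icc_right hτ ht)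
  continuousOn_symbol a b := (h.continuousOn_symbol a b).mono (Icc_subset_Icc_right hτ)
  continuous_potential t ht := h.continuous_potential t (Icc_subset_Icc_right hτ ht)
  bound t ht := h.bound t (Icc_subset_Icc_right hτ ht)
  continuousOn_potential η := (h.continuousOn_potential η).mono (Icc_subset_Icc_right hτ)

namespace IsRegularHamiltonian

lemma norm_mulOp_le (h : IsRegularHamiltonian T M G W) {t : ℝ} (ht : t ∈ Icc 0 T)
    (x : Lp ℂ 2 (volume : Measure (Space d))) :
    ‖mulOp (fun η => ((W t η : ℝ) : ℂ)) x‖ ≤ M * ‖x‖ :=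
  _root_.norm_mulOp_le (Complex.continuous_ofReal.comp (h.continuous_potential t ht))
    (fun η => by simpa using h.bound t ht η) x

lemma symm_mulOp (h : IsRegularHamiltonian T M G W) {t : ℝ} (ht : t ∈ Icc 0 T)
    (x y : Lp ℂ 2 (volume : Measure (Space d))) :
    inner ℂ (mulOp (fun η => ((W t η : ℝ) : ℂ)) x) y
      = inner ℂ x (mulOp (fun η => ((W t η : ℝ) : ℂ)) y) := by
  rw [inner_mulOp (f := fun η => ((W t η : ℝ) : ℂ))
    (Complex.continuous_ofReal.comp (h.continuous_potential t ht))
    (M := M) (fun η => by simpa using h.bound t ht η)]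
  simp only [Complex.conj_ofReal]

lemma symm_fullOp (h : IsRegularHamiltonian T M G W) {t : ℝ} (ht : t ∈ Icc 0 T)
    (φ ψ : 𝓢(Space d, ℂ)) :
    inner ℂ (fullOp (G t) (W t) φ) (toL2 d ψ) = inner ℂ (toL2 d φ) (fullOp (G t) (W t) ψ) := by
  rw [fullOp_apply, fullOp_apply, inner_add_left, inner_add_right,
    (isCCR_phaseOp d).symm_quadOp (h.symm t ht), h.symm_mulOp ht]

lemma symm_galerkinOp (h : IsRegularHamiltonian T M G W) (n : ℕ) {t : ℝ} (ht : t ∈ Icc 0 T)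
    (x y : hermiteL2 d n) :
    inner ℂ (galerkinOp n (G t) (W t) x) y = inner ℂ x (galerkinOp n (G t) (W t) y) := by
  rw [galerkinOp_apply, galerkinOp_apply, Submodule.inner_orthogonalProjectionOnto_eq_of_mem_right,
    Submodule.inner_orthogonalProjectionOnto_eq_of_mem_left, ← toL2_hermiteRep y,
    h.symm_fullOp ht, toL2_hermiteRep]

lemma continuousOn_fullOp (h : IsRegularHamiltonian T M G W) (φ : 𝓢(Space d, ℂ)) :
    ContinuousOn (fun t => fullOp (G t) (W t) φ) (Icc 0 T) := by
  simp only [fullOp_apply, quadOp_apply, map_sum, map_smul]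
  refine ContinuousOn.add (continuousOn_finsetSum _ fun a _ => continuousOn_finsetSum _ fun b _ =>
    (Complex.continuous_ofReal.comp_continuousOn (h.continuousOn_symbol a b)).smul
      continuousOn_const) fun t ht => ?_
  refine tendsto_mulOp (M := M) ?_ ?_ (Complex.continuous_ofReal.comp
    (h.continuous_potential t ht)) (fun η => by simpa using h.bound t ht η) (fun η =>
      (Complex.continuous_ofReal.tendsto _).comp (h.continuousOn_potential η t ht)) _
  · filter_upwards [self_mem_nhdsWithin] with s hs
    exact Complex.continuous_ofReal.comp (h.continuous_potential s hs)
  · filter_upwards [self_mem_nhdsWithin] with s hs η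
    simpa using h.bound s hs η

lemma continuousOn_galerkinOp (h : IsRegularHamiltonian T M G W) (n : ℕ) :
    ContinuousOn (fun t => galerkinOp n (G t) (W t)) (Icc 0 T) :=
  continuousOn_clm_apply.2 fun x =>
    (hermiteL2 d n).orthogonalProjectionOnto.continuous.comp_continuousOn
      (h.continuousOn_fullOp (hermiteRep d n x))

end IsRegularHamiltonian

/-- The part of `fullOp G W x` that the Galerkin projection removes. -/
noncomputable def galerkinResidual (n : ℕ) (G : Matrix (Fin d ⊕ Fin d) (Fin d ⊕ Fin d) ℝ)
    (W : Space d → ℝ) (x : hermiteL2 d n) : Lp ℂ 2 (volume : Measure (Space d)) :=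
  fullOp G W (hermiteRep d n x)
    - (hermiteL2 d n).starProjection (fullOp G W (hermiteRep d n x))

lemma norm_sub_starProjection_le (n : ℕ) (x : Lp ℂ 2 (volume : Measure (Space d))) :
    ‖x - (hermiteL2 d n).starProjection x‖ ≤ ‖x‖ := by
  rw [← Submodule.starProjection_orthogonal_val]
  exact Submodule.norm_starProjection_apply_le _ _

/-- If the quadratic part preserves the Hermite space, only the potential has a residual. -/
lemma IsRegularHamiltonian.norm_galerkinResidual_le (h : IsRegularHamiltonian T M G W) {n : ℕ}
    {t : ℝ} (ht : t ∈ Icc 0 T)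
    (hinv : ∀ φ ∈ hermiteSpace d n, quadOp (phaseOp d) (G t) φ ∈ hermiteSpace d n)
    (x : hermiteL2 d n) : ‖galerkinResidual n (G t) (W t) x‖ ≤ M * ‖x‖ := by
  have h1 : toL2 d (quadOp (phaseOp d) (G t) (hermiteRep d n x)) ∈ hermiteL2 d n :=
    Submodule.mem_map_of_mem (hinv _ (hermiteRep_mem x))
  rw [galerkinResidual, fullOp_apply, map_add, Submodule.starProjection_eq_self_iff.2 h1,
    add_sub_add_left_eq_sub, toL2_hermiteRep]
  exact (norm_sub_starProjection_le n _).trans (h.norm_mulOp_le ht _)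

variable {w : ℝ → Lp ℂ 2 (volume : Measure (Space d))}

lemma inner_hermiteL2_eq_sum {n k : ℕ} (b : OrthonormalBasis (Fin k) ℂ (hermiteL2 d n))
    (x : hermiteL2 d n) (y : Lp ℂ 2 (volume : Measure (Space d))) :
    inner ℂ (x : Lp ℂ 2 (volume : Measure (Space d))) y
      = ∑ i, inner ℂ x (b i) * inner ℂ (b i : Lp ℂ 2 (volume : Measure (Space d))) y := by
  have := b.sum_inner_mul_inner x ((hermiteL2 d n).orthogonalProjectionOnto y)
  simp only [Submodule.inner_orthogonalProjectionOnto_eq_of_mem_left] at this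
  exact this.symm

namespace IsWeakSolution

lemma mono (h : IsWeakSolution T G W w) {τ : ℝ} (hτ : τ ≤ T) : IsWeakSolution τ G W w where
  continuousOn := h.continuousOn.mono (Icc_subset_Icc_right hτ)
  equation φ t ht := (h.equation φ t (Icc_subset_Icc_right hτ ht)).mono (Icc_subset_Icc_right hτ)

/-- The pairing of a Galerkin solution with a weak solution would be constant in time if the
Galerkin spaces were invariant; its derivative is given by the Galerkin residual. -/
lemma hasDerivWithinAt_inner (h : IsWeakSolution T G W w) {n : ℕ} {u : ℝ → hermiteL2 d n}
    (hu : IsSchrodingerCurve T (fun t => galerkinOp n (G t) (W t)) u) {t : ℝ} (ht : t ∈ Icc 0 T) :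
    HasDerivWithinAt
      (fun s => inner ℂ (u s : Lp ℂ 2 (volume : Measure (Space d))) (w s))
      (-Complex.I * inner ℂ (galerkinResidual n (G t) (W t) (u t))
        (w t - (hermiteL2 d n).starProjection (w t))) (Icc 0 T) t := by
  obtain ⟨k, ⟨b⟩⟩ : ∃ k, Nonempty (OrthonormalBasis (Fin k) ℂ (hermiteL2 d n)) :=
    ⟨_, ⟨stdOrthonormalBasis ℂ (hermiteL2 d n)⟩⟩
  have h1 : ∀ i, HasDerivWithinAt (fun s => inner ℂ (u s) (b i))
      (inner ℂ (-Complex.I • galerkinOp n (G t) (W t) (u t)) (b i)) (Icc 0 T) t := fun i => by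
    simpa using HasDerivWithinAt.inner ℂ (hu t ht) (hasDerivWithinAt_const t (Icc 0 T) (b i))
  have h2 : ∀ i, HasDerivWithinAt
      (fun s => inner ℂ (b i : Lp ℂ 2 (volume : Measure (Space d))) (w s))
      (-Complex.I * inner ℂ (fullOp (G t) (W t) (hermiteRep d n (b i))) (w t)) (Icc 0 T) t :=
    fun i => by simpa only [toL2_hermiteRep] using h.equation (hermiteRep d n (b i)) t ht
  have h3 := HasDerivWithinAt.fun_sum (u := Finset.univ) fun i _ => (h1 i).mul (h2 i)
  have h4 : ∀ s, inner ℂ (u s : Lp ℂ 2 (volume : Measure (Space d))) (w s)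
      = ∑ i, inner ℂ (u s) (b i) * inner ℂ (b i : Lp ℂ 2 (volume : Measure (Space d))) (w s) :=
    fun s => inner_hermiteL2_eq_sum b (u s) (w s)
  simp only [h4]
  refine h3.congr_deriv ?_
  rw [Finset.sum_add_distrib, ← inner_hermiteL2_eq_sum]
  have h5 : ∑ i, inner ℂ (u t) (b i) *
      (-Complex.I * inner ℂ (fullOp (G t) (W t) (hermiteRep d n (b i))) (w t))
      = -Complex.I * inner ℂ (fullOp (G t) (W t) (hermiteRep d n (u t))) (w t) := by
    conv_rhs => rw [← b.sum_repr' (u t)]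
    simp only [map_sum, map_smul, sum_inner, inner_smul_left, inner_conj_symm, Finset.mul_sum]
    exact Finset.sum_congr rfl fun i _ => by ring
  have h6 : inner ℂ (galerkinResidual n (G t) (W t) (u t))
      ((hermiteL2 d n).starProjection (w t)) = 0 :=
    Submodule.starProjection_inner_eq_zero _ _ (Submodule.starProjection_apply_mem _ _)
  rw [h5, inner_sub_right, h6, galerkinResidual, inner_sub_left, Submodule.coe_smul,
    inner_smul_left, galerkinOp_apply, Submodule.starProjection_apply]
  simp only [map_neg, Complex.conj_I]
  ring

/-- The projections of a continuous curve converge uniformly in time, by Dini's theorem. -/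
lemma eventually_norm_sub_starProjection_le (h : IsWeakSolution T G W w) {δ : ℝ} (hδ : 0 < δ) :
    ∀ᶠ n in atTop, ∀ t ∈ Icc 0 T, ‖w t - (hermiteL2 d n).starProjection (w t)‖ ≤ δ := by
  have h1 := Antitone.tendstoUniformlyOn_of_forall_tendsto
    (F := fun n t => ‖w t - (hermiteL2 d n).starProjection (w t)‖) (f := fun _ => (0 : ℝ))
    (s := Icc 0 T) isCompact_Icc
    (fun n => (h.continuousOn.sub
      ((hermiteL2 d n).starProjection.continuous.comp_continuousOn h.continuousOn)).norm)
    (fun t _ m n hmn => by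
      have h2 : w t - (hermiteL2 d n).starProjection (w t)
          = (w t - (hermiteL2 d m).starProjection (w t))
            - (hermiteL2 d n).starProjection (w t - (hermiteL2 d m).starProjection (w t)) := by
        rw [map_sub, Submodule.starProjection_eq_self_iff.2
          (hermiteL2_mono hmn (Submodule.starProjection_apply_mem (hermiteL2 d m) (w t)))]
        abel
      dsimp only
      rw [h2]
      exact norm_sub_starProjection_le n _)
    continuousOn_const
    (fun t _ => by
      have := (tendsto_starProjection_hermiteL2 (w t)).const_sub (w t)
      simpa using this.norm)
  filter_upwards [Metric.tendstoUniformlyOn_iff.1 h1 δ hδ] with n hn t ht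
  have := hn t ht
  rw [dist_zero_left, Real.norm_of_nonneg (norm_nonneg _)] at this
  exact this.le

lemma norm_inner_sub_inner_le (h : IsWeakSolution T G W w) {n : ℕ} {u : ℝ → hermiteL2 d n}
    (hu : IsSchrodingerCurve T (fun t => galerkinOp n (G t) (W t)) u) {D δ : ℝ}
    (hD : ∀ t ∈ Icc 0 T, ‖galerkinResidual n (G t) (W t) (u t)‖ ≤ D)
    (hδ : ∀ t ∈ Icc 0 T, ‖w t - (hermiteL2 d n).starProjection (w t)‖ ≤ δ)
    {t : ℝ} (ht : t ∈ Icc 0 T) :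
    ‖inner ℂ (u t : Lp ℂ 2 (volume : Measure (Space d))) (w t)
      - inner ℂ (u 0 : Lp ℂ 2 (volume : Measure (Space d))) (w 0)‖ ≤ D * δ * t := by
  have h0 : (0 : ℝ) ∈ Icc 0 T := ⟨le_rfl, ht.1.trans ht.2⟩
  have := (convex_Icc 0 T).norm_image_sub_le_of_norm_hasDerivWithin_le (C := D * δ)
    (fun s hs => h.hasDerivWithinAt_inner hu hs) (fun s hs => by
      rw [norm_mul, norm_neg, Complex.norm_I, one_mul]
      exact (norm_inner_le_norm _ _).trans (mul_le_mul (hD s hs) (hδ s hs) (norm_nonneg _)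
        ((norm_nonneg _).trans (hD s hs)))) h0 ht
  rwa [sub_zero, Real.norm_of_nonneg ht.1] at this

/-- If the quadratic part preserves the Hermite spaces, the `L²` norm of a weak solution does not
grow: it is tested with Galerkin solutions of the terminal value problem. -/
lemma norm_le (h : IsWeakSolution T G W w) (hR : IsRegularHamiltonian T M G W)
    (hinv : ∀ t ∈ Icc 0 T, ∀ n, ∀ φ ∈ hermiteSpace d n,
      quadOp (phaseOp d) (G t) φ ∈ hermiteSpace d n)
    {t : ℝ} (ht : t ∈ Icc 0 T) : ‖w t‖ ≤ ‖w 0‖ := by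
  have hτ := h.mono ht.2
  have hRτ := hR.mono ht.2
  have hinv' : ∀ s ∈ Icc 0 t, ∀ n, ∀ x : hermiteL2 d n,
      ‖galerkinResidual n (G s) (W s) x‖ ≤ M * ‖x‖ := fun s hs n x =>
    hRτ.norm_galerkinResidual_le hs (hinv s ⟨hs.1, hs.2.trans ht.2⟩ n) x
  -- the pairing with an element of some Hermite space
  have key : ∀ m, ∀ χ ∈ hermiteL2 d m, ‖inner ℂ χ (w t)‖ ≤ ‖χ‖ * ‖w 0‖ := by
    intro m χ hχ
    refine le_of_forall_pos_le_add fun e he => ?_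
    obtain ⟨δ, hδ, hδe⟩ : ∃ δ > 0, M * ‖χ‖ * δ * t ≤ e := by
      refine ⟨e / (|M * ‖χ‖ * t| + 1), by positivity, ?_⟩
      rw [show M * ‖χ‖ * (e / (|M * ‖χ‖ * t| + 1)) * t
        = e * ((M * ‖χ‖ * t) / (|M * ‖χ‖ * t| + 1)) by ring]
      refine mul_le_of_le_one_right he.le ?_
      rw [div_le_one (by positivity)]
      exact (le_abs_self _).trans (by linarith)
    obtain ⟨n, hn, hmn⟩ := ((hτ.eventually_norm_sub_starProjection_le hδ).and
      (eventually_ge_atTop m)).exists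
    obtain ⟨u, hut, hu⟩ := exists_schrodingerCurve_terminal ht.1
      (hRτ.continuousOn_galerkinOp n) (⟨χ, hermiteL2_mono hmn hχ⟩ : hermiteL2 d n)
    have hnorm : ∀ s ∈ Icc 0 t, ‖u s‖ = ‖χ‖ := fun s hs => by
      rw [hu.norm_eq (fun s hs => hRτ.symm_galerkinOp n hs) hs ⟨ht.1, le_rfl⟩, hut]; rfl
    have h3 := hτ.norm_inner_sub_inner_le hu (D := M * ‖χ‖) (δ := δ)
      (fun s hs => by rw [← hnorm s hs]; exact hinv' s hs n (u s)) hn ⟨ht.1, le_rfl⟩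
    rw [hut] at h3
    have h4 : ‖inner ℂ (u 0 : Lp ℂ 2 (volume : Measure (Space d))) (w 0)‖ ≤ ‖χ‖ * ‖w 0‖ := by
      rw [← hnorm 0 ⟨le_rfl, ht.1⟩]
      exact norm_inner_le_norm _ _
    calc ‖inner ℂ χ (w t)‖ ≤ ‖inner ℂ (u 0 : Lp ℂ 2 (volume : Measure (Space d))) (w 0)‖
          + ‖inner ℂ χ (w t) - inner ℂ (u 0 : Lp ℂ 2 (volume : Measure (Space d))) (w 0)‖ :=
        norm_le_norm_add_norm_sub' _ _
      _ ≤ _ := add_le_add h4 (h3.trans hδe)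
  have h5 := tendsto_starProjection_hermiteL2 (w t)
  have h6 : ‖inner ℂ (w t) (w t)‖ ≤ ‖w t‖ * ‖w 0‖ :=
    le_of_tendsto_of_tendsto' ((h5.inner tendsto_const_nhds).norm) (h5.norm.mul_const _)
      fun m => key m _ (Submodule.starProjection_apply_mem _ _)
  rw [inner_self_eq_norm_sq_to_K] at h6
  have h7 : ‖w t‖ ^ 2 ≤ ‖w t‖ * ‖w 0‖ := by simpa using h6
  rcases (norm_nonneg (w t)).eq_or_lt with h8 | h8
  · rw [← h8]; exact norm_nonneg _
  · rw [sq] at h7; exact le_of_mul_le_mul_left h7 h8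

lemma exists_galerkin (h0 : w 0 ∈ hermiteL2 d 0) (hR : IsRegularHamiltonian T M G W)
    (hT : 0 ≤ T) : ∃ u : ∀ n, ℝ → hermiteL2 d n,
      (∀ n, IsSchrodingerCurve T (fun t => galerkinOp n (G t) (W t)) (u n)) ∧
      ∀ n, (u n 0 : Lp ℂ 2 (volume : Measure (Space d))) = w 0 := by
  choose u hu0 hu using fun n => exists_schrodingerCurve hT (hR.continuousOn_galerkinOp n)
    (⟨w 0, hermiteL2_mono (Nat.zero_le n) h0⟩ : hermiteL2 d n)
  exact ⟨u, hu, fun n => by rw [hu0]⟩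

/-- Galerkin solutions with bounded residuals converge to every weak solution that has the same
initial value and whose norm does not grow. -/
lemma tendsto_galerkin (h : IsWeakSolution T G W w) (hR : IsRegularHamiltonian T M G W)
    {u : ∀ n, ℝ → hermiteL2 d n}
    (hu : ∀ n, IsSchrodingerCurve T (fun t => galerkinOp n (G t) (W t)) (u n))
    (h0 : ∀ n, (u n 0 : Lp ℂ 2 (volume : Measure (Space d))) = w 0)
    {D : ℝ} (hD : ∀ n, ∀ t ∈ Icc 0 T, ‖galerkinResidual n (G t) (W t) (u n t)‖ ≤ D)
    (hw : ∀ t ∈ Icc 0 T, ‖w t‖ ≤ ‖w 0‖) {t : ℝ} (ht : t ∈ Icc 0 T) :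
    Tendsto (fun n => (u n t : Lp ℂ 2 (volume : Measure (Space d)))) atTop (𝓝 (w t)) := by
  have hnorm : ∀ n, ‖(u n t : Lp ℂ 2 (volume : Measure (Space d)))‖ = ‖w 0‖ := fun n => by
    rw [← h0 n]
    exact (hu n).norm_eq (fun s hs => hR.symm_galerkinOp n hs) ht ⟨le_rfl, ht.1.trans ht.2⟩
  have h1 : Tendsto (fun n => inner ℂ (u n t : Lp ℂ 2 (volume : Measure (Space d))) (w t)) atTop
      (𝓝 (inner ℂ (w 0) (w 0))) := by
    rw [tendsto_iff_norm_sub_tendsto_zero, Metric.tendsto_nhds]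
    intro e he
    have hDT : 0 < (|D| * t + 1) := by have := ht.1; positivity
    filter_upwards [h.eventually_norm_sub_starProjection_le (div_pos he hDT)] with n hn
    rw [Real.dist_0_eq_abs, abs_of_nonneg (norm_nonneg _)]
    have h2 := h.norm_inner_sub_inner_le (hu n) (hD n) hn ht
    rw [h0 n] at h2
    refine h2.trans_lt ?_
    have h3 : D * (e / (|D| * t + 1)) * t ≤ (|D| * t) * (e / (|D| * t + 1)) := by
      have := mul_le_mul_of_nonneg_right (le_abs_self D) (mul_nonneg ht.1 (div_pos he hDT).le)
      linarith
    refine h3.trans_lt ?_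
    rw [mul_div_assoc', div_lt_iff₀ hDT]
    linarith
  rw [tendsto_iff_norm_sub_tendsto_zero]
  have h4 : Tendsto (fun n => 2 * ‖w 0‖ ^ 2 -
      2 * (inner ℂ (u n t : Lp ℂ 2 (volume : Measure (Space d))) (w t)).re) atTop (𝓝 0) := by
    have := (((Complex.continuous_re.tendsto _).comp h1).const_mul 2).const_sub (2 * ‖w 0‖ ^ 2)
    have h5 : (inner ℂ (w 0) (w 0)).re = ‖w 0‖ ^ 2 := by
      rw [inner_self_eq_norm_sq_to_K]; norm_cast
    rw [h5, sub_self] at this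
    exact this
  have h6 : Tendsto (fun n => ‖(u n t : Lp ℂ 2 (volume : Measure (Space d))) - w t‖ ^ 2) atTop
      (𝓝 0) := by
    refine squeeze_zero (fun n => by positivity) (fun n => ?_) h4
    rw [norm_sub_sq (𝕜 := ℂ), hnorm n]
    have := pow_le_pow_left₀ (norm_nonneg _) (hw t ht) 2
    simp only [RCLike.re_to_complex]
    linarith
  simpa using h6.sqrt

end IsWeakSolution

end Galerkin


/-! ### Complex conjugation of test functions and the weak equation -/

section Conjugation

variable {d : ℕ}

/-- The complex conjugate of a Schwartz function. -/
noncomputable def conjSchwartz (φ : 𝓢(Space d, ℂ)) : 𝓢(Space d, ℂ) :=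
  SchwartzMap.postcompCLM (𝕜 := ℝ) (Complex.conjCLE : ℂ →L[ℝ] ℂ) φ

lemma conjSchwartz_apply (φ : 𝓢(Space d, ℂ)) (η : Space d) :
    conjSchwartz φ η = (starRingEnd ℂ) (φ η) := rfl

lemma conjSchwartz_conjSchwartz (φ : 𝓢(Space d, ℂ)) : conjSchwartz (conjSchwartz φ) = φ := by
  ext η; simp [conjSchwartz_apply]

lemma fderiv_conjSchwartz_apply (φ : 𝓢(Space d, ℂ)) (η v : Space d) :
    fderiv ℝ (conjSchwartz φ) η v = (starRingEnd ℂ) (fderiv ℝ φ η v) := by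
  have h : HasFDerivAt (conjSchwartz φ) ((Complex.conjCLE : ℂ →L[ℝ] ℂ).comp (fderiv ℝ φ η)) η :=
    (Complex.conjCLE : ℂ →L[ℝ] ℂ).hasFDerivAt.comp η φ.differentiableAt.hasFDerivAt
  rw [h.fderiv]; rfl

lemma phaseOp_inl_conjSchwartz (k : Fin d) (φ : 𝓢(Space d, ℂ)) :
    phaseOp d (Sum.inl k) (conjSchwartz φ) = -conjSchwartz (phaseOp d (Sum.inl k) φ) := by
  ext η
  rw [neg_apply, conjSchwartz_apply, phaseOp_inl_apply, phaseOp_inl_apply,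
    fderiv_conjSchwartz_apply]
  simp

lemma inner_toL2_conjSchwartz (φ : 𝓢(Space d, ℂ)) (w : Lp ℂ 2 (volume : Measure (Space d))) :
    inner ℂ (toL2 d (conjSchwartz φ)) w = ∫ η, φ η * w η := by
  rw [inner_toL2_left]
  simp [conjSchwartz_apply]

lemma hessian_conjSchwartz (φ : 𝓢(Space d, ℂ)) (η : Space d) (i j : Fin d) :
    hessian (conjSchwartz φ) η i j = (starRingEnd ℂ) (hessian φ η i j) := by
  have h : ∀ ψ : 𝓢(Space d, ℂ), hessian ψ η i j
      = -(phaseOp d (Sum.inl i) (phaseOp d (Sum.inl j) ψ)) η := fun ψ => by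
    rw [phaseOp_inl_inl_apply, neg_neg]; rfl
  have h2 : ∀ ψ : 𝓢(Space d, ℂ), conjSchwartz (-ψ) = -conjSchwartz ψ := fun ψ => by
    ext η; simp [conjSchwartz_apply]
  rw [h, h, phaseOp_inl_conjSchwartz, map_neg, phaseOp_inl_conjSchwartz, neg_neg,
    conjSchwartz_apply, map_neg]

lemma quadraticHamiltonian_eq_sum (B : Matrix (Fin d) (Fin d) ℝ) (φ : Space d → ℂ) (η : Space d) :
    quadraticHamiltonian B φ η
      = ∑ k, ∑ l, (((B * Bᵀ) k l / 2 : ℝ) : ℂ) * -hessian φ η k l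
        + ∑ k, ∑ l, (((B * Bᵀ) k l / 2 : ℝ) : ℂ) * (2 * η k * (2 * η l * φ η)) := by
  have h1 : ((B.map Complex.ofReal)ᵀ * hessian φ η * B.map Complex.ofReal).trace
      = ∑ k, ∑ l, ((B * Bᵀ) k l : ℂ) * hessian φ η k l := by
    rw [Matrix.trace_mul_comm, ← Matrix.mul_assoc]
    have h2 : B.map Complex.ofReal * (B.map Complex.ofReal)ᵀ = (B * Bᵀ).map Complex.ofReal := by
      ext i j; simp [Matrix.mul_apply]
    rw [h2, Matrix.trace]
    simp only [Matrix.diag_apply, Matrix.mul_apply, Matrix.map_apply]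
    rw [Finset.sum_comm]
    refine Finset.sum_congr rfl fun k _ => Finset.sum_congr rfl fun l _ => ?_
    rw [show (∑ j, B l j * Bᵀ j k) = (B * Bᵀ) k l by
      rw [← Matrix.mul_apply, (isSymm_mul_transpose B).apply], Matrix.mul_apply]
  have h3 : (η.ofLp ⬝ᵥ ((B * Bᵀ) *ᵥ η.ofLp)) = ∑ i, ∑ j, (B * Bᵀ) i j * (η i * η j) :=
    quadForm_eq_sum _ η
  rw [quadraticHamiltonian, h1, h3]
  push_cast
  simp only [Finset.mul_sum, Finset.sum_mul]
  congr 1 <;>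
  · refine Finset.sum_congr rfl fun k _ => Finset.sum_congr rfl fun l _ => ?_
    ring

lemma quadraticHamiltonian_eq_quadOp (B : Matrix (Fin d) (Fin d) ℝ) (φ : 𝓢(Space d, ℂ))
    (η : Space d) :
    quadraticHamiltonian B φ η = quadOp (phaseOp d) (gaugeSymbol B 0) φ η := by
  rw [quadraticHamiltonian_eq_sum, quadOp_apply, gaugeSymbol_zero]
  simp only [Fintype.sum_sum_type, Matrix.fromBlocks_apply₁₁, Matrix.fromBlocks_apply₁₂,
    Matrix.fromBlocks_apply₂₁, Matrix.fromBlocks_apply₂₂, Matrix.zero_apply, Complex.ofReal_zero,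
    zero_smul, Finset.sum_const_zero, zero_add, add_zero, add_apply, sum_apply, smul_apply,
    phaseOp_inr_apply, phaseOp_inl_inl_apply, smul_eq_mul, Matrix.smul_apply, hessian,
    Matrix.of_apply]
  congr 1 <;>
  · refine Finset.sum_congr rfl fun k _ => Finset.sum_congr rfl fun l _ => ?_
    congr 2
    ring

/-- Tested with complex conjugates of Schwartz functions, `IsWSolution` becomes an equation in the
sesquilinear pairing. -/
lemma IsWSolution.isWeakSolution {ε T : ℝ} {V : Space d → ℝ} {q : ℝ → Space d}
    {B : ℝ → Matrix (Fin d) (Fin d) ℝ} {w : ℝ → Lp ℂ 2 (volume : Measure (Space d))}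
    (h : IsWSolution ε V T q B w) {M : ℝ}
    (hc : ∀ t ∈ Icc 0 T, Continuous (residualPotential ε V (q t) (B t)))
    (hM : ∀ t ∈ Icc 0 T, ∀ η, |√ε * residualPotential ε V (q t) (B t) η| ≤ M) :
    IsWeakSolution T (fun t => gaugeSymbol (B t) 0)
      (fun t η => √ε * residualPotential ε V (q t) (B t) η) w where
  continuousOn := h.continuousOn
  equation := fun φ t ht => by
    have h1 := h.equation (conjSchwartz φ) t ht
    simp only [← inner_toL2_conjSchwartz, conjSchwartz_conjSchwartz] at h1
    refine h1.congr_deriv ?_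
    congr 1
    rw [L2.inner_def]
    refine integral_congr_ae ?_
    have h2 : Continuous fun η => ((√ε * residualPotential ε V (q t) (B t) η : ℝ) : ℂ) :=
      Complex.continuous_ofReal.comp (continuous_const.mul (hc t ht))
    filter_upwards [coeFn_mulOp h2 (M := M) (fun η => by
        rw [Complex.norm_real]; exact hM t ht η) (toL2 d φ), coeFn_toL2 φ,
      coeFn_toL2 (quadOp (phaseOp d) (gaugeSymbol (B t) 0) φ),
      Lp.coeFn_add (toL2 d (quadOp (phaseOp d) (gaugeSymbol (B t) 0) φ))
        (mulOp (fun η => ((√ε * residualPotential ε V (q t) (B t) η : ℝ) : ℂ)) (toL2 d φ))]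
      with η e1 e2 e3 e4
    rw [fullOp_apply, e4, Pi.add_apply, e1, e2, e3, ← quadraticHamiltonian_eq_quadOp, hamiltonian,
      RCLike.inner_apply, mul_comm (w t η)]
    congr 1
    rw [quadraticHamiltonian_eq_sum, quadraticHamiltonian_eq_sum]
    simp only [hessian_conjSchwartz, conjSchwartz_apply, map_add, map_sum, map_mul, map_neg,
      Complex.conj_ofReal, Complex.conj_ofNat]

end Conjugation

/-! ### The initial value -/

section Initial

variable {d : ℕ}

lemma norm_toL2_groundState_sq :
    ‖toL2 d (groundState d)‖ ^ 2 = (Real.pi / 2) ^ ((d : ℝ) / 2) := by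
  have h := GaussianFourier.integral_rexp_neg_mul_sq_norm (V := Space d) (b := 2) (by norm_num)
  rw [finrank_euclideanSpace_fin] at h
  rw [← h, L2_norm_sq_eq]
  refine integral_congr_ae ?_
  filter_upwards [coeFn_toL2 (groundState d)] with η hη
  rw [hη, groundState_apply, Complex.norm_real, Real.norm_of_nonneg (Real.exp_pos _).le,
    ← Real.exp_nat_mul]
  congr 1
  push_cast; ring

lemma norm_toL2_groundState_pos : 0 < ‖toL2 d (groundState d)‖ := by
  have h : 0 < ‖toL2 d (groundState d)‖ ^ 2 := by
    rw [norm_toL2_groundState_sq]; positivity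
  exact lt_of_le_of_ne (norm_nonneg _) fun h0 => by simp [← h0] at h

variable {ε T : ℝ} {V : Space d → ℝ} {q : ℝ → Space d} {B : ℝ → Matrix (Fin d) (Fin d) ℝ}
  {w : ℝ → Lp ℂ 2 (volume : Measure (Space d))}

lemma IsWSolution.initial_eq (h : IsWSolution ε V T q B w) :
    w 0 = toL2 d (((2 : ℝ) ^ ((d : ℝ) / 4) / (Real.pi * ε) ^ ((d : ℝ) / 4) : ℝ) •
      groundState d) := by
  ext1
  filter_upwards [h.initial, coeFn_toL2 (((2 : ℝ) ^ ((d : ℝ) / 4) /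
    (Real.pi * ε) ^ ((d : ℝ) / 4) : ℝ) • groundState d)] with η h1 h2
  rw [h1, h2, smul_apply, groundState_apply, initialValue, Complex.real_smul]
  push_cast; ring

lemma IsWSolution.norm_initial (h : IsWSolution ε V T q B w) (hε : 0 < ε) :
    ‖w 0‖ = ε ^ (-(d : ℝ) / 4) := by
  have h1 : ‖w 0‖ ^ 2 = (ε ^ (-(d : ℝ) / 4)) ^ 2 := by
    have hpi := Real.pi_pos
    rw [h.initial_eq, ← Complex.coe_smul, map_smul, norm_smul, mul_pow, norm_toL2_groundState_sq,
      Complex.norm_real, Real.norm_of_nonneg (by positivity), div_pow,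
      Real.div_rpow hpi.le zero_le_two, Real.mul_rpow hpi.le hε.le, mul_pow,
      ← Real.rpow_mul_natCast zero_le_two, ← Real.rpow_mul_natCast hpi.le,
      ← Real.rpow_mul_natCast hε.le, ← Real.rpow_mul_natCast hε.le]
    rw [show (d : ℝ) / 4 * (2 : ℕ) = d / 2 by push_cast; ring,
      show -(d : ℝ) / 4 * (2 : ℕ) = -(d / 2) by push_cast; ring, Real.rpow_neg hε.le]
    field_simp
  exact (sq_eq_sq₀ (norm_nonneg _) (by positivity)).1 h1

end Initial

/-! ### The flow and the residual potential -/

section Flow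

variable {d : ℕ} {V : Space d → ℝ} {T : ℝ} {q p : ℝ → Space d}
  {α : ℝ → Matrix (Fin d) (Fin d) ℂ} {B : ℝ → Matrix (Fin d) (Fin d) ℝ}

/-- A matrix valued linear differential equation has a solution. -/
lemma exists_matrixODE_solution (hT : 0 ≤ T) {a : ℝ → Matrix (Fin d) (Fin d) ℝ}
    (ha : ∀ i j, ContinuousOn (fun t => a t i j) (Icc 0 T)) (C₀ : Matrix (Fin d) (Fin d) ℝ) :
    ∃ C : ℝ → Matrix (Fin d) (Fin d) ℝ, C 0 = C₀ ∧ ∀ t ∈ Icc 0 T, ∀ i j,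
      HasDerivWithinAt (fun s => C s i j) ((a t * C t) i j) (Icc 0 T) t := by
  set L : ℝ → (Fin d → Fin d → ℝ) →L[ℝ] (Fin d → Fin d → ℝ) := fun t =>
    LinearMap.toContinuousLinearMap
      { toFun := fun X i j => ∑ k, a t i k * X k j
        map_add' := fun X Y => by
          ext i j; simp [mul_add, Finset.sum_add_distrib]
        map_smul' := fun c X => by
          ext i j; simp [Finset.mul_sum, mul_left_comm] }
  have hL : ContinuousOn L (Icc 0 T) := by
    refine continuousOn_clm_apply.2 fun X => continuousOn_pi.2 fun i =>
      continuousOn_pi.2 fun j => ?_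
    have h : ContinuousOn (fun t => ∑ k, a t i k * X k j) (Icc 0 T) :=
      continuousOn_finsetSum _ fun k _ => (ha i k).mul continuousOn_const
    exact h
  obtain ⟨C, h0, hC⟩ := exists_linearODE_solution hT hL (fun i j => C₀ i j)
  refine ⟨C, h0, fun t ht i j => ?_⟩
  have := hasDerivWithinAt_pi.1 (hasDerivWithinAt_pi.1 (hC t ht) i) j
  exact this

namespace IsGWPTFlow

lemma continuousOn_re_α (h : IsGWPTFlow V T q p α B) (i j : Fin d) :
    ContinuousOn (fun t => ((α t).map Complex.re) i j) (Icc 0 T) := fun t ht =>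
  (Complex.continuous_re.tendsto _).comp (h.deriv_α t ht i j).continuousWithinAt

lemma isUnit_det_B_zero (h : IsGWPTFlow V T q p α B) : IsUnit (B 0).det := by
  have h1 := h.posDef_α.det_pos
  rw [← h.sq_B, Matrix.det_mul] at h1
  exact isUnit_iff_ne_zero.2 fun h0 => by simp [h0] at h1

/-- The inverse of `B` exists on all of `[0, T]`, being the solution of the dual equation. -/
lemma exists_inverse (h : IsGWPTFlow V T q p α B) (hT : 0 ≤ T) :
    ∃ C : ℝ → Matrix (Fin d) (Fin d) ℝ, (∀ t ∈ Icc 0 T, B t * C t = 1) ∧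
      ∀ t ∈ Icc 0 T, ∀ i j, HasDerivWithinAt (fun s => C s i j)
        ((((2 : ℝ) • (α t).map Complex.re) * C t) i j) (Icc 0 T) t := by
  obtain ⟨C, h0, hC⟩ := exists_matrixODE_solution hT
    (a := fun t => (2 : ℝ) • (α t).map Complex.re)
    (fun i j => (h.continuousOn_re_α i j).const_smul (2 : ℝ)) (B 0)⁻¹
  refine ⟨C, fun t ht => ?_, hC⟩
  ext i j
  have hd : ∀ s ∈ Icc 0 T, HasDerivWithinAt (fun s => (B s * C s) i j) 0 (Icc 0 T) s := by
    intro s hs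
    simp only [Matrix.mul_apply]
    refine (HasDerivWithinAt.fun_sum (u := Finset.univ) fun k _ =>
      (h.deriv_B s hs i k).mul (hC s hs k j)).congr_deriv ?_
    rw [Finset.sum_add_distrib]
    have e1 : ∑ k, B s i k * (((2 : ℝ) • (α s).map Complex.re) * C s) k j
        = 2 * (B s * (α s).map Complex.re * C s) i j := by
      rw [← Matrix.mul_apply, Matrix.smul_mul, Matrix.mul_smul, Matrix.smul_apply,
        Matrix.mul_assoc, smul_eq_mul]
    have e2 : ∑ k, -2 * (B s * (α s).map Complex.re) i k * C s k j
        = -2 * (B s * (α s).map Complex.re * C s) i j := by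
      rw [Matrix.mul_apply (M := B s * (α s).map Complex.re), Finset.mul_sum]
      exact Finset.sum_congr rfl fun k _ => by ring
    rw [e1, e2]; ring
  have h1 := (convex_Icc 0 T).norm_image_sub_le_of_norm_hasDerivWithin_le (C := 0) hd
    (by simp) ⟨le_rfl, hT⟩ ht
  rw [zero_mul] at h1
  rw [sub_eq_zero.1 (norm_le_zero_iff.1 h1), h0, Matrix.mul_nonsing_inv _ h.isUnit_det_B_zero]

end IsGWPTFlow

lemma quadForm_hessian (hV : ContDiff ℝ 2 V) (x y : Space d) :
    quadForm (hessian V x) y = fderiv ℝ (fderiv ℝ V) x y y := by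
  have hy : y = ∑ i, y i • EuclideanSpace.single i (1 : ℝ) := by
    ext j; simp [Finset.sum_apply, Pi.single_apply]
  rw [quadForm_eq_sum]
  conv_rhs => rw [hy]
  simp only [map_sum, map_smul, sum_apply, smul_apply, smul_eq_mul, hessian, Matrix.of_apply,
    Finset.mul_sum]
  rw [Finset.sum_comm]
  refine Finset.sum_congr rfl fun i _ => Finset.sum_congr rfl fun j _ => ?_
  rw [(hV.contDiffAt (x := x)).isSymmSndFDerivAt (by simp)]
  ring

lemma residualPotential_eq (hV : ContDiff ℝ 2 V) (ε : ℝ) (x : Space d)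
    (b : Matrix (Fin d) (Fin d) ℝ) (η : Space d) :
    residualPotential ε V x b η = 1 / ε ^ (3 / 2 : ℝ) *
      (V (x + √ε • Matrix.toEuclideanCLM (𝕜 := ℝ) b⁻¹ η) - V x
        - √ε * fderiv ℝ V x (Matrix.toEuclideanCLM (𝕜 := ℝ) b⁻¹ η)
        - ε / 2 * fderiv ℝ (fderiv ℝ V) x (Matrix.toEuclideanCLM (𝕜 := ℝ) b⁻¹ η)
          (Matrix.toEuclideanCLM (𝕜 := ℝ) b⁻¹ η)) := by
  rw [← quadForm_hessian hV]; rfl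

lemma continuous_residualPotential (hV : ContDiff ℝ 2 V) (ε : ℝ) (x : Space d)
    (b : Matrix (Fin d) (Fin d) ℝ) : Continuous (residualPotential ε V x b) := by
  have h0 := hV.continuous
  rw [funext (residualPotential_eq hV ε x b)]
  fun_prop

/-- The derivative of the residual potential is a first order Taylor remainder of `∇V`. -/
lemma hasFDerivAt_residualPotential (hV : ContDiff ℝ 2 V) {ε : ℝ} (hε : 0 < ε) (x : Space d)
    (b : Matrix (Fin d) (Fin d) ℝ) (η : Space d) :
    HasFDerivAt (residualPotential ε V x b)
      (ε⁻¹ • (fderiv ℝ V (x + √ε • Matrix.toEuclideanCLM (𝕜 := ℝ) b⁻¹ η) - fderiv ℝ V x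
        - √ε • fderiv ℝ (fderiv ℝ V) x (Matrix.toEuclideanCLM (𝕜 := ℝ) b⁻¹ η)).comp
          (Matrix.toEuclideanCLM (𝕜 := ℝ) b⁻¹)) η := by
  set Y : Space d →L[ℝ] Space d := Matrix.toEuclideanCLM (𝕜 := ℝ) b⁻¹
  have hY : HasFDerivAt (fun η => Y η) Y η := Y.hasFDerivAt
  have h1 : HasFDerivAt (fun η => V (x + √ε • Y η))
      ((fderiv ℝ V (x + √ε • Y η)).comp (√ε • Y)) η :=
    ((hV.differentiable (by simp)) _).hasFDerivAt.comp η ((hY.const_smul √ε).const_add x)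
  have h2 : HasFDerivAt (fun η => √ε * fderiv ℝ V x (Y η)) (√ε • (fderiv ℝ V x).comp Y) η :=
    ((fderiv ℝ V x).hasFDerivAt.comp η hY).const_mul √ε
  have h3 : HasFDerivAt (fun η => fderiv ℝ (fderiv ℝ V) x (Y η) (Y η)) _ η :=
    ((fderiv ℝ (fderiv ℝ V) x).hasFDerivAt.comp η hY).clm_apply hY
  have h4 := (((h1.sub_const (V x)).sub h2).sub (h3.const_mul (ε / 2))).const_mul
    (1 / ε ^ (3 / 2 : ℝ))
  rw [funext (residualPotential_eq hV ε x b)]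
  refine h4.congr_fderiv ?_
  have hs : √ε ^ 2 = ε := Real.sq_sqrt hε.le
  have h32 : ε ^ (3 / 2 : ℝ) = ε * √ε := by
    rw [Real.sqrt_eq_rpow, show (3 / 2 : ℝ) = 1 + 1 / 2 by norm_num, Real.rpow_add hε,
      Real.rpow_one]
  have hs0 : √ε ≠ 0 := (Real.sqrt_pos.2 hε).ne'
  ext v
  have hsym : fderiv ℝ (fderiv ℝ V) x (Y v) (Y η) = fderiv ℝ (fderiv ℝ V) x (Y η) (Y v) :=
    (hV.contDiffAt (x := x)).isSymmSndFDerivAt (by simp) _ _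
  simp only [add_apply, sub_apply, smul_apply, ContinuousLinearMap.comp_apply,
    ContinuousLinearMap.flip_apply, Function.comp_apply, smul_eq_mul, map_smul, h32, hsym]
  field_simp
  linear_combination 2 * fderiv ℝ (fderiv ℝ V) x (Y η) (Y v) * hs

end Flow


/-! ### Weak adjoints -/

section WeakAdjoint

open Filter Topology

variable {d : ℕ}

/-- If `z n → w` in `L²` and `T (z n)` stays bounded, then `T w` exists weakly in `L²`. -/
lemma exists_weak_image {T T' : 𝓢(Space d, ℂ) →ₗ[ℂ] 𝓢(Space d, ℂ)}
    (hadj : ∀ f g, inner ℂ (toL2 d (T f)) (toL2 d g) = inner ℂ (toL2 d f) (toL2 d (T' g)))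
    {z : ℕ → 𝓢(Space d, ℂ)} {w : Lp ℂ 2 (volume : Measure (Space d))}
    (hz : Tendsto (fun n => toL2 d (z n)) atTop (𝓝 w)) {C : ℝ}
    (hC : ∀ n, ‖toL2 d (T (z n))‖ ≤ C) :
    ∃ h : Lp ℂ 2 (volume : Measure (Space d)), ‖h‖ ≤ C ∧
      ∀ φ, inner ℂ (toL2 d (T' φ)) w = inner ℂ (toL2 d φ) h := by
  have hC0 : 0 ≤ C := (norm_nonneg _).trans (hC 0)
  set l : 𝓢(Space d, ℂ) →ₗ[ℂ] ℂ := (innerSL ℂ w).toLinearMap ∘ₗ toL2 d ∘ₗ T'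
  have hl : ∀ φ, l φ = inner ℂ w (toL2 d (T' φ)) := fun φ => rfl
  have hb : ∀ φ, ‖l φ‖ ≤ C * ‖toL2 d φ‖ := fun φ => by
    rw [hl]
    refine le_of_tendsto (hz.inner tendsto_const_nhds).norm (.of_forall fun n => ?_)
    rw [← hadj]
    exact (norm_inner_le_norm _ _).trans (by gcongr; exact hC n)
  refine ⟨(InnerProductSpace.toDual ℂ _).symm (l.extendOfNorm (toL2 d)), ?_, fun φ => ?_⟩
  · rw [LinearIsometryEquiv.norm_map]
    exact ContinuousLinearMap.opNorm_le_bound _ hC0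
      (LinearMap.norm_extendOfNorm_apply_le denseRange_toL2 C hb)
  · rw [← inner_conj_symm, ← inner_conj_symm (toL2 d φ), InnerProductSpace.toDual_symm_apply,
      LinearMap.extendOfNorm_eq denseRange_toL2 ⟨C, hb⟩, hl]

lemma ae_eq_of_inner_position {w h : Lp ℂ 2 (volume : Measure (Space d))} {k : Fin d}
    (hwh : ∀ φ, inner ℂ (toL2 d (phaseOp d (Sum.inr k) φ)) w = inner ℂ (toL2 d φ) h) :
    (h : Space d → ℂ) =ᵐ[volume] fun η => ((2 * η k : ℝ) : ℂ) * w η := by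
  have hc : Continuous fun η : Space d => ((2 * η k : ℝ) : ℂ) := by fun_prop
  refine ae_eq_of_integral_contDiff_smul_eq ((Lp.memLp h).locallyIntegrable (by norm_num))
    (((Lp.memLp w).locallyIntegrable (by norm_num)).continuous_mul hc) fun g hg hgs => ?_
  have hg2 : HasCompactSupport fun η => ((g η : ℝ) : ℂ) := hgs.comp_left (g := Complex.ofReal) rfl
  have hg1 : ContDiff ℝ (⊤ : ℕ∞) fun η => ((g η : ℝ) : ℂ) := Complex.ofRealCLM.contDiff.comp hg
  have h1 := hwh (hg2.toSchwartzMap hg1)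
  have h2 : ∀ η, hg2.toSchwartzMap hg1 η = ((g η : ℝ) : ℂ) := fun η => rfl
  rw [inner_toL2_left, inner_toL2_left] at h1
  simp only [phaseOp_inr_apply, h2, map_mul, Complex.conj_ofReal, Complex.conj_ofNat] at h1
  simp only [Complex.real_smul]
  rw [← h1]
  congr 1
  ext η
  push_cast; ring

end WeakAdjoint

/-! ### The energy estimate -/

section Energy

variable {d : ℕ}

lemma integrable_mul_mul (f g : 𝓢(Space d, ℂ)) {m : Space d → ℂ} (hc : Continuous m) {M : ℝ}
    (hM : ∀ η, ‖m η‖ ≤ M) :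
    Integrable fun η => (starRingEnd ℂ) (f η) * (m η * g η) := by
  refine (L2.integrable_inner (𝕜 := ℂ) (toL2 d f) (mulOp m (toL2 d g))).congr ?_
  filter_upwards [coeFn_toL2 f, coeFn_toL2 g, coeFn_mulOp hc hM (toL2 d g)] with η h1 h2 h3
  rw [h1, h3, h2, RCLike.inner_apply, mul_comm]

lemma inner_toL2_mulOp (f g : 𝓢(Space d, ℂ)) {m : Space d → ℂ} (hc : Continuous m) {M : ℝ}
    (hM : ∀ η, ‖m η‖ ≤ M) :
    inner ℂ (toL2 d f) (mulOp m (toL2 d g)) = ∫ η, (starRingEnd ℂ) (f η) * (m η * g η) := by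
  rw [inner_toL2_left]
  refine integral_congr_ae ?_
  filter_upwards [coeFn_toL2 g, coeFn_mulOp hc hM (toL2 d g)] with η h2 h3
  rw [h3, h2]

lemma inner_toL2_mulOp_ofReal_self_im (f : 𝓢(Space d, ℂ)) {W : Space d → ℝ} (hc : Continuous W)
    {M : ℝ} (hM : ∀ η, |W η| ≤ M) :
    (inner ℂ (toL2 d f) (mulOp (fun η => ((W η : ℝ) : ℂ)) (toL2 d f))).im = 0 := by
  refine Complex.conj_eq_iff_im.1 ?_
  rw [inner_conj_symm, inner_mulOp (f := fun η => ((W η : ℝ) : ℂ))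
    (Complex.continuous_ofReal.comp hc) (M := M) (fun η => by simpa using hM η)]
  simp only [Complex.conj_ofReal]

/-- Integration by parts: only the gradient of the potential enters the imaginary part. -/
lemma abs_im_inner_momentum_sq_le (φ : 𝓢(Space d, ℂ)) (j : Fin d) {W : Space d → ℝ}
    (hW : ContDiff ℝ 1 W) {M M' : ℝ} (hM : ∀ η, |W η| ≤ M)
    (hM' : ∀ η, |fderiv ℝ W η (EuclideanSpace.single j 1)| ≤ M') :
    |(inner ℂ (toL2 d (phaseOp d (Sum.inl j) (phaseOp d (Sum.inl j) φ)))
      (mulOp (fun η => ((W η : ℝ) : ℂ)) (toL2 d φ))).im|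
        ≤ M' * ‖toL2 d (phaseOp d (Sum.inl j) φ)‖ * ‖toL2 d φ‖ := by
  set e : Space d := EuclideanSpace.single j 1
  set f := phaseOp d (Sum.inl j) φ with hf
  have hcW : Continuous fun η => ((W η : ℝ) : ℂ) := Complex.continuous_ofReal.comp hW.continuous
  have hbW : ∀ η, ‖((W η : ℝ) : ℂ)‖ ≤ M := fun η => by simpa using hM η
  have hcD : Continuous fun η => ((fderiv ℝ W η e : ℝ) : ℂ) :=
    Complex.continuous_ofReal.comp ((hW.continuous_fderiv (by simp)).clm_apply continuous_const)
  have hbD : ∀ η, ‖((fderiv ℝ W η e : ℝ) : ℂ)‖ ≤ M' := fun η => by simpa using hM' η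
  have hd : ∀ η, HasFDerivAt (fun η => ((W η : ℝ) : ℂ) * φ η)
      (((W η : ℝ) : ℂ) • fderiv ℝ φ η + φ η • Complex.ofRealCLM.comp (fderiv ℝ W η)) η :=
    fun η => HasFDerivAt.mul (Complex.ofRealCLM.hasFDerivAt.comp η
      ((hW.differentiable (by simp)) η).hasFDerivAt) φ.differentiableAt.hasFDerivAt
  have hφ : ∀ η, fderiv ℝ φ η e = Complex.I * f η := fun η => by
    rw [hf, phaseOp_inl_apply, ← mul_assoc, mul_neg, Complex.I_mul_I]; ring
  have hd' : ∀ η, fderiv ℝ (fun η => ((W η : ℝ) : ℂ) * φ η) η e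
      = Complex.I * (((W η : ℝ) : ℂ) * f η) + ((fderiv ℝ W η e : ℝ) : ℂ) * φ η := fun η => by
    rw [(hd η).fderiv]
    simp only [add_apply, smul_apply, ContinuousLinearMap.comp_apply, Complex.ofRealCLM_apply,
      smul_eq_mul, hφ]
    ring
  have hD : ∀ η, (starRingEnd ℂ) (phaseOp d (Sum.inl j) f η)
      = Complex.I * fderiv ℝ (conjSchwartz f) η e := fun η => by
    rw [phaseOp_inl_apply, fderiv_conjSchwartz_apply]; simp [e]
  have i1 : Integrable fun η => fderiv ℝ (conjSchwartz f) η e * (((W η : ℝ) : ℂ) * φ η) := by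
    refine ((integrable_mul_mul (phaseOp d (Sum.inl j) f) φ hcW hbW).const_mul
      (-Complex.I)).congr (.of_forall fun η => ?_)
    simp only [hD]
    linear_combination (-(fderiv ℝ (conjSchwartz f) η e * (((W η : ℝ) : ℂ) * φ η)))
      * Complex.I_mul_I
  have i2 := integrable_mul_mul f f hcW hbW
  have i3 := integrable_mul_mul f φ hcD hbD
  have i4 : ∀ η, conjSchwartz f η * fderiv ℝ (fun η => ((W η : ℝ) : ℂ) * φ η) η e
      = Complex.I * ((starRingEnd ℂ) (f η) * (((W η : ℝ) : ℂ) * f η))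
        + (starRingEnd ℂ) (f η) * (((fderiv ℝ W η e : ℝ) : ℂ) * φ η) := fun η => by
    rw [hd', conjSchwartz_apply]; ring
  have key : inner ℂ (toL2 d (phaseOp d (Sum.inl j) f)) (mulOp (fun η => ((W η : ℝ) : ℂ))
      (toL2 d φ)) = inner ℂ (toL2 d f) (mulOp (fun η => ((W η : ℝ) : ℂ)) (toL2 d f))
        - Complex.I * inner ℂ (toL2 d f)
          (mulOp (fun η => ((fderiv ℝ W η e : ℝ) : ℂ)) (toL2 d φ)) := by
    rw [inner_toL2_mulOp _ _ hcW hbW, inner_toL2_mulOp _ _ hcW hbW, inner_toL2_mulOp _ _ hcD hbD]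
    have h1 := integral_mul_fderiv_eq_neg_fderiv_mul_of_integrable (μ := volume) (v := e)
      (f := conjSchwartz f) (g := fun η => ((W η : ℝ) : ℂ) * φ η) i1
      (by simp only [i4]; exact (i2.const_mul _).add i3)
      ((integrable_mul_mul f φ hcW hbW).congr (.of_forall fun η => rfl))
      (fun η _ => (conjSchwartz f).differentiableAt) (fun η _ => (hd η).differentiableAt)
    simp only [i4] at h1
    rw [integral_add (i2.const_mul _) i3, integral_const_mul] at h1
    simp only [hD, mul_assoc]
    rw [integral_const_mul, ← neg_eq_iff_eq_neg.2 h1]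
    linear_combination (-∫ η, (starRingEnd ℂ) (f η) * (((W η : ℝ) : ℂ) * f η)) * Complex.I_mul_I
  rw [key, Complex.sub_im, inner_toL2_mulOp_ofReal_self_im f hW.continuous hM, zero_sub, abs_neg]
  refine (Complex.abs_im_le_norm _).trans ?_
  rw [norm_mul, Complex.norm_I, one_mul]
  refine (norm_inner_le_norm _ _).trans ?_
  rw [mul_comm M', mul_assoc]
  gcongr
  exact norm_mulOp_le hcD hbD _

lemma im_inner_position_sq (φ : 𝓢(Space d, ℂ)) (j : Fin d) {W : Space d → ℝ}
    (hW : Continuous W) {M : ℝ} (hM : ∀ η, |W η| ≤ M) :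
    (inner ℂ (toL2 d (phaseOp d (Sum.inr j) (phaseOp d (Sum.inr j) φ)))
      (mulOp (fun η => ((W η : ℝ) : ℂ)) (toL2 d φ))).im = 0 := by
  have hcW : Continuous fun η => ((W η : ℝ) : ℂ) := Complex.continuous_ofReal.comp hW
  have hbW : ∀ η, ‖((W η : ℝ) : ℂ)‖ ≤ M := fun η => by simpa using hM η
  rw [← inner_toL2_mulOp_ofReal_self_im (phaseOp d (Sum.inr j) φ) hW hM,
    inner_toL2_mulOp _ _ hcW hbW, inner_toL2_mulOp _ _ hcW hbW]
  congr 2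
  ext η
  simp only [phaseOp_inr_apply, map_mul, Complex.conj_ofReal, Complex.conj_ofNat]
  ring

lemma quadOp_one (φ : 𝓢(Space d, ℂ)) :
    quadOp (phaseOp d) 1 φ = oscillator (phaseOp d) φ := by
  rw [quadOp_apply, oscillator_apply]
  refine Finset.sum_congr rfl fun a _ => ?_
  rw [Finset.sum_eq_single a (fun b _ hb => by simp [hb.symm]) (by simp)]
  simp

lemma fullOp_one_zero (φ : 𝓢(Space d, ℂ)) :
    fullOp 1 (fun _ => 0) φ = toL2 d (oscillator (phaseOp d) φ) := by
  have h : ‖mulOp (fun _ : Space d => ((0 : ℝ) : ℂ)) (toL2 d φ)‖ ≤ 0 * ‖toL2 d φ‖ :=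
    norm_mulOp_le continuous_const (by simp) _
  rw [zero_mul, norm_le_zero_iff] at h
  rw [fullOp_apply, h, add_zero, quadOp_one]

lemma isRegularHamiltonian_oscillator (T : ℝ) :
    IsRegularHamiltonian T 0 (fun _ => (1 : Matrix (Fin d ⊕ Fin d) (Fin d ⊕ Fin d) ℝ))
      (fun _ _ => 0) where
  symm _ _ := Matrix.isSymm_one
  continuousOn_symbol _ _ := continuousOn_const
  continuous_potential _ _ := continuous_const
  bound _ _ _ := by simp
  continuousOn_potential _ := continuousOn_const

lemma coe_galerkinOp_oscillator {n : ℕ} (x : hermiteL2 d n) :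
    (galerkinOp n 1 (fun _ => 0) x : Lp ℂ 2 (volume : Measure (Space d)))
      = toL2 d (oscillator (phaseOp d) (hermiteRep d n x)) := by
  rw [galerkinOp_apply, fullOp_one_zero, ← Submodule.starProjection_apply,
    Submodule.starProjection_eq_self_iff]
  exact Submodule.mem_map_of_mem (oscillator_mem (hermiteRep_mem x))

/-- The energy `⟪x, (-Δ + 4 |η|²) x⟫`. -/
lemma re_inner_galerkinOp_oscillator {n : ℕ} (x : hermiteL2 d n) :
    (inner ℂ (galerkinOp n 1 (fun _ => 0) x) x).re
      = ∑ a, ‖toL2 d (phaseOp d a (hermiteRep d n x))‖ ^ 2 := by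
  rw [Submodule.coe_inner, coe_galerkinOp_oscillator, ← toL2_hermiteRep x, ← inner_conj_symm,
    Complex.conj_re, toL2_hermiteRep, ← toL2_hermiteRep x,
    (isCCR_phaseOp d).inner_oscillator_self]
  exact Complex.ofReal_re _

lemma two_mul_im_inner_oscillator_mulOp_le (φ : 𝓢(Space d, ℂ)) {W : Space d → ℝ}
    (hW : ContDiff ℝ 1 W) {M M' : ℝ} (hM : ∀ η, |W η| ≤ M)
    (hM' : ∀ η j, |fderiv ℝ W η (EuclideanSpace.single j 1)| ≤ M') :
    2 * (inner ℂ (toL2 d (oscillator (phaseOp d) φ))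
      (mulOp (fun η => ((W η : ℝ) : ℂ)) (toL2 d φ))).im
      ≤ ∑ a, ‖toL2 d (phaseOp d a φ)‖ ^ 2 + d * M' ^ 2 * ‖toL2 d φ‖ ^ 2 := by
  have h1 : ∀ j, 2 * (inner ℂ (toL2 d (phaseOp d (Sum.inl j) (phaseOp d (Sum.inl j) φ)))
      (mulOp (fun η => ((W η : ℝ) : ℂ)) (toL2 d φ))).im
      ≤ ‖toL2 d (phaseOp d (Sum.inl j) φ)‖ ^ 2 + M' ^ 2 * ‖toL2 d φ‖ ^ 2 := fun j => by
    have h := (le_abs_self _).trans (abs_im_inner_momentum_sq_le φ j hW hM fun η => hM' η j)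
    generalize ‖toL2 d (phaseOp d (Sum.inl j) φ)‖ = a at *
    generalize ‖toL2 d φ‖ = b at *
    nlinarith [sq_nonneg (a - M' * b)]
  have h2 : (0 : ℝ) ≤ ∑ j, ‖toL2 d (phaseOp d (Sum.inr j) φ)‖ ^ 2 := by positivity
  have h3 := Finset.sum_le_sum fun j (_ : j ∈ Finset.univ) => h1 j
  rw [← Finset.mul_sum, Finset.sum_add_distrib] at h3
  simp only [Finset.sum_const, Finset.card_univ, Fintype.card_fin, nsmul_eq_mul] at h3
  rw [oscillator_apply, Fintype.sum_sum_type, Fintype.sum_sum_type]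
  simp only [map_add, map_sum, inner_add_left, sum_inner, Complex.add_im, Complex.im_sum,
    im_inner_position_sq φ _ hW.continuous hM, Finset.sum_const_zero, add_zero]
  linarith

/-- The quadratic Hamiltonian without gauge commutes with the oscillator, so that the energy changes
only through the gradient of the potential. -/
lemma two_mul_im_inner_oscillator_le {n : ℕ} (x : hermiteL2 d n) (B : Matrix (Fin d) (Fin d) ℝ)
    {W : Space d → ℝ} (hW : ContDiff ℝ 1 W) {M M' : ℝ} (hM : ∀ η, |W η| ≤ M)
    (hM' : ∀ η j, |fderiv ℝ W η (EuclideanSpace.single j 1)| ≤ M') :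
    2 * (inner ℂ (galerkinOp n 1 (fun _ => 0) x) (galerkinOp n (gaugeSymbol B 0) W x)).im
      ≤ (inner ℂ (galerkinOp n 1 (fun _ => 0) x) x).re + d * M' ^ 2 * ‖x‖ ^ 2 := by
  have hσ : ∀ b c, ∑ a, phaseComm d c a * gaugeSymbol B 0 a b
      + ∑ a, phaseComm d b a * gaugeSymbol B 0 a c = 0 := by
    have hs := isSymm_mul_transpose B
    rw [gaugeSymbol_zero]
    rintro (b | b) (c | c) <;>
      simp [phaseComm, Fintype.sum_sum_type, hs.apply]
  have h1 := two_mul_im_inner_oscillator_mulOp_le (hermiteRep d n x) hW hM hM'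
  have h2 : (inner ℂ (galerkinOp n 1 (fun _ => 0) x) (galerkinOp n (gaugeSymbol B 0) W x)).im
      = (inner ℂ (toL2 d (oscillator (phaseOp d) (hermiteRep d n x)))
        (mulOp (fun η => ((W η : ℝ) : ℂ)) (toL2 d (hermiteRep d n x)))).im := by
    rw [galerkinOp_apply n (gaugeSymbol B 0),
      Submodule.inner_orthogonalProjectionOnto_eq_of_mem_left, coe_galerkinOp_oscillator,
      fullOp_apply, inner_add_right, Complex.add_im,
      (isCCR_phaseOp d).im_inner_oscillator_quadOp_eq_zero (isSymm_gaugeSymbol B 0) hσ, zero_add]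
  rw [h2, re_inner_galerkinOp_oscillator]
  rwa [norm_toL2_hermiteRep] at h1

end Energy


/-! ### Weak gradients from bounded approximations -/

section WeakGradient

open Filter Topology

variable {d : ℕ}

/-- Position and momentum of an `L²` limit of Schwartz functions exist weakly in `L²` if they are
bounded along the sequence. -/
lemma exists_weak_phaseOp {z : ℕ → 𝓢(Space d, ℂ)} {w : Lp ℂ 2 (volume : Measure (Space d))}
    (hz : Tendsto (fun n => toL2 d (z n)) atTop (𝓝 w)) {C : ℝ}
    (hC : ∀ n a, ‖toL2 d (phaseOp d a (z n))‖ ≤ C) :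
    ∃ h : Fin d ⊕ Fin d → Lp ℂ 2 (volume : Measure (Space d)), (∀ a, ‖h a‖ ≤ C) ∧
      ∀ a φ, inner ℂ (toL2 d (phaseOp d a φ)) w = inner ℂ (toL2 d φ) (h a) := by
  choose h h1 h2 using fun a => exists_weak_image ((isCCR_phaseOp d).symm a) hz fun n => hC n a
  exact ⟨h, h1, h2⟩

/-- The vector field with the components `i h_j`. -/
noncomputable def gradientOfMomentum (h : Fin d → Lp ℂ 2 (volume : Measure (Space d)))
    (η : Space d) : EuclideanSpace ℂ (Fin d) :=
  WithLp.toLp 2 fun j => Complex.I * h j η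

lemma hasWeakGradient_gradientOfMomentum {w : Lp ℂ 2 (volume : Measure (Space d))}
    {h : Fin d → Lp ℂ 2 (volume : Measure (Space d))}
    (hw : ∀ j φ, inner ℂ (toL2 d (phaseOp d (Sum.inl j) φ)) w = inner ℂ (toL2 d φ) (h j)) :
    HasWeakGradient w (gradientOfMomentum h) where
  memLp := memLp_piLp_iff.2 fun j => (Lp.memLp (h j)).const_mul Complex.I
  integral_eq := fun φ j => by
    have h1 := hw j (conjSchwartz φ)
    rw [inner_toL2_conjSchwartz, inner_toL2_left] at h1
    simp only [phaseOp_inl_apply, fderiv_conjSchwartz_apply, map_mul, map_neg, Complex.conj_I,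
      neg_neg, Complex.conj_conj, mul_assoc] at h1
    rw [integral_const_mul] at h1
    have h2 : ∫ η, φ η * gradientOfMomentum h η j = Complex.I * ∫ η, φ η * h j η := by
      rw [← integral_const_mul]
      congr 1
      ext η
      simp only [gradientOfMomentum]; ring
    rw [h2, ← h1, ← mul_assoc, Complex.I_mul_I]
    ring

lemma norm_le_sum_norm_apply {𝕜 : Type*} [RCLike 𝕜] (v : EuclideanSpace 𝕜 (Fin d)) :
    ‖v‖ ≤ ∑ j, ‖v j‖ := by
  have h : v = ∑ j, EuclideanSpace.single j (v j) := by
    ext i; simp [Finset.sum_apply, Pi.single_apply]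
  conv_lhs => rw [h]
  exact (norm_sum_le _ _).trans (by simp)

lemma norm_gradientOfMomentum_le (h : Fin d → Lp ℂ 2 (volume : Measure (Space d))) (η : Space d) :
    ‖gradientOfMomentum h η‖ ≤ ∑ j, ‖h j η‖ :=
  (norm_le_sum_norm_apply _).trans (by simp [gradientOfMomentum])

lemma eLpNorm_le_of_norm_le_sum {ι E : Type*} [Fintype ι] [NormedAddCommGroup E] {f : Space d → E}
    {h : ι → Lp ℂ 2 (volume : Measure (Space d))} {C : ℝ} (hC : ∀ i, ‖h i‖ ≤ C)
    (hf : ∀ᵐ η, ‖f η‖ ≤ ∑ i, ‖h i η‖) :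
    eLpNorm f 2 volume ≤ ENNReal.ofReal (Fintype.card ι * C) := by
  calc eLpNorm f 2 volume ≤ eLpNorm (∑ i, fun η => ‖h i η‖) 2 volume := by
        refine eLpNorm_mono_ae_real ?_
        filter_upwards [hf] with η hη
        rwa [Finset.sum_apply]
    _ ≤ ∑ i, eLpNorm (fun η => ‖h i η‖) 2 volume :=
        eLpNorm_sum_le (fun i _ => (Lp.aestronglyMeasurable (h i)).norm) (by norm_num)
    _ ≤ ∑ _i : ι, ENNReal.ofReal C := Finset.sum_le_sum fun i _ => by
        rw [eLpNorm_norm, ← Lp.enorm_def, ← ofReal_norm]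
        exact ENNReal.ofReal_le_ofReal (hC i)
    _ = _ := by
        rw [Finset.sum_const, nsmul_eq_mul, ENNReal.ofReal_mul (by positivity)]
        simp

/-- Bounds for position and momentum along an approximating sequence give the weak gradient and
the weighted norm of the limit. -/
lemma exists_hasWeakGradient_of_tendsto {z : ℕ → 𝓢(Space d, ℂ)}
    {w : Lp ℂ 2 (volume : Measure (Space d))}
    (hz : Tendsto (fun n => toL2 d (z n)) atTop (𝓝 w)) {C : ℝ}
    (hC : ∀ n a, ‖toL2 d (phaseOp d a (z n))‖ ≤ C) :
    ∃ g : Space d → EuclideanSpace ℂ (Fin d), HasWeakGradient w g ∧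
      eLpNorm g 2 volume + eLpNorm (fun η => ‖η‖ * ‖w η‖) 2 volume
        ≤ ENNReal.ofReal (2 * d * C) := by
  obtain ⟨h, hh, hw⟩ := exists_weak_phaseOp hz hC
  have hC0 : 0 ≤ d * C := by
    rcases Nat.eq_zero_or_pos d with rfl | hd
    · simp
    · exact mul_nonneg (Nat.cast_nonneg d) ((norm_nonneg _).trans (hh (Sum.inl ⟨0, hd⟩)))
  refine ⟨gradientOfMomentum fun j => h (Sum.inl j),
    hasWeakGradient_gradientOfMomentum fun j φ => hw (Sum.inl j) φ, ?_⟩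
  have h1 := eLpNorm_le_of_norm_le_sum (f := gradientOfMomentum fun j => h (Sum.inl j))
    (fun j => hh (Sum.inl j)) (.of_forall fun η => norm_gradientOfMomentum_le _ η)
  have h2 := eLpNorm_le_of_norm_le_sum (f := fun η => ‖η‖ * ‖w η‖)
    (h := fun j => h (Sum.inr j)) (fun j => hh (Sum.inr j)) (by
      filter_upwards [ae_all_iff.2 fun k => ae_eq_of_inner_position (hw (Sum.inr k))] with η hη
      simp only [hη, norm_mul, norm_norm, ← Finset.sum_mul]
      gcongr
      refine (norm_le_sum_norm_apply η).trans (Finset.sum_le_sum fun j _ => ?_)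
      rw [Complex.norm_real, norm_mul, Real.norm_ofNat]
      linarith [norm_nonneg (η j)])
  rw [Fintype.card_fin] at h1 h2
  refine (add_le_add h1 h2).trans_eq ?_
  rw [← ENNReal.ofReal_add hC0 hC0]
  congr 1; ring

/-- If the products of a position and a momentum are bounded as well, then the weak gradient has a
weighted bound. -/
lemma exists_hasWeakGradient_weighted_of_tendsto {z : ℕ → 𝓢(Space d, ℂ)}
    {w : Lp ℂ 2 (volume : Measure (Space d))}
    (hz : Tendsto (fun n => toL2 d (z n)) atTop (𝓝 w)) {C C' : ℝ}
    (hC : ∀ n a, ‖toL2 d (phaseOp d a (z n))‖ ≤ C)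
    (hC' : ∀ n k j, ‖toL2 d (phaseOp d (Sum.inr k) (phaseOp d (Sum.inl j) (z n)))‖ ≤ C') :
    ∃ g : Space d → EuclideanSpace ℂ (Fin d), HasWeakGradient w g ∧
      eLpNorm (fun η => ‖η‖ * ‖g η‖) 2 volume ≤ ENNReal.ofReal (d ^ 2 * C') := by
  obtain ⟨h, -, hw⟩ := exists_weak_phaseOp hz hC
  have h2 : ∀ kj : Fin d × Fin d, ∃ h' : Lp ℂ 2 (volume : Measure (Space d)), ‖h'‖ ≤ C' ∧
      (h' : Space d → ℂ) =ᵐ[volume] fun η => ((2 * η kj.1 : ℝ) : ℂ) * h (Sum.inl kj.2) η := by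
    rintro ⟨k, j⟩
    obtain ⟨h', h1, h2⟩ := exists_weak_image
      (T := phaseOp d (Sum.inr k) ∘ₗ phaseOp d (Sum.inl j))
      (T' := phaseOp d (Sum.inl j) ∘ₗ phaseOp d (Sum.inr k))
      (fun f g => by
        simp only [LinearMap.comp_apply, (isCCR_phaseOp d).symm]) hz fun n => hC' n k j
    refine ⟨h', h1, ae_eq_of_inner_position fun φ => ?_⟩
    rw [← h2, ← hw]; rfl
  choose h' h1 h3 using h2
  refine ⟨gradientOfMomentum fun j => h (Sum.inl j),
    hasWeakGradient_gradientOfMomentum fun j φ => hw (Sum.inl j) φ, ?_⟩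
  have h4 := eLpNorm_le_of_norm_le_sum
    (f := fun η => ‖η‖ * ‖gradientOfMomentum (fun j => h (Sum.inl j)) η‖) h1 (by
      filter_upwards [ae_all_iff.2 h3] with η hη
      rw [norm_mul, norm_norm, norm_norm]
      simp only [hη, norm_mul, Complex.norm_real, Real.norm_ofNat, Fintype.sum_prod_type,
        ← Finset.mul_sum, ← Finset.sum_mul]
      refine mul_le_mul ?_ (norm_gradientOfMomentum_le _ η) (norm_nonneg _) (by positivity)
      refine (norm_le_sum_norm_apply η).trans ?_
      have : 0 ≤ ∑ i, ‖η i‖ := by positivity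
      linarith)
  simpa [sq] using h4

end WeakGradient

/-! ### The coefficients along the flow -/

section Coefficients

variable {d : ℕ} {V : Space d → ℝ} {T : ℝ} {q p : ℝ → Space d}
  {α : ℝ → Matrix (Fin d) (Fin d) ℂ} {B : ℝ → Matrix (Fin d) (Fin d) ℝ}

lemma continuousOn_mul_apply {l m n : Type*} [Fintype m] {X : ℝ → Matrix l m ℝ}
    {Y : ℝ → Matrix m n ℝ} {s : Set ℝ} (hX : ∀ i j, ContinuousOn (fun t => X t i j) s)
    (hY : ∀ i j, ContinuousOn (fun t => Y t i j) s) (i : l) (j : n) :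
    ContinuousOn (fun t => (X t * Y t) i j) s := by
  simp only [Matrix.mul_apply]
  exact continuousOn_finsetSum _ fun k _ => (hX i k).mul (hY k j)

lemma continuousOn_gaugeSymbol {A B : ℝ → Matrix (Fin d) (Fin d) ℝ} {s : Set ℝ}
    (hB : ∀ i j, ContinuousOn (fun t => B t i j) s)
    (hA : ∀ i j, ContinuousOn (fun t => A t i j) s) (a b : Fin d ⊕ Fin d) :
    ContinuousOn (fun t => gaugeSymbol (B t) (A t) a b) s := by
  have hK : ∀ i j, ContinuousOn (fun t => (B t * (B t)ᵀ) i j) s :=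
    continuousOn_mul_apply hB fun i j => hB j i
  have hM : ∀ i a, ContinuousOn (fun t => shiftMatrix (A t) i a) s := fun i a => by
    rcases a with a | a
    · exact continuousOn_const
    · exact (hA i a).const_smul (2 : ℝ)⁻¹
  have h1 := continuousOn_mul_apply (continuousOn_mul_apply
    (X := fun t => (shiftMatrix (A t))ᵀ) (fun a i => hM i a) hK) hM a b
  have h2 : ContinuousOn (fun t => Matrix.fromBlocks (0 : Matrix (Fin d) (Fin d) ℝ)
      (0 : Matrix (Fin d) (Fin d) ℝ) (0 : Matrix (Fin d) (Fin d) ℝ)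
      ((2 : ℝ)⁻¹ • (B t * (B t)ᵀ)) a b) s := by
    rcases a with a | a <;> rcases b with b | b
    · exact continuousOn_const
    · exact continuousOn_const
    · exact continuousOn_const
    · exact (hK a b).const_smul (2 : ℝ)⁻¹
  exact (h1.const_smul (2 : ℝ)⁻¹).add h2

namespace IsGWPTFlow

lemma continuousOn_q (h : IsGWPTFlow V T q p α B) : ContinuousOn q (Icc 0 T) :=
  fun t ht => (h.deriv_q t ht).continuousWithinAt

lemma continuousOn_B (h : IsGWPTFlow V T q p α B) (i j : Fin d) :
    ContinuousOn (fun t => B t i j) (Icc 0 T) :=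
  fun t ht => (h.deriv_B t ht i j).continuousWithinAt

lemma continuousOn_inv_B (h : IsGWPTFlow V T q p α B) (hT : 0 ≤ T) (i j : Fin d) :
    ContinuousOn (fun t => (B t)⁻¹ i j) (Icc 0 T) := by
  obtain ⟨C, h1, h2⟩ := h.exists_inverse hT
  have h3 : ContinuousOn (fun t => C t i j) (Icc 0 T) :=
    fun t ht => (h2 t ht i j).continuousWithinAt
  exact h3.congr fun t ht => by rw [Matrix.inv_eq_right_inv (h1 t ht)]

lemma continuousOn_residualPotential (h : IsGWPTFlow V T q p α B) (hT : 0 ≤ T)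
    (hV : ContDiff ℝ 2 V) (ε : ℝ) (η : Space d) :
    ContinuousOn (fun t => residualPotential ε V (q t) (B t) η) (Icc 0 T) := by
  have hy : ContinuousOn (fun t => Matrix.toEuclideanCLM (𝕜 := ℝ) (B t)⁻¹ η) (Icc 0 T) := by
    have h1 : ContinuousOn (fun t => ((B t)⁻¹ *ᵥ η.ofLp)) (Icc 0 T) :=
      continuousOn_pi.2 fun i => by
        simp only [Matrix.mulVec, dotProduct]
        exact continuousOn_finsetSum _ fun k _ =>
          (h.continuousOn_inv_B hT i k).mul continuousOn_const
    exact (PiLp.continuous_toLp 2 _).comp_continuousOn h1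
  have hq := h.continuousOn_q
  have hV0 := hV.continuous
  have hV1 : Continuous (fderiv ℝ V) := hV.continuous_fderiv (by simp)
  have hV2 : Continuous (fderiv ℝ (fderiv ℝ V)) :=
    (hV.fderiv_right (m := 1) (by norm_num)).continuous_fderiv (by simp)
  simp only [residualPotential_eq hV]
  refine continuousOn_const.mul ((((hV0.comp_continuousOn (hq.add (hy.const_smul √ε))).sub
    (hV0.comp_continuousOn hq)).sub (continuousOn_const.mul
      ((hV1.comp_continuousOn hq).clm_apply hy))).sub (continuousOn_const.mul
        (((hV2.comp_continuousOn hq).clm_apply hy).clm_apply hy)))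

lemma isRegularHamiltonian (h : IsGWPTFlow V T q p α B) (hT : 0 ≤ T) (hV : ContDiff ℝ 2 V)
    {ε M : ℝ} (hε1 : ε ≤ 1)
    (hM : ∀ t ∈ Icc 0 T, ∀ η, |residualPotential ε V (q t) (B t) η| ≤ M)
    {G : ℝ → Matrix (Fin d ⊕ Fin d) (Fin d ⊕ Fin d) ℝ} (hs : ∀ t ∈ Icc 0 T, (G t).IsSymm)
    (hG : ∀ a b, ContinuousOn (fun t => G t a b) (Icc 0 T)) :
    IsRegularHamiltonian T M G (fun t η => √ε * residualPotential ε V (q t) (B t) η) where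
  symm := hs
  continuousOn_symbol := hG
  continuous_potential _ _ := continuous_const.mul (continuous_residualPotential hV _ _ _)
  bound t ht η := by
    rw [abs_mul, abs_of_nonneg (Real.sqrt_nonneg ε)]
    exact (mul_le_of_le_one_left (abs_nonneg _) (Real.sqrt_le_one.2 hε1)).trans (hM t ht η)
  continuousOn_potential η := continuousOn_const.mul (h.continuousOn_residualPotential hT hV ε η)

end IsGWPTFlow

lemma contDiff_residualPotential (hV : ContDiff ℝ 2 V) {ε : ℝ} (hε : 0 < ε) (x : Space d)
    (b : Matrix (Fin d) (Fin d) ℝ) : ContDiff ℝ 1 (residualPotential ε V x b) := by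
  have hV1 : Continuous (fderiv ℝ V) := hV.continuous_fderiv (by simp)
  refine contDiff_one_iff_hasFDerivAt.2 ⟨_, ?_, hasFDerivAt_residualPotential hV hε x b⟩
  have hY : Continuous (Matrix.toEuclideanCLM (𝕜 := ℝ) b⁻¹) := ContinuousLinearMap.continuous _
  have h1 : Continuous fun η => fderiv ℝ V (x + √ε • Matrix.toEuclideanCLM (𝕜 := ℝ) b⁻¹ η)
      - fderiv ℝ V x - √ε • fderiv ℝ (fderiv ℝ V) x (Matrix.toEuclideanCLM (𝕜 := ℝ) b⁻¹ η) :=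
    ((hV1.comp (continuous_const.add (hY.const_smul √ε))).sub continuous_const).sub
      (((fderiv ℝ (fderiv ℝ V) x).continuous.comp hY).const_smul √ε)
  have h2 : Continuous fun _ : Space d => Matrix.toEuclideanCLM (𝕜 := ℝ) b⁻¹ := continuous_const
  exact (h1.clm_comp h2).const_smul ε⁻¹

lemma abs_fderiv_le_norm_gradient (f : Space d → ℝ) (η v : Space d) :
    |fderiv ℝ f η v| ≤ ‖gradient f η‖ * ‖v‖ := by
  have h : fderiv ℝ f η v = inner ℝ (gradient f η) v := by
    rw [gradient, InnerProductSpace.toDual_symm_apply]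
  rw [h]
  exact abs_real_inner_le_norm _ _

end Coefficients

/-! ### Bounds for the norm and the energy of the solution -/

section Bounds

open Filter Topology

variable {d : ℕ} {V : Space d → ℝ} {T ε M : ℝ} {q p : ℝ → Space d}
  {α : ℝ → Matrix (Fin d) (Fin d) ℂ} {B : ℝ → Matrix (Fin d) (Fin d) ℝ}
  {w : ℝ → Lp ℂ 2 (volume : Measure (Space d))}

lemma IsWSolution.initial_mem (h : IsWSolution ε V T q B w) : w 0 ∈ hermiteL2 d 0 := by
  rw [h.initial_eq]
  refine Submodule.mem_map_of_mem ?_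
  rw [← Complex.coe_smul]
  exact Submodule.smul_mem _ _ (groundState_mem 0)

/-- The initial value is a multiple of the ground state, so that the norms of all operators applied
to it scale with its own norm. -/
lemma IsWSolution.norm_toL2_initial (h : IsWSolution ε V T q B w)
    (P : 𝓢(Space d, ℂ) →ₗ[ℂ] 𝓢(Space d, ℂ)) {φ : 𝓢(Space d, ℂ)} (hφ : toL2 d φ = w 0) :
    ‖toL2 d (P φ)‖
      = ‖toL2 d (P (groundState d))‖ / ‖toL2 d (groundState d)‖ * ‖w 0‖ := by
  have h1 : φ = ((((2 : ℝ) ^ ((d : ℝ) / 4) / (Real.pi * ε) ^ ((d : ℝ) / 4) : ℝ)) : ℂ) •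
      groundState d := by
    rw [Complex.coe_smul]
    exact toL2_injective (hφ.trans h.initial_eq)
  rw [← hφ, h1, map_smul, map_smul, map_smul, norm_smul, norm_smul]
  field_simp [norm_toL2_groundState_pos.ne']

/-- The quadratic Hamiltonian preserves the Hermite spaces, hence the duality argument with Galerkin
solutions applies to the weak solution. -/
lemma IsWSolution.norm_le (h : IsWSolution ε V T q B w) (hT : 0 ≤ T) (hε1 : ε ≤ 1)
    (hV : ContDiff ℝ 2 V) (hflow : IsGWPTFlow V T q p α B)
    (hM : ∀ t ∈ Icc 0 T, ∀ η, |residualPotential ε V (q t) (B t) η| ≤ M) {t : ℝ}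
    (ht : t ∈ Icc 0 T) : ‖w t‖ ≤ ‖w 0‖ := by
  have hR := hflow.isRegularHamiltonian hT hV hε1 hM (fun t _ => isSymm_gaugeSymbol (B t) 0)
    (continuousOn_gaugeSymbol (A := fun _ => 0) hflow.continuousOn_B fun _ _ => continuousOn_const)
  have hw := h.isWeakSolution (fun t _ => continuous_residualPotential hV ε (q t) (B t)) hR.bound
  exact hw.norm_le hR (fun t _ n φ hφ => quadOp_gaugeSymbol_zero_mem hφ (B t)) ht

/-- The energy estimate for the Galerkin approximations, which converge to the solution. The
constant does not depend on the flow because the energy is conserved by the quadratic part. -/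
lemma IsWSolution.exists_tendsto_energy (h : IsWSolution ε V T q B w) (hT : 0 ≤ T) (hε : 0 < ε)
    (hε1 : ε ≤ 1) (hV : ContDiff ℝ 2 V) (hflow : IsGWPTFlow V T q p α B)
    (hM : ∀ t ∈ Icc 0 T, ∀ η, |residualPotential ε V (q t) (B t) η| ≤ M)
    (hM' : ∀ t ∈ Icc 0 T, ∀ η, ‖gradient (residualPotential ε V (q t) (B t)) η‖ ≤ M) {t : ℝ}
    (ht : t ∈ Icc 0 T) :
    ∃ z : ℕ → 𝓢(Space d, ℂ), Tendsto (fun n => toL2 d (z n)) atTop (𝓝 (w t)) ∧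
      ∀ n a, ‖toL2 d (phaseOp d a (z n))‖ ≤
        √((∑ a, (‖toL2 d (phaseOp d a (groundState d))‖ / ‖toL2 d (groundState d)‖) ^ 2
          + d * M ^ 2) * Real.exp T) * ‖w 0‖ := by
  set W : ℝ → Space d → ℝ := fun t η => √ε * residualPotential ε V (q t) (B t) η
  have hR := hflow.isRegularHamiltonian hT hV hε1 hM (fun t _ => isSymm_gaugeSymbol (B t) 0)
    (continuousOn_gaugeSymbol (A := fun _ => 0) hflow.continuousOn_B fun _ _ => continuousOn_const)
  have hw := h.isWeakSolution (fun t _ => continuous_residualPotential hV ε (q t) (B t)) hR.bound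
  obtain ⟨u, hu, hu0⟩ := IsWeakSolution.exists_galerkin h.initial_mem hR hT
  have h0T : (0 : ℝ) ∈ Icc 0 T := ⟨le_rfl, hT⟩
  have hnorm : ∀ n, ∀ s ∈ Icc 0 T, ‖u n s‖ = ‖w 0‖ := fun n s hs => by
    rw [(hu n).norm_eq (fun s hs => hR.symm_galerkinOp n hs) hs h0T, ← hu0 n]; rfl
  have hlim := hw.tendsto_galerkin hR hu hu0 (D := M * ‖w 0‖) (fun n s hs => by
    rw [← hnorm n s hs]
    exact hR.norm_galerkinResidual_le hs (fun φ hφ => quadOp_gaugeSymbol_zero_mem hφ (B s)) _)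
    (fun s hs => h.norm_le hT hε1 hV hflow hM hs) ht
  have hWM' : ∀ s ∈ Icc 0 T, ∀ η j, |fderiv ℝ (W s) η (EuclideanSpace.single j 1)| ≤ M :=
    fun s hs η j => by
      have h1 : fderiv ℝ (W s) η = √ε • fderiv ℝ (residualPotential ε V (q s) (B s)) η :=
        fderiv_const_mul ((contDiff_residualPotential hV hε _ _).differentiable (by simp) η) _
      rw [h1, smul_apply, smul_eq_mul, abs_mul, abs_of_nonneg (Real.sqrt_nonneg ε)]
      refine (mul_le_of_le_one_left (abs_nonneg _) (Real.sqrt_le_one.2 hε1)).trans ?_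
      refine (abs_fderiv_le_norm_gradient _ _ _).trans ?_
      simpa using hM' s hs η
  refine ⟨fun n => hermiteRep d n (u n t), by simpa only [toL2_hermiteRep] using hlim,
    fun n a => ?_⟩
  have h2 := (hu n).expectation_le hT (fun s hs => hR.symm_galerkinOp n hs)
    (galerkinOp n 1 fun _ => 0)
    ((isRegularHamiltonian_oscillator T).symm_galerkinOp n h0T) (c := d * M ^ 2)
    (fun s hs x => two_mul_im_inner_oscillator_le x (B s)
      (contDiff_const.mul (contDiff_residualPotential hV hε _ _)) (hR.bound s hs) (hWM' s hs)) ht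
  rw [re_inner_galerkinOp_oscillator, re_inner_galerkinOp_oscillator, hnorm n 0 h0T] at h2
  have h3 : ∑ a, ‖toL2 d (phaseOp d a (hermiteRep d n (u n 0)))‖ ^ 2
      = (∑ a, (‖toL2 d (phaseOp d a (groundState d))‖ / ‖toL2 d (groundState d)‖) ^ 2)
        * ‖w 0‖ ^ 2 := by
    rw [Finset.sum_mul]
    refine Finset.sum_congr rfl fun a _ => ?_
    rw [h.norm_toL2_initial (phaseOp d a) ((toL2_hermiteRep _).trans (hu0 n)), mul_pow]
  rw [h3] at h2
  rw [← Real.sqrt_sq (norm_nonneg (w 0)), ← Real.sqrt_mul (by positivity)]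
  refine Real.le_sqrt_of_sq_le ?_
  calc ‖toL2 d (phaseOp d a (hermiteRep d n (u n t)))‖ ^ 2
      ≤ ∑ a, ‖toL2 d (phaseOp d a (hermiteRep d n (u n t)))‖ ^ 2 :=
        Finset.single_le_sum (f := fun a => ‖toL2 d (phaseOp d a (hermiteRep d n (u n t)))‖ ^ 2)
          (fun _ _ => by positivity) (Finset.mem_univ a)
    _ ≤ _ := le_trans (le_add_of_nonneg_right (by positivity)) h2
    _ ≤ _ := by
        rw [← add_mul, mul_right_comm]
        gcongr
        exact ht.2

end Bounds


/-! ### Positivity of the gauged symbol and coercivity -/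

section Coercivity

variable {d : ℕ}

lemma sum_transpose_mul_inner {A K H : Type*} [Fintype A] [Fintype K] [NormedAddCommGroup H]
    [InnerProductSpace ℂ H] (N : Matrix K A ℝ) (v : A → H) :
    ∑ a, ∑ b, ((Nᵀ * N) a b : ℂ) * inner ℂ (v a) (v b)
      = ((∑ k, ‖∑ a, (N k a : ℂ) • v a‖ ^ 2 : ℝ) : ℂ) := by
  have h : ∀ k, ((‖∑ a, (N k a : ℂ) • v a‖ ^ 2 : ℝ) : ℂ)
      = ∑ a, ∑ b, ((N k a : ℂ) * N k b) * inner ℂ (v a) (v b) := fun k => by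
    have h1 := inner_self_eq_norm_sq_to_K (𝕜 := ℂ) (∑ a, (N k a : ℂ) • v a)
    rw [Complex.ofReal_pow]
    refine h1.symm.trans ?_
    simp only [sum_inner, inner_sum, inner_smul_left, inner_smul_right, Complex.conj_ofReal,
      Finset.mul_sum]
    rw [Finset.sum_comm]
    exact Finset.sum_congr rfl fun a _ => Finset.sum_congr rfl fun b _ => by ring
  rw [Complex.ofReal_sum]
  simp only [h, Matrix.mul_apply, Matrix.transpose_apply, Complex.ofReal_sum, Complex.ofReal_mul,
    Finset.sum_mul]
  conv_rhs => rw [Finset.sum_comm]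
  refine Finset.sum_congr rfl fun a _ => ?_
  conv_rhs => rw [Finset.sum_comm]

lemma sq_sum_smul_le {K H : Type*} [Fintype K] [NormedAddCommGroup H]
    [InnerProductSpace ℂ H] {c : K → ℝ} {κ : ℝ} (hc : ∀ k, |c k| ≤ κ) (v : K → H) :
    ‖∑ k, (c k : ℂ) • v k‖ ^ 2 ≤ Fintype.card K * κ ^ 2 * ∑ k, ‖v k‖ ^ 2 := by
  calc ‖∑ k, (c k : ℂ) • v k‖ ^ 2 ≤ (∑ k, ‖(c k : ℂ) • v k‖) ^ 2 := by
        gcongr; exact norm_sum_le _ _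
    _ ≤ Fintype.card K * ∑ k, ‖(c k : ℂ) • v k‖ ^ 2 := by
        simpa using sq_sum_le_card_mul_sum_sq (s := Finset.univ) (f := fun k => ‖(c k : ℂ) • v k‖)
    _ ≤ Fintype.card K * ∑ k, κ ^ 2 * ‖v k‖ ^ 2 := by
        gcongr with k _
        rw [norm_smul, Complex.norm_real, Real.norm_eq_abs, mul_pow]
        gcongr
        exact hc k
    _ = _ := by rw [← Finset.mul_sum, mul_assoc]

/-- If the time derivative of the gauge is positive, the gauged symbol is positive definite. -/
lemma gaugeSymbol_add_pos {H : Type*} [NormedAddCommGroup H] [InnerProductSpace ℂ H]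
    {B C A R : Matrix (Fin d) (Fin d) ℝ} {κ : ℝ} (hBC : B * C = 1) (hC : ∀ i j, |C i j| ≤ κ)
    (hA : ∀ i j, |A i j| ≤ κ)
    (hR : ∀ v : Fin d → H, ∑ k, ‖v k‖ ^ 2 ≤ (∑ k, ∑ l, (R k l : ℂ) * inner ℂ (v k) (v l)).re)
    (v : Fin d ⊕ Fin d → H) :
    (4 * d ^ 2 * κ ^ 2 + 1)⁻¹ * ∑ a, ‖v a‖ ^ 2
      ≤ (∑ a, ∑ b, (((gaugeSymbol B A + Matrix.fromBlocks 0 0 0 R :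
          Matrix (Fin d ⊕ Fin d) (Fin d ⊕ Fin d) ℝ) a b : ℝ) : ℂ)
        * inner ℂ (v a) (v b)).re := by
  set x : Fin d → H := fun i => v (Sum.inl i) + ∑ j, ((A i j / 2 : ℝ) : ℂ) • v (Sum.inr j)
  set y : Fin d → H := fun k => ∑ i, (B i k : ℂ) • x i
  set Y := ∑ k, ‖y k‖ ^ 2
  set Z := ∑ k, ‖v (Sum.inr k)‖ ^ 2
  have hY0 : 0 ≤ Y := by positivity
  have hZ0 : 0 ≤ Z := by positivity
  have hx : ∀ i, x i = ∑ k, (C k i : ℂ) • y k := fun i => by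
    simp only [y, Finset.smul_sum, smul_smul]
    rw [Finset.sum_comm]
    have h1 : ∀ j, ∑ k, ((C k i : ℂ) * (B j k : ℂ)) • x j = (((B * C) j i : ℝ) : ℂ) • x j :=
      fun j => by
        rw [← Finset.sum_smul, Matrix.mul_apply]
        congr 1
        push_cast
        exact Finset.sum_congr rfl fun k _ => mul_comm _ _
    simp [h1, hBC, Matrix.one_apply]
  have hx2 : ∑ i, ‖x i‖ ^ 2 ≤ d ^ 2 * κ ^ 2 * Y := by
    calc ∑ i, ‖x i‖ ^ 2 ≤ ∑ _i : Fin d, d * κ ^ 2 * Y := Finset.sum_le_sum fun i _ => by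
          rw [hx i]
          simpa using sq_sum_smul_le (fun k => hC k i) y
      _ = _ := by simp; ring
  have hv : ∑ i, ‖v (Sum.inl i)‖ ^ 2 ≤ 2 * (d ^ 2 * κ ^ 2 * Y) + 2 * (d ^ 2 * (κ / 2) ^ 2 * Z) := by
    calc ∑ i, ‖v (Sum.inl i)‖ ^ 2
        ≤ ∑ i, (2 * ‖x i‖ ^ 2 + 2 * (d * (κ / 2) ^ 2 * Z)) := Finset.sum_le_sum fun i _ => by
          have h1 : v (Sum.inl i) = x i - ∑ j, ((A i j / 2 : ℝ) : ℂ) • v (Sum.inr j) := by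
            simp [x]
          have h2 : ‖∑ j, ((A i j / 2 : ℝ) : ℂ) • v (Sum.inr j)‖ ^ 2 ≤ d * (κ / 2) ^ 2 * Z := by
            simpa using sq_sum_smul_le (c := fun j => A i j / 2) (κ := κ / 2) (fun j => by
              rw [abs_div, abs_two]; linarith [hA i j]) fun j => v (Sum.inr j)
          have h3 := norm_sub_le (x i) (∑ j, ((A i j / 2 : ℝ) : ℂ) • v (Sum.inr j))
          rw [← h1] at h3
          have h4 := pow_le_pow_left₀ (norm_nonneg _) h3 2
          nlinarith [sq_nonneg (‖x i‖ - ‖∑ j, ((A i j / 2 : ℝ) : ℂ) • v (Sum.inr j)‖)]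
      _ = 2 * ∑ i, ‖x i‖ ^ 2 + 2 * (d ^ 2 * (κ / 2) ^ 2 * Z) := by
          rw [Finset.sum_add_distrib, ← Finset.mul_sum]; simp; ring
      _ ≤ _ := by linarith
  -- the symbol is a sum of two squares and of the form of `R`
  have h1 : ∀ k, ∑ a, (((Bᵀ * shiftMatrix A) k a : ℝ) : ℂ) • v a = y k := fun k => by
    simp only [y, Matrix.mul_apply, Matrix.transpose_apply, Complex.ofReal_sum,
      Complex.ofReal_mul, Finset.sum_smul]
    rw [Finset.sum_comm]
    refine Finset.sum_congr rfl fun i _ => ?_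
    simp only [mul_smul, ← Finset.smul_sum]
    congr 1
    rw [Fintype.sum_sum_type]
    simp only [x, shiftMatrix, Matrix.fromCols_apply_inl, Matrix.fromCols_apply_inr]
    congr 1
    · simp [Matrix.one_apply]
    · refine Finset.sum_congr rfl fun j _ => ?_
      rw [Matrix.smul_apply, smul_eq_mul, div_eq_inv_mul]
  have h2 : (∑ a, ∑ b, (((gaugeSymbol B A + Matrix.fromBlocks 0 0 0 R :
          Matrix (Fin d ⊕ Fin d) (Fin d ⊕ Fin d) ℝ) a b : ℝ) : ℂ)
        * inner ℂ (v a) (v b)) = (2 : ℂ)⁻¹ * ((Y : ℝ) : ℂ)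
      + (2 : ℂ)⁻¹ * ((∑ k, ‖∑ i, ((Bᵀ k i : ℝ) : ℂ) • v (Sum.inr i)‖ ^ 2 : ℝ) : ℂ)
      + ∑ k, ∑ l, (R k l : ℂ) * inner ℂ (v (Sum.inr k)) (v (Sum.inr l)) := by
    have e1 : (shiftMatrix A)ᵀ * (B * Bᵀ) * shiftMatrix A
        = (Bᵀ * shiftMatrix A)ᵀ * (Bᵀ * shiftMatrix A) := by
      rw [Matrix.transpose_mul, Matrix.transpose_transpose]
      simp only [Matrix.mul_assoc]
    have e2 := sum_transpose_mul_inner (Bᵀ * shiftMatrix A) v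
    simp only [h1] at e2
    have e3 := sum_transpose_mul_inner Bᵀ fun i => v (Sum.inr i)
    rw [Matrix.transpose_transpose] at e3
    rw [← e2, ← e3, gaugeSymbol, e1]
    simp only [Matrix.add_apply, Matrix.smul_apply, smul_eq_mul, Complex.ofReal_add,
      Complex.ofReal_mul, add_mul, Finset.sum_add_distrib, Finset.mul_sum, mul_assoc]
    refine congrArg₂ (· + ·) (congrArg₂ (· + ·) ?_ ?_) ?_
    · exact Finset.sum_congr rfl fun a _ => Finset.sum_congr rfl fun b _ => by push_cast; ring
    · simp [Fintype.sum_sum_type, Matrix.smul_apply, mul_assoc]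
    · simp [Fintype.sum_sum_type]
  have h3 := hR fun k => v (Sum.inr k)
  have h4 : (2⁻¹ : ℝ) * Y + Z ≤ (∑ a, ∑ b, (((gaugeSymbol B A + Matrix.fromBlocks 0 0 0 R :
          Matrix (Fin d ⊕ Fin d) (Fin d ⊕ Fin d) ℝ) a b : ℝ) : ℂ)
        * inner ℂ (v a) (v b)).re := by
    rw [h2]
    have e4 : (0 : ℝ) ≤ ∑ k, ‖∑ i, ((Bᵀ k i : ℝ) : ℂ) • v (Sum.inr i)‖ ^ 2 := by positivity
    have e5 : ∀ r : ℝ, ((2 : ℂ)⁻¹ * (r : ℂ)).re = 2⁻¹ * r := fun r => by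
      rw [show (2 : ℂ)⁻¹ = ((2⁻¹ : ℝ) : ℂ) by push_cast; rfl, ← Complex.ofReal_mul,
        Complex.ofReal_re]
    rw [Complex.add_re, Complex.add_re, e5, e5]
    linarith
  refine le_trans ?_ h4
  rw [inv_mul_le_iff₀ (by positivity), Fintype.sum_sum_type]
  have h5 : 0 ≤ d ^ 2 * κ ^ 2 * Z := by positivity
  nlinarith

lemma re_inner_oscillator_quadOp_le {n : ℕ} {G : Matrix (Fin d ⊕ Fin d) (Fin d ⊕ Fin d) ℝ}
    {W : Space d → ℝ} {M : ℝ} (hc : Continuous W) (hM : ∀ η, |W η| ≤ M) (x : hermiteL2 d n) :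
    (inner ℂ (toL2 d (oscillator (phaseOp d) (hermiteRep d n x)))
      (toL2 d (quadOp (phaseOp d) G (hermiteRep d n x)))).re
      ≤ ‖toL2 d (oscillator (phaseOp d) (hermiteRep d n x))‖
        * (‖galerkinOp n G W x‖ + M * ‖x‖) := by
  have e1 : inner ℂ (galerkinOp n 1 (fun _ => 0) x) (galerkinOp n G W x)
      = inner ℂ (toL2 d (oscillator (phaseOp d) (hermiteRep d n x)))
          (toL2 d (quadOp (phaseOp d) G (hermiteRep d n x)))
        + inner ℂ (toL2 d (oscillator (phaseOp d) (hermiteRep d n x)))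
          (mulOp (fun η => ((W η : ℝ) : ℂ)) (toL2 d (hermiteRep d n x))) := by
    rw [galerkinOp_apply n G W, Submodule.inner_orthogonalProjectionOnto_eq_of_mem_left,
      coe_galerkinOp_oscillator, fullOp_apply, inner_add_right]
  have e3 := norm_mulOp_le (f := fun η => ((W η : ℝ) : ℂ)) (Complex.continuous_ofReal.comp hc)
    (M := M) (fun η => by simpa using hM η) (toL2 d (hermiteRep d n x))
  have hx := norm_toL2_hermiteRep x
  have hE : ‖toL2 d (oscillator (phaseOp d) (hermiteRep d n x))‖
      = ‖galerkinOp n 1 (fun _ => 0) x‖ := (congrArg norm (coe_galerkinOp_oscillator x)).symm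
  rw [hx] at e3
  have e5 := (abs_le.1 ((Complex.abs_re_le_norm _).trans (norm_inner_le_norm (𝕜 := ℂ)
    (toL2 d (oscillator (phaseOp d) (hermiteRep d n x)))
    (mulOp (fun η => ((W η : ℝ) : ℂ)) (toL2 d (hermiteRep d n x)))))).1
  have e6 := (abs_le.1 ((Complex.abs_re_le_norm _).trans (norm_inner_le_norm (𝕜 := ℂ)
    (galerkinOp n 1 (fun _ => 0) x) (galerkinOp n G W x)))).2
  rw [e1, Complex.add_re, ← hE] at e6
  have e4 := mul_le_mul_of_nonneg_left e3
    (norm_nonneg (toL2 d (oscillator (phaseOp d) (hermiteRep d n x))))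
  have key : ∀ a b c m L r : ℝ, -(c * m) ≤ b → a + b ≤ c * L → c * m ≤ c * r → a ≤ c * (L + r) :=
    fun a b c m L r h1 h2 h3 => by linarith
  exact key _ _ _ _ _ _ e5 e6 e4

/-- The arithmetic of coercivity: in Gårding's inequality one factor of the second order norm `N` is
cancelled, `E` being the norm of the oscillator and `S` the energy. -/
lemma le_of_garding {g N E L X M Γ r S D : ℝ} (hg : 0 < g) (hN : 0 ≤ N) (hE : 0 ≤ E) (hL : 0 ≤ L)
    (hX : 0 ≤ X) (hM : 0 ≤ M) (hΓ : 0 ≤ Γ)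
    (h1 : g * N ^ 2 ≤ r + 2 * Γ * 2 * D ^ 2 * S)
    (h2 : S ≤ X * E) (h3 : E ≤ √D * N) (h4 : r ≤ E * (L + M * X)) :
    N ≤ √D / g * (1 + M + 4 * Γ * D ^ 2) * (L + X) := by
  have h5 : g * N ^ 2 ≤ √D * N * ((1 + M + 4 * Γ * D ^ 2) * (L + X)) := by
    calc g * N ^ 2 ≤ E * (L + M * X) + 2 * Γ * 2 * D ^ 2 * (X * E) := by
          refine h1.trans (add_le_add h4 ?_)
          gcongr
      _ = E * (L + (M + 4 * Γ * D ^ 2) * X) := by ring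
      _ ≤ E * ((1 + M + 4 * Γ * D ^ 2) * (L + X)) := by
          refine mul_le_mul_of_nonneg_left ?_ hE
          have : 0 ≤ (M + 4 * Γ * D ^ 2) * L := by positivity
          linarith
      _ ≤ _ := by gcongr
  rcases hN.eq_or_lt with h6 | h6
  · rw [← h6]; positivity
  · have h7 : g * N ≤ √D * ((1 + M + 4 * Γ * D ^ 2) * (L + X)) := by
      refine le_of_mul_le_mul_right ?_ h6
      linarith
    rw [div_mul_eq_mul_div, div_mul_eq_mul_div, le_div_iff₀ hg]
    linarith

/-- Coercivity of the compression of a positive definite symbol: because the oscillator preserves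
the Hermite spaces, the Gårding inequality survives the Galerkin projection. -/
lemma norm₂_hermiteRep_le {n : ℕ} {G : Matrix (Fin d ⊕ Fin d) (Fin d ⊕ Fin d) ℝ} {W : Space d → ℝ}
    {g Γ M : ℝ} (hg : 0 < g) (hΓ0 : 0 ≤ Γ) (hM0 : 0 ≤ M) (hΓ : ∀ a b, |G a b| ≤ Γ)
    (hpos : ∀ v : Fin d ⊕ Fin d → Lp ℂ 2 (volume : Measure (Space d)), g * ∑ a, ‖v a‖ ^ 2
      ≤ (∑ a, ∑ b, (G a b : ℂ) * inner ℂ (v a) (v b)).re)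
    (hc : Continuous W) (hM : ∀ η, |W η| ≤ M) (x : hermiteL2 d n) :
    norm₂ (toL2 d) (phaseOp d) (hermiteRep d n x)
      ≤ √(2 * d) / g * (1 + M + 4 * Γ * (2 * d) ^ 2) * (‖galerkinOp n G W x‖ + ‖x‖) := by
  have hcard : (Fintype.card (Fin d ⊕ Fin d) : ℝ) = 2 * d := by
    rw [Fintype.card_sum, Fintype.card_fin]; push_cast; ring
  have h1 := (isCCR_phaseOp d).garding abs_phaseComm_le hΓ hpos (hermiteRep d n x)
  have h2 := (isCCR_phaseOp d).sum_norm_sq_le (hermiteRep d n x)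
  have h3 := IsCCR.norm_oscillator_le (ι := toL2 d) (X := phaseOp d) (hermiteRep d n x)
  rw [hcard] at h1 h3
  rw [norm_toL2_hermiteRep] at h2
  exact le_of_garding hg (norm₂_nonneg _) (norm_nonneg _) (norm_nonneg _) (norm_nonneg _) hM0 hΓ0
    h1 h2 h3 (re_inner_oscillator_quadOp_le hc hM x)

lemma one_add_norm_sq_mul_eq (φ : 𝓢(Space d, ℂ)) (η : Space d) :
    (φ + (4 : ℂ)⁻¹ • ∑ k, phaseOp d (Sum.inr k) (phaseOp d (Sum.inr k) φ)) η
      = ((1 + ‖η‖ ^ 2 : ℝ) : ℂ) * φ η := by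
  rw [EuclideanSpace.norm_sq_eq]
  simp only [add_apply, smul_apply, sum_apply, phaseOp_inr_apply, smul_eq_mul,
    Real.norm_eq_abs, sq_abs]
  push_cast
  rw [add_mul, one_mul, Finset.mul_sum, Finset.sum_mul]
  congr 1
  exact Finset.sum_congr rfl fun k _ => by ring

/-- A part of the symbol that acts by multiplication may be moved to the potential; the difference
of two Hamiltonians is then estimated by the differences of the remaining symbols and of the total
potentials. -/
lemma norm_fullOp_sub_le {G G' : Matrix (Fin d ⊕ Fin d) (Fin d ⊕ Fin d) ℝ}
    {R R' : Matrix (Fin d) (Fin d) ℝ} {W W' : Space d → ℝ} {M δ : ℝ} (hδ : 0 ≤ δ)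
    (hc : Continuous W) (hc' : Continuous W') (hM : ∀ η, |W η| ≤ M) (hM' : ∀ η, |W' η| ≤ M)
    (hG : ∀ a b, |G a b - G' a b| ≤ δ)
    (hW : ∀ η, |(4 * quadForm R η + W η) - (4 * quadForm R' η + W' η)| ≤ δ * (1 + ‖η‖ ^ 2))
    (φ : 𝓢(Space d, ℂ)) :
    ‖fullOp (G + Matrix.fromBlocks 0 0 0 R) W φ - fullOp (G' + Matrix.fromBlocks 0 0 0 R') W' φ‖
      ≤ δ * (4 * d ^ 2 + d + 1) * (norm₂ (toL2 d) (phaseOp d) φ + ‖toL2 d φ‖) := by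
  have hadd : ∀ G G' : Matrix (Fin d ⊕ Fin d) (Fin d ⊕ Fin d) ℝ,
      quadOp (phaseOp d) (G + G') φ = quadOp (phaseOp d) G φ + quadOp (phaseOp d) G' φ :=
    fun G G' => by
      simp only [quadOp_apply, Matrix.add_apply, Complex.ofReal_add, add_smul,
        Finset.sum_add_distrib]
  set N := norm₂ (toL2 d) (phaseOp d) φ
  have hN0 : 0 ≤ N := norm₂_nonneg φ
  set ψ := φ + (4 : ℂ)⁻¹ • ∑ k, phaseOp d (Sum.inr k) (phaseOp d (Sum.inr k) φ)
  have hψ : ‖toL2 d ψ‖ ≤ ‖toL2 d φ‖ + d * N := by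
    simp only [ψ, map_add, map_smul, map_sum]
    refine (norm_add_le _ _).trans ?_
    gcongr
    rw [norm_smul]
    calc ‖(4 : ℂ)⁻¹‖ * ‖∑ k, toL2 d (phaseOp d (Sum.inr k) (phaseOp d (Sum.inr k) φ))‖
        ≤ 1 * ∑ _k : Fin d, N := by
          gcongr
          · norm_num
          · exact (norm_sum_le _ _).trans (Finset.sum_le_sum fun k _ =>
              norm_le_norm₂ (ι := toL2 d) (X := phaseOp d) (Sum.inr k) (Sum.inr k) φ)
      _ = _ := by simp
  set r := fullOp (G + Matrix.fromBlocks 0 0 0 R) W φ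
    - fullOp (G' + Matrix.fromBlocks 0 0 0 R') W' φ
  set D := toL2 d (quadOp (phaseOp d) (G - G') φ)
  have hD : ‖D‖ ≤ 4 * d ^ 2 * δ * N := by
    refine (norm_quadOp_le (ι := toL2 d) (X := phaseOp d) (G - G') φ).trans ?_
    gcongr
    calc ∑ a, ∑ b, |(G - G') a b| ≤ ∑ _a : Fin d ⊕ Fin d, ∑ _b : Fin d ⊕ Fin d, δ :=
          Finset.sum_le_sum fun a _ => Finset.sum_le_sum fun b _ => hG a b
      _ = _ := by simp; ring
  have hr : ‖r - D‖ ≤ δ * ‖toL2 d ψ‖ := by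
    refine Lp.norm_le_mul_norm_of_ae_le_mul ?_
    have hGG : quadOp (phaseOp d) G φ
        = quadOp (phaseOp d) G' φ + quadOp (phaseOp d) (G - G') φ := by
      rw [← hadd, add_sub_cancel]
    have hr' : r - D = toL2 d (quadOp (phaseOp d) (Matrix.fromBlocks 0 0 0 R) φ
          - quadOp (phaseOp d) (Matrix.fromBlocks 0 0 0 R') φ)
        + (mulOp (fun η => ((W η : ℝ) : ℂ)) (toL2 d φ)
          - mulOp (fun η => ((W' η : ℝ) : ℂ)) (toL2 d φ)) := by
      simp only [r, D, fullOp_apply, hadd, hGG, map_add, map_sub]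
      abel
    rw [hr']
    filter_upwards [coeFn_toL2 ψ, coeFn_toL2 φ,
      coeFn_toL2 (quadOp (phaseOp d) (Matrix.fromBlocks 0 0 0 R) φ
          - quadOp (phaseOp d) (Matrix.fromBlocks 0 0 0 R') φ),
      coeFn_mulOp (f := fun η => ((W η : ℝ) : ℂ)) (Complex.continuous_ofReal.comp hc) (M := M)
        (fun η => by simpa using hM η) (toL2 d φ),
      coeFn_mulOp (f := fun η => ((W' η : ℝ) : ℂ)) (Complex.continuous_ofReal.comp hc') (M := M)
        (fun η => by simpa using hM' η) (toL2 d φ),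
      Lp.coeFn_add (toL2 d (quadOp (phaseOp d) (Matrix.fromBlocks 0 0 0 R) φ
          - quadOp (phaseOp d) (Matrix.fromBlocks 0 0 0 R') φ))
        (mulOp (fun η => ((W η : ℝ) : ℂ)) (toL2 d φ)
          - mulOp (fun η => ((W' η : ℝ) : ℂ)) (toL2 d φ)),
      Lp.coeFn_sub (mulOp (fun η => ((W η : ℝ) : ℂ)) (toL2 d φ))
        (mulOp (fun η => ((W' η : ℝ) : ℂ)) (toL2 d φ))] with η e1 e2 e3 e4 e5 e6 e7
    rw [e6, Pi.add_apply, e7, Pi.sub_apply, e1, e3, e4, e5, e2, sub_apply,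
      quadOp_fromBlocks_apply, quadOp_fromBlocks_apply, one_add_norm_sq_mul_eq]
    have e8 : ((4 * quadForm R η : ℝ) : ℂ) * φ η - ((4 * quadForm R' η : ℝ) : ℂ) * φ η
        + (((W η : ℝ) : ℂ) * φ η - ((W' η : ℝ) : ℂ) * φ η)
        = (((4 * quadForm R η + W η) - (4 * quadForm R' η + W' η) : ℝ) : ℂ) * φ η := by
      push_cast; ring
    rw [e8, norm_mul, norm_mul, Complex.norm_real, Complex.norm_real, Real.norm_eq_abs,
      Real.norm_of_nonneg (show (0 : ℝ) ≤ 1 + ‖η‖ ^ 2 by positivity), ← mul_assoc]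
    gcongr
    exact hW η
  have h1 : ‖r‖ ≤ ‖r - D‖ + ‖D‖ := by
    simpa using norm_add_le (r - D) D
  have h2 : δ * ‖toL2 d ψ‖ ≤ δ * (‖toL2 d φ‖ + d * N) := by gcongr
  have h3 : 0 ≤ δ * N := by positivity
  have h4 : 0 ≤ δ * (4 * d ^ 2 + d) * ‖toL2 d φ‖ := by positivity
  linarith

end Coercivity


/-! ### Bounds on compact time intervals -/

section LipschitzOn

variable {T : ℝ}

/-- `f` is Lipschitz continuous on `[0, T]` with some constant. -/
def IsLipOn (T : ℝ) (f : ℝ → ℝ) : Prop :=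
  ∃ K, 0 ≤ K ∧ ∀ s ∈ Icc 0 T, ∀ t ∈ Icc 0 T, |f s - f t| ≤ K * |s - t|

lemma exists_bound_of_continuousOn {ι : Type*} [Fintype ι] {f : ι → ℝ → ℝ}
    (h : ∀ i, ContinuousOn (f i) (Icc 0 T)) :
    ∃ K, 0 ≤ K ∧ ∀ t ∈ Icc 0 T, ∀ i, |f i t| ≤ K := by
  choose C hC using fun i => isCompact_Icc.exists_bound_of_continuousOn (h i)
  refine ⟨∑ i, |C i|, by positivity, fun t ht i => (hC i t ht).trans ((le_abs_self _).trans ?_)⟩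
  exact Finset.single_le_sum (f := fun i => |C i|) (fun _ _ => abs_nonneg _) (Finset.mem_univ i)

lemma exists_entry_bound {m n : Type*} [Fintype m] [Fintype n] {X : ℝ → Matrix m n ℝ}
    (h : ∀ i j, ContinuousOn (fun t => X t i j) (Icc 0 T)) :
    ∃ K, 0 ≤ K ∧ ∀ t ∈ Icc 0 T, ∀ i j, |X t i j| ≤ K := by
  obtain ⟨K, h1, h2⟩ := exists_bound_of_continuousOn (f := fun (ij : m × n) t => X t ij.1 ij.2)
    fun ij => h ij.1 ij.2
  exact ⟨K, h1, fun t ht i j => h2 t ht (i, j)⟩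

namespace IsLipOn

variable {f g f' : ℝ → ℝ}

lemma of_hasDerivWithinAt (h : ∀ t ∈ Icc 0 T, HasDerivWithinAt f (f' t) (Icc 0 T) t)
    (hc : ContinuousOn f' (Icc 0 T)) : IsLipOn T f := by
  obtain ⟨K, hK⟩ := isCompact_Icc.exists_bound_of_continuousOn hc
  refine ⟨|K|, abs_nonneg _, fun s hs t ht => ?_⟩
  exact (convex_Icc 0 T).norm_image_sub_le_of_norm_hasDerivWithin_le h
    (fun x hx => (hK x hx).trans (le_abs_self K)) ht hs

lemma const (c : ℝ) : IsLipOn T fun _ => c := ⟨0, le_rfl, by simp⟩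

lemma exists_bound (h : IsLipOn T f) : ∃ C, 0 ≤ C ∧ ∀ t ∈ Icc 0 T, |f t| ≤ C := by
  obtain ⟨K, hK0, hK⟩ := h
  refine ⟨|f 0| + K * |T|, by positivity, fun t ht => ?_⟩
  have h1 := hK t ht 0 ⟨le_rfl, ht.1.trans ht.2⟩
  have h2 : |f t| ≤ |f 0| + |f t - f 0| := by
    have := abs_add_le (f 0) (f t - f 0)
    rwa [add_sub_cancel] at this
  refine h2.trans (add_le_add le_rfl (h1.trans ?_))
  rw [sub_zero, abs_of_nonneg ht.1]
  gcongr
  exact ht.2.trans (le_abs_self T)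

lemma add (hf : IsLipOn T f) (hg : IsLipOn T g) : IsLipOn T fun t => f t + g t := by
  obtain ⟨K, hK0, hK⟩ := hf
  obtain ⟨L, hL0, hL⟩ := hg
  refine ⟨K + L, by positivity, fun s hs t ht => ?_⟩
  rw [add_sub_add_comm, add_mul]
  exact (abs_add_le _ _).trans (add_le_add (hK s hs t ht) (hL s hs t ht))

lemma mul (hf : IsLipOn T f) (hg : IsLipOn T g) : IsLipOn T fun t => f t * g t := by
  obtain ⟨C, hC0, hC⟩ := hf.exists_bound
  obtain ⟨D, hD0, hD⟩ := hg.exists_bound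
  obtain ⟨K, hK0, hK⟩ := hf
  obtain ⟨L, hL0, hL⟩ := hg
  refine ⟨K * D + C * L, by positivity, fun s hs t ht => ?_⟩
  rw [show f s * g s - f t * g t = (f s - f t) * g s + f t * (g s - g t) by ring]
  refine (abs_add_le _ _).trans ?_
  rw [abs_mul, abs_mul, add_mul]
  refine add_le_add ?_ ?_
  · calc |f s - f t| * |g s| ≤ (K * |s - t|) * D := by
          gcongr
          exacts [hK s hs t ht, hD s hs]
      _ = _ := by ring
  · calc |f t| * |g s - g t| ≤ C * (L * |s - t|) := by
          gcongr
          exacts [hC t ht, hL s hs t ht]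
      _ = _ := by ring

lemma sum {ι : Type*} {s : Finset ι} {f : ι → ℝ → ℝ} (h : ∀ i, IsLipOn T (f i)) :
    IsLipOn T fun t => ∑ i ∈ s, f i t := by
  classical
  induction s using Finset.induction_on with
  | empty => simpa using const 0
  | insert a s ha ih => simpa only [Finset.sum_insert ha] using (h a).add ih

lemma exists_common {m n : Type*} [Fintype m] [Fintype n] {X : ℝ → Matrix m n ℝ}
    (h : ∀ i j, IsLipOn T fun t => X t i j) :
    ∃ K, 0 ≤ K ∧ ∀ s ∈ Icc 0 T, ∀ t ∈ Icc 0 T, ∀ i j, |X s i j - X t i j| ≤ K * |s - t| := by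
  choose C hC0 hC using h
  refine ⟨∑ i, ∑ j, C i j, Finset.sum_nonneg fun i _ => Finset.sum_nonneg fun j _ => hC0 i j,
    fun s hs t ht i j => (hC i j s hs t ht).trans ?_⟩
  gcongr
  exact (Finset.single_le_sum (f := fun j => C i j) (fun j _ => hC0 i j)
    (Finset.mem_univ j)).trans (Finset.single_le_sum (f := fun i => ∑ j, C i j)
      (fun i _ => Finset.sum_nonneg fun j _ => hC0 i j) (Finset.mem_univ i))

end IsLipOn

lemma isLipOn_mul_apply {l m n : Type*} [Fintype m] {X : ℝ → Matrix l m ℝ}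
    {Y : ℝ → Matrix m n ℝ} (hX : ∀ i j, IsLipOn T fun t => X t i j)
    (hY : ∀ i j, IsLipOn T fun t => Y t i j) (i : l) (j : n) :
    IsLipOn T fun t => (X t * Y t) i j := by
  simp only [Matrix.mul_apply]
  exact IsLipOn.sum fun k => (hX i k).mul (hY k j)

lemma isLipOn_gaugeSymbol {d : ℕ} {A B : ℝ → Matrix (Fin d) (Fin d) ℝ}
    (hB : ∀ i j, IsLipOn T fun t => B t i j) (hA : ∀ i j, IsLipOn T fun t => A t i j)
    (a b : Fin d ⊕ Fin d) : IsLipOn T fun t => gaugeSymbol (B t) (A t) a b := by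
  have hK : ∀ i j, IsLipOn T fun t => (B t * (B t)ᵀ) i j :=
    isLipOn_mul_apply (Y := fun t => (B t)ᵀ) hB fun i j => hB j i
  have hM : ∀ i a, IsLipOn T fun t => shiftMatrix (A t) i a := fun i a => by
    rcases a with a | a
    · exact .const _
    · exact (IsLipOn.const (2 : ℝ)⁻¹).mul (hA i a)
  have h1 := isLipOn_mul_apply (isLipOn_mul_apply
    (X := fun t => (shiftMatrix (A t))ᵀ) (fun a i => hM i a) hK) hM a b
  have h2 : IsLipOn T fun t => Matrix.fromBlocks (0 : Matrix (Fin d) (Fin d) ℝ)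
      (0 : Matrix (Fin d) (Fin d) ℝ) (0 : Matrix (Fin d) (Fin d) ℝ)
      ((2 : ℝ)⁻¹ • (B t * (B t)ᵀ)) a b := by
    rcases a with a | a <;> rcases b with b | b
    · exact .const _
    · exact .const _
    · exact .const _
    · exact (IsLipOn.const (2 : ℝ)⁻¹).mul (hK a b)
  exact ((IsLipOn.const (2 : ℝ)⁻¹).mul h1).add h2

/-- Continuous functions on `[0, T]` have antiderivatives there that vanish at zero; equal functions
are given equal antiderivatives, which keeps symmetric matrices symmetric. -/
lemma exists_antiderivative {ι : Type*} (hT : 0 ≤ T) {f : ι → ℝ → ℝ}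
    (hf : ∀ i, ContinuousOn (f i) (Icc 0 T)) :
    ∃ F : ι → ℝ → ℝ, (∀ i, F i 0 = 0) ∧ (∀ i j, f i = f j → F i = F j) ∧
      ∀ i, ∀ t ∈ Icc 0 T, HasDerivWithinAt (F i) (f i t) (Icc 0 T) t := by
  refine ⟨fun i t => ∫ s in (0 : ℝ)..t, IccExtend hT ((Icc 0 T).domRestrict (f i)) s, by simp,
    fun i j hij => by simp only [hij], fun i t ht => ?_⟩
  have hc : Continuous (IccExtend hT ((Icc 0 T).domRestrict (f i))) :=
    (continuousOn_iff_continuous_domRestrict.1 (hf i)).Icc_extend'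
  have h1 := (hc.integral_hasStrictDerivAt 0 t).hasDerivAt.hasDerivWithinAt (s := Icc 0 T)
  rwa [IccExtend_of_mem hT _ ht] at h1

end LipschitzOn

/-! ### The total potential along the flow -/

section TotalPotential

variable {d : ℕ} {V : Space d → ℝ} {T : ℝ} {q p : ℝ → Space d}
  {α : ℝ → Matrix (Fin d) (Fin d) ℂ} {B : ℝ → Matrix (Fin d) (Fin d) ℝ}

/-- The first order Taylor remainder `ε⁻¹ (V (x + √ε y) - V x - √ε ∇V(x) y)`. In contrast to the
residual potential it is differentiable along the flow although the Hessian of `V` need not be. -/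
noncomputable def totalPotential (ε : ℝ) (V : Space d → ℝ) (x y : Space d) : ℝ :=
  ε⁻¹ * (V (x + √ε • y) - V x - √ε * fderiv ℝ V x y)

lemma totalPotential_eq (hV : ContDiff ℝ 2 V) {ε : ℝ} (hε : 0 < ε) (x : Space d)
    (b : Matrix (Fin d) (Fin d) ℝ) (η : Space d) :
    totalPotential ε V x (Matrix.toEuclideanCLM (𝕜 := ℝ) b⁻¹ η)
      = 4 * quadForm ((8 : ℝ)⁻¹ • ((b⁻¹)ᵀ * hessian V x * b⁻¹)) η
        + √ε * residualPotential ε V x b η := by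
  have h1 : quadForm ((b⁻¹)ᵀ * hessian V x * b⁻¹) η
      = quadForm (hessian V x) (Matrix.toEuclideanCLM (𝕜 := ℝ) b⁻¹ η) := by
    simp only [quadForm, Matrix.ofLp_toEuclideanCLM]
    rw [← Matrix.mulVec_mulVec, ← Matrix.mulVec_mulVec, Matrix.dotProduct_mulVec,
      Matrix.vecMul_transpose]
  have hs : √ε ^ 2 = ε := Real.sq_sqrt hε.le
  have h32 : ε ^ (3 / 2 : ℝ) = ε * √ε := by
    rw [Real.sqrt_eq_rpow, show (3 / 2 : ℝ) = 1 + 1 / 2 by norm_num, Real.rpow_add hε,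
      Real.rpow_one]
  have hs0 : √ε ≠ 0 := (Real.sqrt_pos.2 hε).ne'
  rw [quadForm_smul, h1, quadForm_hessian hV, residualPotential_eq hV, totalPotential, h32]
  field_simp
  ring

lemma fderiv_fderiv_eq_sum (x u v : Space d) :
    fderiv ℝ (fderiv ℝ V) x u v = ∑ i, ∑ j, hessian V x i j * (u i * v j) := by
  have h : ∀ y : Space d, y = ∑ i, y i • EuclideanSpace.single i (1 : ℝ) := fun y => by
    ext j; simp [Finset.sum_apply, Pi.single_apply]
  conv_lhs => rw [h u, h v]
  simp only [map_sum, map_smul, sum_apply, smul_apply, smul_eq_mul, hessian, Matrix.of_apply,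
    Finset.mul_sum]
  rw [Finset.sum_comm]
  exact Finset.sum_congr rfl fun i _ => Finset.sum_congr rfl fun j _ => by ring

lemma abs_fderiv_fderiv_le {x : Space d} {κ : ℝ} (hκ : 0 ≤ κ) (h : ∀ i j, |hessian V x i j| ≤ κ)
    (u v : Space d) : |fderiv ℝ (fderiv ℝ V) x u v| ≤ d ^ 2 * κ * (‖u‖ * ‖v‖) := by
  rw [fderiv_fderiv_eq_sum]
  calc |∑ i, ∑ j, hessian V x i j * (u i * v j)| ≤ ∑ _i : Fin d, ∑ _j : Fin d, κ * (‖u‖ * ‖v‖) := by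
        refine (Finset.abs_sum_le_sum_abs _ _).trans (Finset.sum_le_sum fun i _ => ?_)
        refine (Finset.abs_sum_le_sum_abs _ _).trans (Finset.sum_le_sum fun j _ => ?_)
        rw [abs_mul, abs_mul]
        exact mul_le_mul (h i j) (mul_le_mul (PiLp.norm_apply_le u i) (PiLp.norm_apply_le v j)
          (abs_nonneg _) (norm_nonneg _)) (by positivity) hκ
    _ = _ := by simp; ring

lemma norm_toEuclideanCLM_le {X : Matrix (Fin d) (Fin d) ℝ} {κ : ℝ} (hκ : 0 ≤ κ)
    (h : ∀ i j, |X i j| ≤ κ) (v : Space d) :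
    ‖Matrix.toEuclideanCLM (𝕜 := ℝ) X v‖ ≤ d ^ 2 * κ * ‖v‖ := by
  refine (norm_le_sum_norm_apply _).trans ?_
  calc ∑ i, ‖Matrix.toEuclideanCLM (𝕜 := ℝ) X v i‖ ≤ ∑ _i : Fin d, ∑ _j : Fin d, κ * ‖v‖ := by
        refine Finset.sum_le_sum fun i _ => ?_
        rw [Matrix.ofLp_toEuclideanCLM]
        simp only [Matrix.mulVec, dotProduct]
        refine (norm_sum_le _ _).trans (Finset.sum_le_sum fun j _ => ?_)
        rw [norm_mul]
        exact mul_le_mul (h i j) (PiLp.norm_apply_le v j) (norm_nonneg _) hκ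
    _ = _ := by simp; ring

lemma hasDerivWithinAt_totalPotential (hV : ContDiff ℝ 2 V) {ε : ℝ} (hε : 0 < ε) {s : Set ℝ}
    {x y : ℝ → Space d} {x' y' : Space d} {t : ℝ} (hx : HasDerivWithinAt x x' s t)
    (hy : HasDerivWithinAt y y' s t) :
    HasDerivWithinAt (fun r => totalPotential ε V (x r) (y r))
      ((ε⁻¹ • (fderiv ℝ V (x t + √ε • y t) - fderiv ℝ V (x t)
          - √ε • fderiv ℝ (fderiv ℝ V) (x t) (y t))) (x' + √ε • y')
        + fderiv ℝ (fderiv ℝ V) (x t) (y t) y') s t := by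
  have hV1 : Differentiable ℝ V := hV.differentiable (by simp)
  have hV2 : Differentiable ℝ (fderiv ℝ V) :=
    (hV.fderiv_right (m := 1) (by norm_num)).differentiable (by simp)
  have h1 := (hV1 (x t + √ε • y t)).hasFDerivAt.comp_hasDerivWithinAt t
    (hx.add (hy.const_smul √ε))
  have h2 := (hV1 (x t)).hasFDerivAt.comp_hasDerivWithinAt t hx
  have h3 := ((hV2 (x t)).hasFDerivAt.comp_hasDerivWithinAt t hx).clm_apply hy
  have h4 := ((h1.sub h2).sub (h3.const_mul √ε)).const_mul ε⁻¹
  refine h4.congr_deriv ?_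
  have hs : √ε ^ 2 = ε := Real.sq_sqrt hε.le
  have hsym : fderiv ℝ (fderiv ℝ V) (x t) x' (y t) = fderiv ℝ (fderiv ℝ V) (x t) (y t) x' :=
    (hV.contDiffAt (x := x t)).isSymmSndFDerivAt (by simp) _ _
  simp only [sub_apply, smul_apply, smul_eq_mul, map_add, map_smul, hsym, Function.comp_apply]
  field_simp
  linear_combination fderiv ℝ (fderiv ℝ V) (x t) (y t) y' * hs

namespace IsGWPTFlow

/-- The total potential is Lipschitz in time with a constant of quadratic growth: its time
derivative is a directional derivative of the residual potential plus a quadratic form. -/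
lemma abs_totalPotential_sub_le (h : IsGWPTFlow V T q p α B) (hV : ContDiff ℝ 2 V) {ε : ℝ}
    (hε : 0 < ε) (hε1 : ε ≤ 1) {C C' : ℝ → Matrix (Fin d) (Fin d) ℝ} {κ M : ℝ} (hκ : 0 ≤ κ)
    (hM0 : 0 ≤ M) (hC : ∀ t ∈ Icc 0 T, B t * C t = 1)
    (hC' : ∀ t ∈ Icc 0 T, ∀ i j, HasDerivWithinAt (fun s => C s i j) (C' t i j) (Icc 0 T) t)
    (kB : ∀ t ∈ Icc 0 T, ∀ i j, |B t i j| ≤ κ) (kC : ∀ t ∈ Icc 0 T, ∀ i j, |C t i j| ≤ κ)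
    (kC' : ∀ t ∈ Icc 0 T, ∀ i j, |C' t i j| ≤ κ) (kp : ∀ t ∈ Icc 0 T, ‖p t‖ ≤ κ)
    (kS : ∀ t ∈ Icc 0 T, ∀ i j, |hessian V (q t) i j| ≤ κ)
    (hM : ∀ t ∈ Icc 0 T, ∀ η, ‖gradient (residualPotential ε V (q t) (B t)) η‖ ≤ M)
    {s t : ℝ} (hs : s ∈ Icc 0 T) (ht : t ∈ Icc 0 T) (η : Space d) :
    |totalPotential ε V (q s) (Matrix.toEuclideanCLM (𝕜 := ℝ) (B s)⁻¹ η)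
      - totalPotential ε V (q t) (Matrix.toEuclideanCLM (𝕜 := ℝ) (B t)⁻¹ η)|
      ≤ (M * (d ^ 2 * κ * (κ + d ^ 2 * κ)) + d ^ 2 * κ * (d ^ 2 * κ) ^ 2) * |s - t|
        * (1 + ‖η‖ ^ 2) := by
  have hinv : ∀ r ∈ Icc 0 T, (B r)⁻¹ = C r := fun r hr => Matrix.inv_eq_right_inv (hC r hr)
  set y : ℝ → Space d := fun r => Matrix.toEuclideanCLM (𝕜 := ℝ) (C r) η
  set y' : ℝ → Space d := fun r => Matrix.toEuclideanCLM (𝕜 := ℝ) (C' r) η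
  have hy : ∀ r ∈ Icc 0 T, HasDerivWithinAt y (y' r) (Icc 0 T) r := fun r hr => by
    have h1 : HasDerivWithinAt (fun r => C r *ᵥ η.ofLp) (C' r *ᵥ η.ofLp) (Icc 0 T) r :=
      hasDerivWithinAt_pi.2 fun i => by
        simp only [Matrix.mulVec, dotProduct]
        exact HasDerivWithinAt.fun_sum fun k _ => (hC' r hr i k).mul_const _
    exact (PiLp.continuousLinearEquiv 2 ℝ fun _ : Fin d => ℝ).symm.hasFDerivAt.comp_hasDerivWithinAt
      r h1
  rw [hinv s hs, hinv t ht]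
  have hη : ‖η‖ ≤ 1 + ‖η‖ ^ 2 := by nlinarith [sq_nonneg (‖η‖ - 1)]
  have hη0 := norm_nonneg η
  have key := (convex_Icc 0 T).norm_image_sub_le_of_norm_hasDerivWithin_le
    (f := fun r => totalPotential ε V (q r) (y r))
    (C := (M * (d ^ 2 * κ * (κ + d ^ 2 * κ)) + d ^ 2 * κ * (d ^ 2 * κ) ^ 2) * (1 + ‖η‖ ^ 2))
    (fun r hr => hasDerivWithinAt_totalPotential hV hε (h.deriv_q r hr) (hy r hr))
    (fun r hr => ?_) ht hs
  · rw [mul_right_comm]; exact key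
  have ny : ‖y r‖ ≤ d ^ 2 * κ * ‖η‖ := norm_toEuclideanCLM_le hκ (kC r hr) η
  have ny' : ‖y' r‖ ≤ d ^ 2 * κ * ‖η‖ := norm_toEuclideanCLM_le hκ (kC' r hr) η
  set z : Space d := p r + √ε • y' r
  have nz : ‖z‖ ≤ (κ + d ^ 2 * κ) * (1 + ‖η‖ ^ 2) := by
    calc ‖z‖ ≤ ‖p r‖ + ‖√ε • y' r‖ := norm_add_le _ _
      _ ≤ κ + 1 * (d ^ 2 * κ * ‖η‖) := by
          rw [norm_smul, Real.norm_of_nonneg (Real.sqrt_nonneg ε)]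
          gcongr
          exacts [kp r hr, Real.sqrt_le_one.2 hε1]
      _ ≤ κ * (1 + ‖η‖ ^ 2) + d ^ 2 * κ * (1 + ‖η‖ ^ 2) := by
          rw [one_mul]
          gcongr
          exact le_mul_of_one_le_right hκ (by nlinarith)
      _ = _ := by ring
  -- the first term is the derivative of the residual potential in the direction `B z`
  have e1 : (ε⁻¹ • (fderiv ℝ V (q r + √ε • y r) - fderiv ℝ V (q r)
          - √ε • fderiv ℝ (fderiv ℝ V) (q r) (y r))) z
      = fderiv ℝ (residualPotential ε V (q r) (B r)) η
        (Matrix.toEuclideanCLM (𝕜 := ℝ) (B r) z) := by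
    rw [(hasFDerivAt_residualPotential hV hε (q r) (B r) η).fderiv, hinv r hr]
    have e2 : Matrix.toEuclideanCLM (𝕜 := ℝ) (C r)
        (Matrix.toEuclideanCLM (𝕜 := ℝ) (B r) z) = z := by
      rw [← mul_apply_eq_comp, ← map_mul, mul_eq_one_comm.1 (hC r hr), map_one]
      rfl
    rw [smul_apply, smul_apply, ContinuousLinearMap.comp_apply, e2]
  rw [e1]
  refine (norm_add_le _ _).trans ?_
  rw [add_mul]
  refine add_le_add ?_ ?_
  · calc _ ≤ ‖gradient (residualPotential ε V (q r) (B r)) η‖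
          * ‖Matrix.toEuclideanCLM (𝕜 := ℝ) (B r) z‖ := abs_fderiv_le_norm_gradient _ _ _
      _ ≤ M * (d ^ 2 * κ * ((κ + d ^ 2 * κ) * (1 + ‖η‖ ^ 2))) := by
          gcongr
          · exact hM r hr η
          · exact (norm_toEuclideanCLM_le hκ (kB r hr) z).trans (by gcongr)
      _ = _ := by ring
  · calc _ ≤ d ^ 2 * κ * (‖y r‖ * ‖y' r‖) := abs_fderiv_fderiv_le hκ (kS r hr) _ _
      _ ≤ d ^ 2 * κ * ((d ^ 2 * κ * ‖η‖) * (d ^ 2 * κ * ‖η‖)) := by gcongr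
      _ = d ^ 2 * κ * (d ^ 2 * κ) ^ 2 * ‖η‖ ^ 2 := by ring
      _ ≤ _ := by gcongr; linarith

end IsGWPTFlow

end TotalPotential


/-! ### Second order bounds for elliptic Hamiltonians -/

section Elliptic

open Filter Topology

variable {d : ℕ} {T M : ℝ} {G : ℝ → Matrix (Fin d ⊕ Fin d) (Fin d ⊕ Fin d) ℝ}
  {W : ℝ → Space d → ℝ} {w : ℝ → Lp ℂ 2 (volume : Measure (Space d))}

lemma IsRegularHamiltonian.norm_fullOp_le (hR : IsRegularHamiltonian T M G W) {Γ : ℝ}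
    (hΓ : ∀ t ∈ Icc 0 T, ∀ a b, |G t a b| ≤ Γ) {t : ℝ} (ht : t ∈ Icc 0 T) (φ : 𝓢(Space d, ℂ)) :
    ‖fullOp (G t) (W t) φ‖
      ≤ (2 * d) ^ 2 * Γ * norm₂ (toL2 d) (phaseOp d) φ + M * ‖toL2 d φ‖ := by
  rw [fullOp_apply]
  refine (norm_add_le _ _).trans (add_le_add ((norm_quadOp_le _ _).trans ?_)
    (hR.norm_mulOp_le ht _))
  refine mul_le_mul_of_nonneg_right ?_ (norm₂_nonneg _)
  calc ∑ a, ∑ b, |G t a b| ≤ ∑ _a : Fin d ⊕ Fin d, ∑ _b : Fin d ⊕ Fin d, Γ :=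
        Finset.sum_le_sum fun a _ => Finset.sum_le_sum fun b _ => hΓ t ht a b
    _ = _ := by simp; ring

lemma norm_galerkinResidual_le_norm_fullOp {n : ℕ} (G : Matrix (Fin d ⊕ Fin d) (Fin d ⊕ Fin d) ℝ)
    (W : Space d → ℝ) (x : hermiteL2 d n) :
    ‖galerkinResidual n G W x‖ ≤ ‖fullOp G W (hermiteRep d n x)‖ :=
  norm_sub_starProjection_le n _

lemma norm_galerkinOp_le {n : ℕ} (G : Matrix (Fin d ⊕ Fin d) (Fin d ⊕ Fin d) ℝ)
    (W : Space d → ℝ) (x : hermiteL2 d n) :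
    ‖galerkinOp n G W x‖ ≤ ‖fullOp G W (hermiteRep d n x)‖ :=
  (hermiteL2 d n).norm_orthogonalProjectionOnto_apply_le _

lemma norm_galerkinOp_sub_le {n : ℕ} (G G' : Matrix (Fin d ⊕ Fin d) (Fin d ⊕ Fin d) ℝ)
    (W W' : Space d → ℝ) (x : hermiteL2 d n) :
    ‖galerkinOp n G W x - galerkinOp n G' W' x‖
      ≤ ‖fullOp G W (hermiteRep d n x) - fullOp G' W' (hermiteRep d n x)‖ := by
  rw [galerkinOp_apply, galerkinOp_apply, ← map_sub]
  exact (hermiteL2 d n).norm_orthogonalProjectionOnto_apply_le _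

/-- The graph norm of the Galerkin solutions of an elliptic Hamiltonian, Lipschitz in time,
propagates, and by ellipticity it controls all operators of second order. -/
lemma IsRegularHamiltonian.norm₂_galerkin_le (hR : IsRegularHamiltonian T M G W) (hT : 0 ≤ T)
    {K Λ Γ c : ℝ} (hK0 : 0 ≤ K) (hΛ0 : 0 ≤ Λ) (hΓ0 : 0 ≤ Γ)
    {n : ℕ} (hK : ∀ t ∈ Icc 0 T, ∀ x : hermiteL2 d n,
      norm₂ (toL2 d) (phaseOp d) (hermiteRep d n x) ≤ K * (‖galerkinOp n (G t) (W t) x‖ + ‖x‖))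
    (hΛ : ∀ s ∈ Icc 0 T, ∀ t ∈ Icc 0 T, ∀ φ, ‖fullOp (G s) (W s) φ - fullOp (G t) (W t) φ‖
      ≤ Λ * |s - t| * (norm₂ (toL2 d) (phaseOp d) φ + ‖toL2 d φ‖))
    (hΓ : ∀ t ∈ Icc 0 T, ∀ a b, |G t a b| ≤ Γ) {u : ℝ → hermiteL2 d n}
    (hu : IsSchrodingerCurve T (fun t => galerkinOp n (G t) (W t)) u)
    (hc : norm₂ (toL2 d) (phaseOp d) (hermiteRep d n (u 0)) ≤ c * ‖u 0‖) {t : ℝ}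
    (ht : t ∈ Icc 0 T) :
    norm₂ (toL2 d) (phaseOp d) (hermiteRep d n (u t))
      ≤ K * (√((((2 * d) ^ 2 * Γ * c + M) ^ 2 + 1) * Real.exp (3 * (Λ * (K + 1)) * T)) + 1)
        * ‖u 0‖ := by
  have h0T : (0 : ℝ) ∈ Icc 0 T := ⟨le_rfl, hT⟩
  have hlip : ∀ s ∈ Icc 0 T, ∀ t ∈ Icc 0 T, ∀ x : hermiteL2 d n,
      ‖galerkinOp n (G s) (W s) x - galerkinOp n (G t) (W t) x‖
        ≤ Λ * (K + 1) * |s - t| * (‖galerkinOp n (G s) (W s) x‖ + ‖x‖) := fun s hs t ht x => by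
    have h1 := (norm_galerkinOp_sub_le (G s) (G t) (W s) (W t) x).trans (hΛ s hs t ht _)
    rw [norm_toL2_hermiteRep] at h1
    have h2 := hK s hs x
    have h3 : norm₂ (toL2 d) (phaseOp d) (hermiteRep d n x) + ‖x‖
        ≤ (K + 1) * (‖galerkinOp n (G s) (W s) x‖ + ‖x‖) := by
      have := norm_nonneg (galerkinOp n (G s) (W s) x)
      linarith
    calc _ ≤ _ := h1
      _ ≤ Λ * |s - t| * ((K + 1) * (‖galerkinOp n (G s) (W s) x‖ + ‖x‖)) := by gcongr
      _ = _ := by ring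
  have h1 := hu.graphNorm_le hT (hR.continuousOn_galerkinOp n)
    (fun s hs => hR.symm_galerkinOp n hs) (C := Λ * (K + 1)) (by positivity) hlip ht
  have hnorm : ‖u t‖ = ‖u 0‖ := hu.norm_eq (fun s hs => hR.symm_galerkinOp n hs) ht h0T
  have h2 : ‖galerkinOp n (G 0) (W 0) (u 0)‖ ≤ ((2 * d) ^ 2 * Γ * c + M) * ‖u 0‖ := by
    refine (norm_galerkinOp_le _ _ _).trans ((hR.norm_fullOp_le hΓ h0T _).trans ?_)
    rw [norm_toL2_hermiteRep, add_mul]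
    refine add_le_add ?_ le_rfl
    rw [mul_assoc _ c]
    gcongr
  have h3 : ‖galerkinOp n (G t) (W t) (u t)‖
      ≤ √((((2 * d) ^ 2 * Γ * c + M) ^ 2 + 1) * Real.exp (3 * (Λ * (K + 1)) * T)) * ‖u 0‖ := by
    conv_rhs => rw [← Real.sqrt_sq (norm_nonneg (u 0))]
    rw [← Real.sqrt_mul (by positivity)]
    refine Real.le_sqrt_of_sq_le ?_
    calc _ ≤ _ := le_add_of_nonneg_right (sq_nonneg ‖u 0‖)
      _ ≤ _ := h1
      _ ≤ ((((2 * d) ^ 2 * Γ * c + M) * ‖u 0‖) ^ 2 + ‖u 0‖ ^ 2)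
          * Real.exp (3 * (Λ * (K + 1)) * T) := by
        gcongr
        exact ht.2
      _ = _ := by ring
  have h4 := hK t ht (u t)
  rw [hnorm] at h4
  refine h4.trans ?_
  rw [mul_assoc, add_mul, one_mul]
  gcongr

/-- A weak solution whose Galerkin approximations have second order bounds is a limit of Schwartz
functions with these bounds. -/
lemma IsWeakSolution.exists_tendsto_norm₂ (h : IsWeakSolution T G W w)
    (hR : IsRegularHamiltonian T M G W) (hT : 0 ≤ T) {Γ c Q : ℝ} (hΓ0 : 0 ≤ Γ)
    (hΓ : ∀ t ∈ Icc 0 T, ∀ a b, |G t a b| ≤ Γ)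
    (hQ : ∀ n, ∀ u : ℝ → hermiteL2 d n, IsSchrodingerCurve T (fun t => galerkinOp n (G t) (W t)) u →
      norm₂ (toL2 d) (phaseOp d) (hermiteRep d n (u 0)) ≤ c * ‖u 0‖ →
      ∀ t ∈ Icc 0 T, norm₂ (toL2 d) (phaseOp d) (hermiteRep d n (u t)) ≤ Q * ‖u 0‖)
    (h0 : w 0 ∈ hermiteL2 d 0)
    (hc : ∀ φ, toL2 d φ = w 0 → norm₂ (toL2 d) (phaseOp d) φ ≤ c * ‖w 0‖)
    (hw : ∀ t ∈ Icc 0 T, ‖w t‖ ≤ ‖w 0‖) {t : ℝ} (ht : t ∈ Icc 0 T) :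
    ∃ z : ℕ → 𝓢(Space d, ℂ), Tendsto (fun n => toL2 d (z n)) atTop (𝓝 (w t)) ∧
      ∀ n, ‖toL2 d (z n)‖ = ‖w 0‖ ∧ norm₂ (toL2 d) (phaseOp d) (z n) ≤ Q * ‖w 0‖ := by
  obtain ⟨u, hu, hu0⟩ := IsWeakSolution.exists_galerkin h0 hR hT
  have h0T : (0 : ℝ) ∈ Icc 0 T := ⟨le_rfl, hT⟩
  have hn0 : ∀ n, ‖u n 0‖ = ‖w 0‖ := fun n => by
    rw [← norm_toL2_hermiteRep, toL2_hermiteRep, hu0 n]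
  have hnorm : ∀ n, ∀ s ∈ Icc 0 T, ‖toL2 d (hermiteRep d n (u n s))‖ = ‖w 0‖ := fun n s hs => by
    rw [norm_toL2_hermiteRep, (hu n).norm_eq (fun s hs => hR.symm_galerkinOp n hs) hs h0T, hn0 n]
  have h2 : ∀ n, ∀ s ∈ Icc 0 T,
      norm₂ (toL2 d) (phaseOp d) (hermiteRep d n (u n s)) ≤ Q * ‖w 0‖ := fun n s hs => by
    have h3 := hc (hermiteRep d n (u n 0)) (by rw [toL2_hermiteRep, hu0 n])
    rw [← hn0 n] at h3 ⊢
    exact hQ n (u n) (hu n) h3 s hs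
  have hD : ∀ n, ∀ s ∈ Icc 0 T, ‖galerkinResidual n (G s) (W s) (u n s)‖
      ≤ (2 * d) ^ 2 * Γ * (Q * ‖w 0‖) + M * ‖w 0‖ := fun n s hs => by
    refine (norm_galerkinResidual_le_norm_fullOp _ _ _).trans
      ((hR.norm_fullOp_le hΓ hs _).trans ?_)
    rw [hnorm n s hs]
    gcongr
    exact h2 n s hs
  have hlim := h.tendsto_galerkin hR hu hu0 hD hw ht
  exact ⟨fun n => hermiteRep d n (u n t), by simpa only [toL2_hermiteRep] using hlim,
    fun n => ⟨hnorm n t ht, h2 n t ht⟩⟩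

/-- The first order operators are controlled by the norm and the second order operators. -/
lemma norm_phaseOp_sq_le (a : Fin d ⊕ Fin d) (φ : 𝓢(Space d, ℂ)) :
    ‖toL2 d (phaseOp d a φ)‖ ^ 2
      ≤ ‖toL2 d φ‖ * (√(2 * d) * norm₂ (toL2 d) (phaseOp d) φ) := by
  have hcard : (Fintype.card (Fin d ⊕ Fin d) : ℝ) = 2 * d := by
    rw [Fintype.card_sum, Fintype.card_fin]; push_cast; ring
  have h1 := IsCCR.norm_oscillator_le (ι := toL2 d) (X := phaseOp d) φ
  rw [hcard] at h1
  calc _ ≤ ∑ a, ‖toL2 d (phaseOp d a φ)‖ ^ 2 :=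
        Finset.single_le_sum (f := fun a => ‖toL2 d (phaseOp d a φ)‖ ^ 2)
          (fun _ _ => by positivity) (Finset.mem_univ a)
    _ ≤ _ := (isCCR_phaseOp d).sum_norm_sq_le φ
    _ ≤ _ := by gcongr

lemma norm_shifted_momentum_le {A : Matrix (Fin d) (Fin d) ℝ} {κ S : ℝ} (hκ : ∀ i j, |A i j| ≤ κ)
    {f : Fin d ⊕ Fin d → 𝓢(Space d, ℂ)} (hS : ∀ a, ‖toL2 d (f a)‖ ≤ S) (k : Fin d) :
    ‖toL2 d (f (Sum.inl k) + ∑ j, ((A k j / 2 : ℝ) : ℂ) • f (Sum.inr j))‖ ≤ (1 + d * κ) * S := by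
  rw [map_add, map_sum]
  have h1 : ∀ j, ‖toL2 d (((A k j / 2 : ℝ) : ℂ) • f (Sum.inr j))‖ ≤ κ * S := fun j => by
    rw [map_smul, norm_smul, Complex.norm_real, Real.norm_eq_abs, abs_div, abs_two]
    have := hκ k j
    have h0 := abs_nonneg (A k j)
    exact mul_le_mul (by linarith) (hS _) (norm_nonneg _) (h0.trans this)
  refine (norm_add_le _ _).trans ?_
  rw [add_mul, one_mul]
  refine add_le_add (hS _) ((norm_sum_le _ _).trans ((Finset.sum_le_sum fun j _ => h1 j).trans ?_))
  simp [mul_assoc]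

lemma norm_phaseOp_phaseMul_le {A : Matrix (Fin d) (Fin d) ℝ} (hA : A.IsSymm) {κ S : ℝ}
    (hκ0 : 0 ≤ κ) (hκ : ∀ i j, |A i j| ≤ κ) {φ : 𝓢(Space d, ℂ)}
    (hS : ∀ a, ‖toL2 d (phaseOp d a φ)‖ ≤ S) (a : Fin d ⊕ Fin d) :
    ‖toL2 d (phaseOp d a (phaseMul A φ))‖ ≤ (1 + d * κ) * S := by
  rcases a with k | k
  · rw [phaseOp_inl_phaseMul hA, norm_toL2_phaseMul]
    exact norm_shifted_momentum_le hκ (f := fun a => phaseOp d a φ) hS k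
  · rw [phaseOp_inr_phaseMul, norm_toL2_phaseMul]
    exact (hS _).trans (le_mul_of_one_le_left ((norm_nonneg _).trans (hS (Sum.inr k)))
      (le_add_of_nonneg_right (by positivity)))

lemma norm_position_momentum_phaseMul_le {A : Matrix (Fin d) (Fin d) ℝ} (hA : A.IsSymm) {κ : ℝ}
    (hκ : ∀ i j, |A i j| ≤ κ) (φ : 𝓢(Space d, ℂ)) (k j : Fin d) :
    ‖toL2 d (phaseOp d (Sum.inr k) (phaseOp d (Sum.inl j) (phaseMul A φ)))‖
      ≤ (1 + d * κ) * norm₂ (toL2 d) (phaseOp d) φ := by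
  rw [phaseOp_inl_phaseMul hA, phaseOp_inr_phaseMul, norm_toL2_phaseMul, map_add, map_sum]
  simp only [map_smul]
  exact norm_shifted_momentum_le hκ (f := fun a => phaseOp d (Sum.inr k) (phaseOp d a φ))
    (fun a => norm_le_norm₂ _ _ φ) j

end Elliptic


/-! ### A gauge that makes the quadratic Hamiltonian elliptic -/

section EllipticGauge

variable {d : ℕ} {T : ℝ}

/-- The time derivative of the matrix of the phase: the Hessian `S` in the coordinates `C = B⁻¹`, shifted by a
multiple of the identity. -/
def gaugeRate (μ : ℝ) (S C : Matrix (Fin d) (Fin d) ℝ) : Matrix (Fin d) (Fin d) ℝ :=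
  μ • (1 : Matrix (Fin d) (Fin d) ℝ) + Cᵀ * S * C

/-- The symbol of the Hamiltonian in the gauge with phase `A`. -/
noncomputable abbrev ellipticSymbol (μ : ℝ) (B A S C : Matrix (Fin d) (Fin d) ℝ) :
    Matrix (Fin d ⊕ Fin d) (Fin d ⊕ Fin d) ℝ :=
  gaugeSymbol B A + Matrix.fromBlocks 0 0 0 ((8 : ℝ)⁻¹ • gaugeRate μ S C)

lemma isSymm_gaugeRate (μ : ℝ) {S : Matrix (Fin d) (Fin d) ℝ} (hS : S.IsSymm)
    (C : Matrix (Fin d) (Fin d) ℝ) : (gaugeRate μ S C).IsSymm := by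
  rw [Matrix.IsSymm, gaugeRate, Matrix.transpose_add, Matrix.transpose_smul, Matrix.transpose_one,
    Matrix.transpose_mul, Matrix.transpose_mul, Matrix.transpose_transpose, hS.eq,
    Matrix.mul_assoc]

/-- The shift by `μ` makes the rate of the gauge positive definite. -/
lemma le_re_sum_gaugeRate {H : Type*} [NormedAddCommGroup H] [InnerProductSpace ℂ H] {ν : ℝ}
    {S C : Matrix (Fin d) (Fin d) ℝ} (h : ∀ i j, |(Cᵀ * S * C) i j| ≤ ν) (v : Fin d → H) :
    ∑ k, ‖v k‖ ^ 2 ≤ (∑ k, ∑ l, ((((8 : ℝ)⁻¹ • gaugeRate (8 + d * ν) S C :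
      Matrix (Fin d) (Fin d) ℝ) k l : ℝ) : ℂ) * inner ℂ (v k) (v l)).re := by
  have e1 : ∑ k, ∑ l, ((((8 : ℝ)⁻¹ • gaugeRate (8 + d * ν) S C :
      Matrix (Fin d) (Fin d) ℝ) k l : ℝ) : ℂ) * inner ℂ (v k) (v l)
      = (((8 : ℝ)⁻¹ * (8 + d * ν) * ∑ k, ‖v k‖ ^ 2 : ℝ) : ℂ)
        + (8 : ℂ)⁻¹ * ∑ k, ∑ l, (((Cᵀ * S * C) k l : ℝ) : ℂ) * inner ℂ (v k) (v l) := by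
    push_cast
    rw [Finset.mul_sum, Finset.mul_sum, ← Finset.sum_add_distrib]
    refine Finset.sum_congr rfl fun k _ => ?_
    rw [Finset.mul_sum]
    have h1 : ∀ l, ((((8 : ℝ)⁻¹ • gaugeRate (8 + d * ν) S C :
        Matrix (Fin d) (Fin d) ℝ) k l : ℝ) : ℂ) * inner ℂ (v k) (v l)
        = (if k = l then (8 : ℂ)⁻¹ * (8 + d * ν) * inner ℂ (v k) (v l) else 0)
          + (8 : ℂ)⁻¹ * ((((Cᵀ * S * C) k l : ℝ) : ℂ) * inner ℂ (v k) (v l)) := fun l => by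
      rw [Matrix.smul_apply, gaugeRate, Matrix.add_apply, Matrix.smul_apply, Matrix.one_apply]
      split_ifs <;> simp <;> ring
    rw [Finset.sum_congr rfl fun l _ => h1 l, Finset.sum_add_distrib, Finset.sum_ite_eq,
      if_pos (Finset.mem_univ k)]
    have h2 := inner_self_eq_norm_sq_to_K (𝕜 := ℂ) (v k)
    rw [h2]
    rfl
  have e2 : ‖∑ k, ∑ l, (((Cᵀ * S * C) k l : ℝ) : ℂ) * inner ℂ (v k) (v l)‖
      ≤ d * ν * ∑ k, ‖v k‖ ^ 2 := by
    calc _ ≤ ∑ k, ∑ l, ν * ((‖v k‖ ^ 2 + ‖v l‖ ^ 2) / 2) := by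
          refine (norm_sum_le _ _).trans (Finset.sum_le_sum fun k _ => ?_)
          refine (norm_sum_le _ _).trans (Finset.sum_le_sum fun l _ => ?_)
          rw [norm_mul, Complex.norm_real, Real.norm_eq_abs]
          refine mul_le_mul (h k l) ((norm_inner_le_norm _ _).trans ?_) (norm_nonneg _)
            ((abs_nonneg _).trans (h k l))
          nlinarith [sq_nonneg (‖v k‖ - ‖v l‖)]
      _ = _ := by
          simp only [← Finset.mul_sum, Finset.sum_add_distrib, ← Finset.sum_div, Finset.sum_const,
            Finset.card_univ, Fintype.card_fin, nsmul_eq_mul]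
          ring
  have e3 := (abs_le.1 ((Complex.abs_re_le_norm _).trans e2)).1
  rw [e1, Complex.add_re, Complex.ofReal_re,
    show (8 : ℂ)⁻¹ = (((8 : ℝ)⁻¹ : ℝ) : ℂ) by push_cast; rfl, Complex.re_ofReal_mul]
  linarith

/-- A phase `A` whose rate is adapted to the Hessian `S` along a trajectory, together with the
inverse `C` of `B`, its derivative `C'`, a bound `κ` for the data and a bound `ν` for the Hessian in
the coordinates `B⁻¹`, which fixes the shift in the rate. -/
structure IsEllipticGauge (T κ ν : ℝ) (p : ℝ → Space d)
    (B C C' A S : ℝ → Matrix (Fin d) (Fin d) ℝ) : Prop where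
  nonneg : 0 ≤ κ
  mul_eq_one : ∀ t ∈ Icc 0 T, B t * C t = 1
  deriv_C : ∀ t ∈ Icc 0 T, ∀ i j, HasDerivWithinAt (fun s => C s i j) (C' t i j) (Icc 0 T) t
  zero : A 0 = 0
  symm : ∀ t, (A t).IsSymm
  symm_S : ∀ t, (S t).IsSymm
  deriv_A : ∀ t ∈ Icc 0 T, ∀ i j, HasDerivWithinAt (fun s => A s i j)
    (gaugeRate (8 + d * ν) (S t) (C t) i j) (Icc 0 T) t
  bound_B : ∀ t ∈ Icc 0 T, ∀ i j, |B t i j| ≤ κ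
  bound_C : ∀ t ∈ Icc 0 T, ∀ i j, |C t i j| ≤ κ
  bound_C' : ∀ t ∈ Icc 0 T, ∀ i j, |C' t i j| ≤ κ
  bound_p : ∀ t ∈ Icc 0 T, ‖p t‖ ≤ κ
  bound_S : ∀ t ∈ Icc 0 T, ∀ i j, |S t i j| ≤ κ
  bound_A : ∀ t ∈ Icc 0 T, ∀ i j, |A t i j| ≤ κ
  bound_rate : ∀ t ∈ Icc 0 T, ∀ i j, |((C t)ᵀ * S t * C t) i j| ≤ ν
  bound_symbol : ∀ t ∈ Icc 0 T, ∀ a b,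
    |ellipticSymbol (8 + d * ν) (B t) (A t) (S t) (C t) a b| ≤ κ
  continuousOn_symbol : ∀ a b, ContinuousOn (fun t =>
    ellipticSymbol (8 + d * ν) (B t) (A t) (S t) (C t) a b) (Icc 0 T)
  lipschitz : ∀ s ∈ Icc 0 T, ∀ t ∈ Icc 0 T, ∀ a b,
    |gaugeSymbol (B s) (A s) a b - gaugeSymbol (B t) (A t) a b| ≤ κ * |s - t|

lemma isSymm_hessian {V : Space d → ℝ} (hV : ContDiff ℝ 2 V) (x : Space d) :
    (hessian V x).IsSymm := by
  ext i j
  have h := (hV.contDiffAt (x := x)).isSymmSndFDerivAt (by simp)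
  exact h _ _

variable {V V' : Space d → ℝ} {q p : ℝ → Space d} {α : ℝ → Matrix (Fin d) (Fin d) ℂ}
  {B : ℝ → Matrix (Fin d) (Fin d) ℝ}

/-- The Hessian along the trajectory is determined by the Riccati equation. -/
lemma IsGWPTFlow.hessian_eq (h : IsGWPTFlow V T q p α B) (h' : IsGWPTFlow V' T q p α B)
    (hT : 0 < T) {t : ℝ} (ht : t ∈ Icc 0 T) : hessian V (q t) = hessian V' (q t) := by
  ext i j
  have h1 := (uniqueDiffOn_Icc hT t ht).eq_deriv _ (h.deriv_α t ht i j) (h'.deriv_α t ht i j)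
  have h2 : ((hessian V (q t) i j : ℝ) : ℂ) = ((hessian V' (q t) i j : ℝ) : ℂ) := by
    linear_combination -2 * h1
  exact_mod_cast h2

lemma IsGWPTFlow.exists_isEllipticGauge (h : IsGWPTFlow V T q p α B) (hV : ContDiff ℝ 2 V)
    (hT : 0 ≤ T) : ∃ κ ν C C' A, IsEllipticGauge T κ ν p B C C' A fun t => hessian V (q t) := by
  obtain ⟨C, hBC, hC⟩ := h.exists_inverse hT
  have cC : ∀ i j, ContinuousOn (fun t => C t i j) (Icc 0 T) := fun i j t ht =>
    (hC t ht i j).continuousWithinAt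
  have cS : ∀ i j, ContinuousOn (fun t => hessian V (q t) i j) (Icc 0 T) := fun i j =>
    ((((hV.fderiv_right (m := 1) (by norm_num)).continuous_fderiv (by simp)).clm_apply
      continuous_const).clm_apply continuous_const).comp_continuousOn h.continuousOn_q
  have cC' : ∀ i j, ContinuousOn
      (fun t => (((2 : ℝ) • (α t).map Complex.re) * C t) i j) (Icc 0 T) :=
    continuousOn_mul_apply (fun i j => (h.continuousOn_re_α i j).const_smul (2 : ℝ)) cC
  have cN : ∀ i j, ContinuousOn (fun t => ((C t)ᵀ * hessian V (q t) * C t) i j) (Icc 0 T) :=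
    continuousOn_mul_apply (continuousOn_mul_apply (X := fun t => (C t)ᵀ) (fun i j => cC j i) cS) cC
  have cp : ContinuousOn p (Icc 0 T) := fun t ht => (h.deriv_p t ht).continuousWithinAt
  obtain ⟨ν, hν0, hν⟩ := exists_entry_bound cN
  have cR : ∀ i j, ContinuousOn
      (fun t => gaugeRate (8 + d * ν) (hessian V (q t)) (C t) i j) (Icc 0 T) := fun i j =>
    continuousOn_const.add (cN i j)
  obtain ⟨F, hF0, hFeq, hF⟩ := exists_antiderivative hT
    (f := fun (ij : Fin d × Fin d) t => gaugeRate (8 + d * ν) (hessian V (q t)) (C t) ij.1 ij.2)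
    fun ij => cR ij.1 ij.2
  set A : ℝ → Matrix (Fin d) (Fin d) ℝ := fun t => Matrix.of fun i j => F (i, j) t
  have hA : ∀ t ∈ Icc 0 T, ∀ i j, HasDerivWithinAt (fun s => A s i j)
      (gaugeRate (8 + d * ν) (hessian V (q t)) (C t) i j) (Icc 0 T) t := fun t ht i j =>
    hF (i, j) t ht
  have cA : ∀ i j, ContinuousOn (fun t => A t i j) (Icc 0 T) := fun i j t ht =>
    (hA t ht i j).continuousWithinAt
  have cG : ∀ a b, ContinuousOn (fun t =>
      ellipticSymbol (8 + d * ν) (B t) (A t) (hessian V (q t)) (C t) a b) (Icc 0 T) := fun a b => by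
    refine (continuousOn_gaugeSymbol h.continuousOn_B cA a b).add ?_
    rcases a with i | i <;> rcases b with j | j
    · exact continuousOn_const
    · exact continuousOn_const
    · exact continuousOn_const
    · exact continuousOn_const.mul (cR i j)
  obtain ⟨k1, k10, hk1⟩ := exists_entry_bound h.continuousOn_B
  obtain ⟨k2, k20, hk2⟩ := exists_entry_bound cC
  obtain ⟨k3, k30, hk3⟩ := exists_entry_bound cC'
  obtain ⟨k4, hk4⟩ := isCompact_Icc.exists_bound_of_continuousOn cp
  obtain ⟨k5, k50, hk5⟩ := exists_entry_bound cS
  obtain ⟨k6, k60, hk6⟩ := exists_entry_bound cA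
  obtain ⟨k7, k70, hk7⟩ := exists_entry_bound cG
  obtain ⟨k8, k80, hk8⟩ := IsLipOn.exists_common (isLipOn_gaugeSymbol
    (fun i j => .of_hasDerivWithinAt (fun t ht => h.deriv_B t ht i j)
      (continuousOn_const.mul (continuousOn_mul_apply h.continuousOn_B h.continuousOn_re_α i j)))
    fun i j => .of_hasDerivWithinAt (fun t ht => hA t ht i j) (cR i j))
  have k40 : 0 ≤ k4 := (norm_nonneg _).trans (hk4 0 ⟨le_rfl, hT⟩)
  refine ⟨k1 + k2 + k3 + k4 + k5 + k6 + k7 + k8, ν, C,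
    fun t => ((2 : ℝ) • (α t).map Complex.re) * C t, A, ?_⟩
  exact
    { nonneg := by positivity
      mul_eq_one := hBC
      deriv_C := hC
      zero := by ext i j; exact hF0 (i, j)
      symm := fun t => by
        ext i j
        refine congrFun (hFeq (j, i) (i, j) (funext fun s => ?_)) t
        exact (isSymm_gaugeRate _ (isSymm_hessian hV (q s)) (C s)).apply i j
      symm_S := fun t => isSymm_hessian hV (q t)
      deriv_A := hA
      bound_B := fun t ht i j => (hk1 t ht i j).trans (by linarith)
      bound_C := fun t ht i j => (hk2 t ht i j).trans (by linarith)
      bound_C' := fun t ht i j => (hk3 t ht i j).trans (by linarith)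
      bound_p := fun t ht => (hk4 t ht).trans (by linarith)
      bound_S := fun t ht i j => (hk5 t ht i j).trans (by linarith)
      bound_A := fun t ht i j => (hk6 t ht i j).trans (by linarith)
      bound_rate := hν
      bound_symbol := fun t ht a b => (hk7 t ht a b).trans (by linarith)
      continuousOn_symbol := cG
      lipschitz := fun s hs t ht a b => (hk8 s hs t ht a b).trans
        (mul_le_mul_of_nonneg_right (by linarith) (abs_nonneg _)) }

end EllipticGauge


/-! ### The weighted bound for the gradient -/

section WeightedBound

open Filter Topology

variable {d : ℕ} {ε T M κ ν : ℝ} {V : Space d → ℝ} {q p : ℝ → Space d}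
  {α : ℝ → Matrix (Fin d) (Fin d) ℂ} {B C C' A S : ℝ → Matrix (Fin d) (Fin d) ℝ}
  {w : ℝ → Lp ℂ 2 (volume : Measure (Space d))}

lemma ellipticSymbol_eq (μ : ℝ) (B A S C : Matrix (Fin d) (Fin d) ℝ) :
    ellipticSymbol μ B A S C
      = gaugeSymbol B A + Matrix.fromBlocks 0 0 0 ((8 : ℝ)⁻¹ • μ • (1 : Matrix (Fin d) (Fin d) ℝ))
        + Matrix.fromBlocks 0 0 0 ((8 : ℝ)⁻¹ • (Cᵀ * S * C)) := by
  rw [ellipticSymbol, gaugeRate, add_assoc, Matrix.fromBlocks_add, smul_add]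
  simp

namespace IsEllipticGauge

/-- In the elliptic gauge the rate of the phase combines with the residual potential to the Taylor
remainder of first order, which is Lipschitz in time with a constant that does not involve third
derivatives of the potential. -/
lemma norm_fullOp_sub_le (hg : IsEllipticGauge T κ ν p B C C' A S) (h : IsGWPTFlow V T q p α B)
    (hV : ContDiff ℝ 2 V) (hε : 0 < ε) (hε1 : ε ≤ 1) (hM0 : 0 ≤ M)
    (hS : ∀ t ∈ Icc 0 T, hessian V (q t) = S t)
    (hM : ∀ t ∈ Icc 0 T, ∀ η, |√ε * residualPotential ε V (q t) (B t) η| ≤ M)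
    (hM' : ∀ t ∈ Icc 0 T, ∀ η, ‖gradient (residualPotential ε V (q t) (B t)) η‖ ≤ M)
    {s t : ℝ} (hs : s ∈ Icc 0 T) (ht : t ∈ Icc 0 T) (φ : 𝓢(Space d, ℂ)) :
    ‖fullOp (ellipticSymbol (8 + d * ν) (B s) (A s) (S s) (C s))
          (fun η => √ε * residualPotential ε V (q s) (B s) η) φ
        - fullOp (ellipticSymbol (8 + d * ν) (B t) (A t) (S t) (C t))
          (fun η => √ε * residualPotential ε V (q t) (B t) η) φ‖
      ≤ (κ + (M * (d ^ 2 * κ * (κ + d ^ 2 * κ)) + d ^ 2 * κ * (d ^ 2 * κ) ^ 2))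
        * (4 * d ^ 2 + d + 1) * |s - t| * (norm₂ (toL2 d) (phaseOp d) φ + ‖toL2 d φ‖) := by
  have hκ := hg.nonneg
  set Z : ℝ := M * (d ^ 2 * κ * (κ + d ^ 2 * κ)) + d ^ 2 * κ * (d ^ 2 * κ) ^ 2 with hZ
  have hZ0 : 0 ≤ Z := by positivity
  have htot : ∀ r ∈ Icc 0 T, ∀ η, 4 * quadForm ((8 : ℝ)⁻¹ • ((C r)ᵀ * S r * C r)) η
      + √ε * residualPotential ε V (q r) (B r) η
      = totalPotential ε V (q r) (Matrix.toEuclideanCLM (𝕜 := ℝ) (B r)⁻¹ η) := fun r hr η => by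
    rw [totalPotential_eq hV hε, hS r hr, Matrix.inv_eq_right_inv (hg.mul_eq_one r hr)]
  have hW : ∀ η, |(4 * quadForm ((8 : ℝ)⁻¹ • ((C s)ᵀ * S s * C s)) η
      + √ε * residualPotential ε V (q s) (B s) η)
      - (4 * quadForm ((8 : ℝ)⁻¹ • ((C t)ᵀ * S t * C t)) η
        + √ε * residualPotential ε V (q t) (B t) η)| ≤ (κ + Z) * |s - t| * (1 + ‖η‖ ^ 2) :=
    fun η => by
      rw [htot s hs, htot t ht]
      refine (h.abs_totalPotential_sub_le hV hε hε1 hκ hM0 hg.mul_eq_one hg.deriv_C hg.bound_B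
        hg.bound_C hg.bound_C' hg.bound_p (fun t ht => by rw [hS t ht]; exact hg.bound_S t ht) hM'
        hs ht η).trans ?_
      rw [← hZ]
      gcongr
      linarith
  rw [ellipticSymbol_eq, ellipticSymbol_eq]
  refine (_root_.norm_fullOp_sub_le (M := M) (δ := (κ + Z) * |s - t|) (by positivity)
    (continuous_const.mul (continuous_residualPotential hV ε _ _))
    (continuous_const.mul (continuous_residualPotential hV ε _ _)) (hM s hs) (hM t ht)
    (fun a b => ?_) hW φ).trans_eq (by ring)
  rw [Matrix.add_apply, Matrix.add_apply, add_sub_add_right_eq_sub]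
  refine (hg.lipschitz s hs t ht a b).trans ?_
  gcongr
  linarith

lemma isRegularHamiltonian (hg : IsEllipticGauge T κ ν p B C C' A S)
    (h : IsGWPTFlow V T q p α B) (hT : 0 ≤ T) (hV : ContDiff ℝ 2 V) (hε1 : ε ≤ 1)
    (hM : ∀ t ∈ Icc 0 T, ∀ η, |residualPotential ε V (q t) (B t) η| ≤ M) :
    IsRegularHamiltonian T M (fun t => ellipticSymbol (8 + d * ν) (B t) (A t) (S t) (C t))
      (fun t η => √ε * residualPotential ε V (q t) (B t) η) := by
  refine h.isRegularHamiltonian hT hV hε1 hM (fun t _ => ?_) hg.continuousOn_symbol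
  rw [Matrix.IsSymm, ellipticSymbol, Matrix.transpose_add, (isSymm_gaugeSymbol _ _).eq,
    Matrix.fromBlocks_transpose, Matrix.transpose_smul, (isSymm_gaugeRate _ (hg.symm_S t) _).eq,
    Matrix.transpose_zero]

/-- The symbol in the elliptic gauge is positive definite, so that Gårding's inequality applies. -/
lemma norm₂_hermiteRep_le (hg : IsEllipticGauge T κ ν p B C C' A S) (hM0 : 0 ≤ M)
    {W : ℝ → Space d → ℝ} (hR : IsRegularHamiltonian T M
      (fun t => ellipticSymbol (8 + d * ν) (B t) (A t) (S t) (C t)) W) {t : ℝ} (ht : t ∈ Icc 0 T)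
    {n : ℕ} (x : hermiteL2 d n) :
    norm₂ (toL2 d) (phaseOp d) (hermiteRep d n x)
      ≤ √(2 * d) / (4 * d ^ 2 * κ ^ 2 + 1)⁻¹ * (1 + M + 4 * κ * (2 * d) ^ 2)
        * (‖galerkinOp n (ellipticSymbol (8 + d * ν) (B t) (A t) (S t) (C t)) (W t) x‖ + ‖x‖) :=
  _root_.norm₂_hermiteRep_le (by positivity) hg.nonneg hM0 (hg.bound_symbol t ht)
    (gaugeSymbol_add_pos (hg.mul_eq_one t ht) (hg.bound_C t ht) (hg.bound_A t ht)
      (le_re_sum_gaugeRate (hg.bound_rate t ht)))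
    (hR.continuous_potential t ht) (hR.bound t ht) x

end IsEllipticGauge

lemma IsWSolution.norm₂_initial (h : IsWSolution ε V T q B w) {φ : 𝓢(Space d, ℂ)}
    (hφ : toL2 d φ = w 0) : norm₂ (toL2 d) (phaseOp d) φ
      = norm₂ (toL2 d) (phaseOp d) (groundState d) / ‖toL2 d (groundState d)‖ * ‖w 0‖ := by
  have h1 : ∀ a c, ‖toL2 d (phaseOp d a (phaseOp d c φ))‖
      = (‖w 0‖ / ‖toL2 d (groundState d)‖)
        * ‖toL2 d (phaseOp d a (phaseOp d c (groundState d)))‖ := fun a c => by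
    have := h.norm_toL2_initial (phaseOp d a ∘ₗ phaseOp d c) hφ
    rw [LinearMap.comp_apply, LinearMap.comp_apply] at this
    rw [this]
    ring
  rw [norm₂]
  simp only [h1, mul_pow, ← Finset.mul_sum]
  rw [Real.sqrt_mul (by positivity), Real.sqrt_sq (by positivity), norm₂]
  ring

/-- In an elliptic gauge the solution is a limit of Schwartz functions with second order bounds that
do not depend on `ε`. -/
lemma IsEllipticGauge.exists_tendsto (hg : IsEllipticGauge T κ ν p B C C' A S) (hT : 0 ≤ T)
    (M : ℝ) : ∃ Q, ∀ (ε : ℝ) (V : Space d → ℝ) (q : ℝ → Space d)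
      (α : ℝ → Matrix (Fin d) (Fin d) ℂ) (w : ℝ → Lp ℂ 2 (volume : Measure (Space d))),
      0 < ε → ε ≤ 1 → ContDiff ℝ 2 V → IsGWPTFlow V T q p α B → IsWSolution ε V T q B w →
      (∀ t ∈ Icc 0 T, hessian V (q t) = S t) →
      (∀ t ∈ Icc 0 T, ∀ η, |residualPotential ε V (q t) (B t) η| ≤ M) →
      (∀ t ∈ Icc 0 T, ∀ η, ‖gradient (residualPotential ε V (q t) (B t)) η‖ ≤ M) →
      ∀ t ∈ Icc 0 T, ∃ z : ℕ → 𝓢(Space d, ℂ),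
        Tendsto (fun n => toL2 d (z n)) atTop (𝓝 (mulOp (phase (-A t)) (w t))) ∧
        ∀ n, ‖toL2 d (z n)‖ = ‖w 0‖ ∧ norm₂ (toL2 d) (phaseOp d) (z n) ≤ Q * ‖w 0‖ := by
  set K : ℝ := √(2 * d) / (4 * d ^ 2 * κ ^ 2 + 1)⁻¹ * (1 + M + 4 * κ * (2 * d) ^ 2) with hK
  set Λ : ℝ := (κ + (M * (d ^ 2 * κ * (κ + d ^ 2 * κ)) + d ^ 2 * κ * (d ^ 2 * κ) ^ 2))
    * (4 * d ^ 2 + d + 1) with hΛ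
  set c : ℝ := norm₂ (toL2 d) (phaseOp d) (groundState d) / ‖toL2 d (groundState d)‖
  have hκ := hg.nonneg
  refine ⟨K * (√((((2 * d) ^ 2 * κ * c + M) ^ 2 + 1) * Real.exp (3 * (Λ * (K + 1)) * T)) + 1),
    fun ε V q α w hε hε1 hV h hw hS hM hM' t ht => ?_⟩
  have h0T : (0 : ℝ) ∈ Icc 0 T := ⟨le_rfl, hT⟩
  have hM0 : 0 ≤ M := (abs_nonneg _).trans (hM 0 h0T 0)
  have hK0 : 0 ≤ K := by positivity
  have hΛ0 : 0 ≤ Λ := by positivity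
  have hR := hg.isRegularHamiltonian h hT hV hε1 hM
  have hweak := (hw.isWeakSolution
    (fun t _ => continuous_residualPotential hV ε (q t) (B t)) hR.bound).gauge
    hR.continuous_potential hR.bound (fun t _ => hg.symm t) hg.deriv_A
  have hw0 : mulOp (phase (-A 0)) (w 0) = w 0 := by
    rw [hg.zero, neg_zero, phase_zero, mulOp_one]
  have hlim := hweak.exists_tendsto_norm₂ hR hT hκ hg.bound_symbol (c := c)
    (fun n u hu hc t ht => hR.norm₂_galerkin_le hT hK0 hΛ0 hκ
      (fun t ht x => hg.norm₂_hermiteRep_le hM0 hR ht x)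
      (fun s hs t ht φ => hg.norm_fullOp_sub_le h hV hε hε1 hM0 hS hR.bound hM' hs ht φ)
      hg.bound_symbol hu hc ht)
    (by rw [hw0]; exact hw.initial_mem)
    (fun φ hφ => by rw [hw0] at hφ ⊢; exact (hw.norm₂_initial hφ).le)
    (fun s hs => by
      rw [norm_mulOp_phase, norm_mulOp_phase]; exact hw.norm_le hT hε1 hV h hM hs) ht
  simpa only [norm_mulOp_phase] using hlim

/-- Undoing the gauge turns the second order bounds into a bound for products of position and
momentum; the constant is the same for all potentials that have the given flow. -/
lemma IsGWPTFlow.exists_weighted_bound (h₀ : IsGWPTFlow V T q p α B) (hV₀ : ContDiff ℝ 2 V)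
    (hT : 0 < T) (M : ℝ) : ∃ Q, ∀ (ε : ℝ) (V : Space d → ℝ)
      (w : ℝ → Lp ℂ 2 (volume : Measure (Space d))),
      0 < ε → ε ≤ 1 → ContDiff ℝ 2 V → IsGWPTFlow V T q p α B → IsWSolution ε V T q B w →
      (∀ t ∈ Icc 0 T, ∀ η, |residualPotential ε V (q t) (B t) η| ≤ M) →
      (∀ t ∈ Icc 0 T, ∀ η, ‖gradient (residualPotential ε V (q t) (B t)) η‖ ≤ M) →
      ∀ t ∈ Icc 0 T, ∃ g : Space d → EuclideanSpace ℂ (Fin d), HasWeakGradient (w t) g ∧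
        eLpNorm (fun η => ‖η‖ * ‖g η‖) 2 volume ≤ ENNReal.ofReal (Q * ‖w 0‖) := by
  obtain ⟨κ, ν, C, C', A, hg⟩ := h₀.exists_isEllipticGauge hV₀ hT.le
  obtain ⟨Q, hQ⟩ := hg.exists_tendsto hT.le M
  refine ⟨d ^ 2 * ((1 + d * κ) * Q), fun ε V' w hε hε1 hV h hw hM hM' t ht => ?_⟩
  obtain ⟨z, hz, hz'⟩ := hQ ε V' q α w hε hε1 hV h hw (fun t ht => h.hessian_eq h₀ hT ht) hM hM'
    t ht
  have hκ := hg.nonneg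
  have h1 : Tendsto (fun n => toL2 d (phaseMul (A t) (z n))) atTop (𝓝 (w t)) := by
    have := ((mulOp (phase (A t))).continuous.tendsto _).comp hz
    simpa only [Function.comp_def, mulOp_phase_neg, mulOp_phase_toL2] using this
  have h2 : ∀ n a, ‖toL2 d (phaseOp d a (z n))‖ ≤ √(‖w 0‖ * (√(2 * d) * (Q * ‖w 0‖))) :=
    fun n a => Real.le_sqrt_of_sq_le ((norm_phaseOp_sq_le a (z n)).trans (by
      rw [(hz' n).1]
      gcongr
      exact (hz' n).2))
  obtain ⟨g, hg1, hg2⟩ := exists_hasWeakGradient_weighted_of_tendsto h1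
    (fun n a => norm_phaseOp_phaseMul_le (hg.symm t) hκ (hg.bound_A t ht) (h2 n) a)
    (C' := (1 + d * κ) * (Q * ‖w 0‖))
    (fun n k j => (norm_position_momentum_phaseMul_le (hg.symm t) (hg.bound_A t ht) (z n) k j).trans
      (by gcongr; exact (hz' n).2))
  refine ⟨g, hg1, hg2.trans_eq ?_⟩
  congr 1
  ring

end WeightedBound

theorem mainTheorem6 (d : ℕ) (T M : ℝ) (hT : 0 < T) :
    -- the constants in the first two estimates depend on `d`, `T`, `M` only
    (∃ C : ℝ, ∀ (ε : ℝ) (V : Space d → ℝ) (q p : ℝ → Space d)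
      (α : ℝ → Matrix (Fin d) (Fin d) ℂ) (B : ℝ → Matrix (Fin d) (Fin d) ℝ)
      (w : ℝ → Lp ℂ 2 (volume : Measure (Space d))),
      0 < ε → ε ≤ 1 → ContDiff ℝ 2 V → IsGWPTFlow V T q p α B → IsWSolution ε V T q B w →
      (∀ t ∈ Icc 0 T, ∀ η, |residualPotential ε V (q t) (B t) η| ≤ M) →
      ∀ t ∈ Icc 0 T, ‖w t‖ ≤ C * ε ^ (-(d : ℝ) / 4)) ∧
    (∃ C : ℝ, ∀ (ε : ℝ) (V : Space d → ℝ) (q p : ℝ → Space d)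
      (α : ℝ → Matrix (Fin d) (Fin d) ℂ) (B : ℝ → Matrix (Fin d) (Fin d) ℝ)
      (w : ℝ → Lp ℂ 2 (volume : Measure (Space d))),
      0 < ε → ε ≤ 1 → ContDiff ℝ 2 V → IsGWPTFlow V T q p α B → IsWSolution ε V T q B w →
      (∀ t ∈ Icc 0 T, ∀ η, |residualPotential ε V (q t) (B t) η| ≤ M) →
      (∀ t ∈ Icc 0 T, ∀ η, ‖gradient (residualPotential ε V (q t) (B t)) η‖ ≤ M) →
      ∀ t ∈ Icc 0 T, ∃ g : Space d → EuclideanSpace ℂ (Fin d), HasWeakGradient (w t) g ∧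
        eLpNorm g 2 volume + eLpNorm (fun η => ‖η‖ * ‖w t η‖) 2 volume
          ≤ ENNReal.ofReal (C * ε ^ (-(d : ℝ) / 4))) ∧
    -- the constant in the third estimate may also depend on the parameters `q`, `p`, `α`, `B`
    (∀ (q p : ℝ → Space d) (α : ℝ → Matrix (Fin d) (Fin d) ℂ)
      (B : ℝ → Matrix (Fin d) (Fin d) ℝ), ∃ C : ℝ, ∀ (ε : ℝ) (V : Space d → ℝ)
      (w : ℝ → Lp ℂ 2 (volume : Measure (Space d))),
      0 < ε → ε ≤ 1 → ContDiff ℝ 2 V → IsGWPTFlow V T q p α B → IsWSolution ε V T q B w →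
      (∀ t ∈ Icc 0 T, ∀ η, |residualPotential ε V (q t) (B t) η| ≤ M) →
      (∀ t ∈ Icc 0 T, ∀ η, ‖gradient (residualPotential ε V (q t) (B t)) η‖ ≤ M) →
      ∀ t ∈ Icc 0 T, ∃ g : Space d → EuclideanSpace ℂ (Fin d), HasWeakGradient (w t) g ∧
        eLpNorm (fun η => ‖η‖ * ‖g η‖) 2 volume
          ≤ ENNReal.ofReal (C * ε ^ (-(d : ℝ) / 4))) := by
  refine ⟨⟨1, fun ε V q p α B w hε hε1 hV h hw hM t ht => ?_⟩,
    ⟨2 * d * √((∑ a, (‖toL2 d (phaseOp d a (groundState d))‖ / ‖toL2 d (groundState d)‖) ^ 2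
      + d * M ^ 2) * Real.exp T), fun ε V q p α B w hε hε1 hV h hw hM hM' t ht => ?_⟩,
    fun q p α B => ?_⟩
  · rw [one_mul, ← hw.norm_initial hε]
    exact hw.norm_le hT.le hε1 hV h hM ht
  · obtain ⟨z, hz, hz'⟩ := hw.exists_tendsto_energy hT.le hε hε1 hV h hM hM' ht
    obtain ⟨g, hg, hg'⟩ := exists_hasWeakGradient_of_tendsto hz hz'
    refine ⟨g, hg, hg'.trans_eq ?_⟩
    rw [hw.norm_initial hε, ← mul_assoc]
  · -- the elliptic gauge depends on the potential only through its Hessian along the trajectory,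
    -- which any potential with this flow determines
    by_cases hex : ∃ V₀ : Space d → ℝ, ContDiff ℝ 2 V₀ ∧ IsGWPTFlow V₀ T q p α B
    · obtain ⟨V₀, hV₀, h₀⟩ := hex
      obtain ⟨Q, hQ⟩ := h₀.exists_weighted_bound hV₀ hT M
      refine ⟨Q, fun ε V w hε hε1 hV h hw hM hM' t ht => ?_⟩
      rw [← hw.norm_initial hε]
      exact hQ ε V w hε hε1 hV h hw hM hM' t ht
    · exact ⟨0, fun ε V w _ _ hV h => absurd ⟨V, hV, h⟩ hex⟩
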